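/- Let $k$ be an algebraically closed field, $A$ a finite-dimensional (associative, unital) $k$-algebra, and $G$ a finite group acting on $A$ by $k$-algebra automorphisms such that $|G|$ is invertible in $k$. Modules are finite-dimensional left modules. The skew group algebra $A*G$ is $A\otimes_k kG$ with product $(a\otimes g)(a'\otimes g')=a\,g(a')\otimes gg'$. **Definitions.** Let $\mathrm{Sim}(A)$ be a set of representatives of the isomorphism classes of simple $A$-modules, let $P_L$ be a projective cover of $L\in\mathrm{Sim}(A)$, and let $\le$ be a partial order on $\mathrm{Sim}(A)$. For semisimple modules $M,N$ write $M<N$ if $L<L'$ for all simple direct summands $L$ of $M$ and $L'$ of $N$. The standard modules are $$\Delta_L:=P_L\Big/\sum_{L'\not\le L,\ \varphi\in\mathrm{Hom}_A(P_{L'},P_L)}\mathrm{im}\,\varphi .$$ The order $\le$ is *adapted* if every module $M$ with simple top $L$ and simple socle $L'$ such that $L,L'$ are incomparable has a composition factor $L''$ with $L''>L$ and $L''>L'$. The pair $(A,\le)$ is - *quasi-hereditary* if $\le$ is adapted, the left module $A$ has a finite filtration with subquotients isomorphic to standard modules, and $\mathrm{Ext}^1_A(\Delta_L,\Delta_L)=0$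 and $\mathrm{End}_A(\Delta_L)\cong k$ for all $L$; - *strongly quasi-hereditary* if it is quasi-hereditary and every $\Delta_L$ has projective dimension at most $1$; - *directed* if $\le$ is adapted and $\Delta_L\cong L$ for all $L$. The same definitions are used for $A*G$. For $g\in G$ and an $A$-module $M$, let $gM$ be $M$ with action $a\cdot m:=g^{-1}(a)m$; let $kG\otimes M$ be the $A*G$-module with $g'(g\otimes m)=g'g\otimes m$ and $a(g\otimes m)=g\otimes g^{-1}(a)m$. For an $A*G$-module $S$ and a $kG$-module $V$, let $S\otimes V$ be the $A*G$-module with $g(s\otimes v)=gs\otimes gv$ and $a(s\otimes v)=as\otimes v$. A partial order $\le_A$ on $\mathrm{Sim}(A)$ is *$G$-equivariant* if $L<_AL'\Leftrightarrow gL<_AhL'$ for all $L,L'$ and all $g,h\in G$. A partial order $\le_{A*G}$ on $\mathrm{Sim}(A*G)$ is *$G$-stable* if $S<_{A*G}S'\Leftrightarrow S\otimes V<_{A*G}S'\otimes W$ for all $S,S'$ and all nonzero $kG$-modules $V,W$. **Theorem.** Suppose that either - $\le_A$ is a $G$-equivariant partial order on $\mathrm{Sim}(A)$, and $\le_{A*G}$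 is the induced partial order on $\mathrm{Sim}(A*G)$, given by $S<_{A*G}S'$ iff ${}_{A|}S<_A{}_{A|}S'$ (restrictions to $A$); or - $\le_{A*G}$ is a $G$-stable partial order on $\mathrm{Sim}(A*G)$, and $\le_A$ is the induced partial order on $\mathrm{Sim}(A)$, given by $L<_AL'$ iff $kG\otimes L<_{A*G}kG\otimes L'$. Then: 1. $(A,\le_A)$ is quasi-hereditary if and only if $(A*G,\le_{A*G})$ is quasi-hereditary. 2. $(A,\le_A)$ is strongly quasi-hereditary if and only if $(A*G,\le_{A*G})$ is strongly quasi-hereditary. 3. $(A,\le_A)$ is directed if and only if $(A*G,\le_{A*G})$ is directed. -/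

import Mathlib

/-!
Modules are left modules.  For a finite-dimensional algebra `A` over a field `k`, a module is
finite-dimensional over `k` iff it is finitely generated over `A`, i.e. `Module.Finite A M`.
-/

namespace QuasiHereditary

universe u v w

section Modules

variable (A : Type u) [Ring A]

/-- Maximal left ideals `m`, `n` of `A` are identified if `A / m` and `A / n` are isomorphic. -/
def simSetoid : Setoid {m : Submodule A A // IsCoatom m} where
  r m n := Nonempty ((A ⧸ m.1) ≃ₗ[A] (A ⧸ n.1))
  iseqv := ⟨fun _ => ⟨LinearEquiv.refl A _⟩, fun ⟨e⟩ => ⟨e.symm⟩, fun ⟨e⟩ ⟨f⟩ => ⟨e.trans f⟩⟩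

/-- The set of isomorphism classes of simple `A`-modules, each simple module being isomorphic to
`A / m` for a maximal left ideal `m`; see `Sim.existsUnique`. -/
def Sim : Type u := Quotient (simSetoid A)

variable {A}

/-- The chosen representative of a class of simple `A`-modules. -/
abbrev Sim.module (L : Sim A) : Type u := A ⧸ (Quotient.out L).1

instance (L : Sim A) : IsSimpleModule A L.module :=
  isSimpleModule_iff_isCoatom.2 (Quotient.out L).2

theorem Sim.ext {L L' : Sim A} (h : Nonempty (L.module ≃ₗ[A] L'.module)) : L = L' := by
  rw [← Quotient.out_eq L, ← Quotient.out_eq L']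
  exact Quotient.sound h

/-- Every simple module is isomorphic to exactly one of the chosen representatives. -/
theorem Sim.existsUnique (M : Type*) [AddCommGroup M] [Module A M] [IsSimpleModule A M] :
    ∃! L : Sim A, Nonempty (M ≃ₗ[A] L.module) := by
  obtain ⟨m, hm, ⟨e⟩⟩ := isSimpleModule_iff_quot_maximal.1 (inferInstance : IsSimpleModule A M)
  let L : Sim A := Quotient.mk (simSetoid A) ⟨m, hm.out⟩
  obtain ⟨f⟩ : Nonempty ((A ⧸ (Quotient.out L).1) ≃ₗ[A] (A ⧸ m)) :=
    Quotient.exact (Quotient.out_eq L)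
  refine ⟨L, ⟨e.trans f.symm⟩, ?_⟩
  rintro L' ⟨e'⟩
  exact Sim.ext ⟨e'.symm.trans (e.trans f.symm)⟩

/-- The top `M / rad M`. -/
abbrev ModTop (A : Type*) [Ring A] (M : Type*) [AddCommGroup M] [Module A M] : Type _ :=
  M ⧸ Module.jacobson A M

/-- The socle: the sum of all simple submodules. -/
def socle (A : Type*) [Ring A] (M : Type*) [AddCommGroup M] [Module A M] : Submodule A M :=
  sSup {N : Submodule A M | IsSimpleModule A N}

/-- `L` is a composition factor of `M`: it embeds into a factor module of `M`. -/
def IsCompositionFactor (L : Sim A) (M : Type*) [AddCommGroup M] [Module A M] : Prop :=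
  ∃ (N : Submodule A M) (f : L.module →ₗ[A] M ⧸ N), Function.Injective f

/-- `N ∣ M`: `N` is isomorphic to a direct summand of `M`. -/
def IsSummand (A : Type*) [Ring A] (N M : Type*) [AddCommGroup N] [Module A N]
    [AddCommGroup M] [Module A M] : Prop :=
  ∃ (i : N →ₗ[A] M) (p : M →ₗ[A] N), p ∘ₗ i = LinearMap.id

/-- `π : P → M` is a projective cover: `P` is projective and `π` is surjective with superfluous
kernel. -/
structure IsProjectiveCover {P M : Type*} [AddCommGroup P] [Module A P] [AddCommGroup M]
    [Module A M] (π : P →ₗ[A] M) : Prop where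
  projective : Module.Projective A P
  surjective : Function.Surjective π
  superfluous : ∀ N : Submodule A P, N ⊔ LinearMap.ker π = ⊤ → N = ⊤

theorem exists_isProjectiveCover (k : Type*) [Field k] [Algebra k A]
    [FiniteDimensional k A] (L : Sim A) :
    ∃ (P : Submodule A A) (π : P →ₗ[A] L.module), IsProjectiveCover π := by
  have : IsArtinianRing A := IsArtinianRing.of_finite k A
  let T : Set (Submodule A A) :=
    {P | Module.Projective A P ∧ ∃ π : P →ₗ[A] L.module, Function.Surjective π}
  have hT : T.Nonempty := by
    refine ⟨⊤, Module.Projective.of_equiv (Submodule.topEquiv (R := A) (M := A)).symm,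
      (Submodule.mkQ _) ∘ₗ (Submodule.topEquiv (R := A) (M := A)).toLinearMap, ?_⟩
    exact (Submodule.mkQ_surjective _).comp (Submodule.topEquiv (R := A) (M := A)).surjective
  obtain ⟨P, ⟨hP, π, hπ⟩, hmin⟩ := IsArtinian.set_has_minimal T hT
  refine ⟨P, π, hP, hπ, fun N hN => ?_⟩
  have hs : Function.Surjective (π ∘ₗ N.subtype) := by
    intro y
    obtain ⟨x, rfl⟩ := hπ y
    obtain ⟨a, ha, b, hb, rfl⟩ := Submodule.mem_sup.1 (hN ▸ Submodule.mem_top (x := x))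
    exact ⟨⟨a, ha⟩, by simpa using hb⟩
  obtain ⟨φ, hφ⟩ := Module.projective_lifting_property (π ∘ₗ N.subtype) π hs
  let f : Module.End A P := N.subtype ∘ₗ φ
  have hf : ∀ x, π (f x) = π x := fun x => LinearMap.congr_fun hφ x
  have hfn : ∀ n x, π ((f ^ n) x) = π x := by
    intro n
    induction n with
    | zero => simp
    | succ n ih => intro x; rw [pow_succ', Module.End.mul_apply, hf, ih]
  obtain ⟨n, hn⟩ := (LinearMap.eventually_isCompl_ker_pow_range_pow f).exists_forall_of_atTop
  specialize hn (n + 1) (Nat.le_succ n)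
  set R := LinearMap.range (f ^ (n + 1)) with hR
  have hRp : Module.Projective A R :=
    Module.Projective.of_split R.subtype (Submodule.projectionOnto _ _ hn.symm)
      (by ext x : 1; exact Submodule.projectionOnto_apply_left hn.symm x)
  have hmem : R.map P.subtype ∈ T := by
    have e := Submodule.equivMapOfInjective P.subtype P.injective_subtype R
    refine ⟨Module.Projective.of_equiv e, (π ∘ₗ R.subtype) ∘ₗ e.symm.toLinearMap, ?_⟩
    intro y
    obtain ⟨x, rfl⟩ := hπ y
    refine ⟨e ⟨(f ^ (n + 1)) x, x, rfl⟩, ?_⟩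
    simpa using hfn _ x
  have hRtop : R = ⊤ := by
    have hle : R.map P.subtype ≤ P := Submodule.map_subtype_le _ _
    have heq : R.map P.subtype = P := by
      by_contra hne
      exact hmin _ hmem (lt_of_le_of_ne hle hne)
    rw [eq_top_iff]
    rintro x -
    have : (x : A) ∈ R.map P.subtype := by rw [heq]; exact x.2
    obtain ⟨y, hy, hyx⟩ := this
    have : y = x := Subtype.ext hyx
    exact this ▸ hy
  rw [eq_top_iff, ← hRtop]
  rintro _ ⟨x, rfl⟩
  rw [pow_succ', Module.End.mul_apply]
  exact (φ _).2

end Modules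

section QuasiHereditary

variable {A : Type u} [Ring A]

/-- A partial order on `Sim A` is adapted if every module `M` with simple top `L` and simple socle
`L'` such that `L`, `L'` are incomparable has a composition factor `L''` with `L'' > L` and
`L'' > L'`. -/
def IsAdapted (o : PartialOrder (Sim A)) : Prop :=
  ∀ (M : Type u) [AddCommGroup M] [Module A M] [Module.Finite A M] (L L' : Sim A),
    Nonempty (ModTop A M ≃ₗ[A] L.module) → Nonempty (socle A M ≃ₗ[A] L'.module) →
    ¬ o.le L L' → ¬ o.le L' L →
    ∃ L'' : Sim A, IsCompositionFactor L'' M ∧ o.lt L L'' ∧ o.lt L' L''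

/-- `M` has a finite filtration `0 = M₀ ⊆ M₁ ⊆ ⋯ ⊆ Mₘ = M` all of whose subquotients `Mᵢ₊₁ / Mᵢ`
are isomorphic to members of the family `Δ`. -/
def HasFiltration {ι : Type*} (Δ : ι → Type*) [∀ i, AddCommGroup (Δ i)] [∀ i, Module A (Δ i)]
    (M : Type*) [AddCommGroup M] [Module A M] : Prop :=
  ∃ (m : ℕ) (F : Fin (m + 1) → Submodule A M), Monotone F ∧ F 0 = ⊥ ∧ F (Fin.last m) = ⊤ ∧
    ∀ j : Fin m, ∃ i : ι,
      Nonempty ((F j.succ ⧸ (F j.castSucc).submoduleOf (F j.succ)) ≃ₗ[A] Δ i)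

variable (k : Type w) [Field k] [Algebra k A]

/-- `M` is exceptional: `Ext¹(M, M) = 0` and `End(M) ≅ k` as `k`-algebras. -/
def IsExceptional (M : Type u) [AddCommGroup M] [Module A M] [Module k M]
    [IsScalarTower k A M] : Prop :=
  Subsingleton (CategoryTheory.Abelian.Ext (ModuleCat.of A M) (ModuleCat.of A M) 1) ∧
    Nonempty (Module.End A M ≃ₐ[k] k)

variable [FiniteDimensional k A]

/-- The (carrier of the) projective cover `P_L` of the simple module `L`, chosen as a left ideal. -/
noncomputable def projCover (L : Sim A) : Submodule A A :=
  (exists_isProjectiveCover k L).choose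

/-- The covering map `P_L → L`. -/
noncomputable def projCoverMap (L : Sim A) : projCover k L →ₗ[A] L.module :=
  (exists_isProjectiveCover k L).choose_spec.choose

theorem projCoverMap_isProjectiveCover (L : Sim A) : IsProjectiveCover (projCoverMap k L) :=
  (exists_isProjectiveCover k L).choose_spec.choose_spec

/-- The sum of the images of all homomorphisms `P_{L'} → P_L` with `L' ≰ L`. -/
noncomputable def standardKer (o : PartialOrder (Sim A)) (L : Sim A) :
    Submodule A (projCover k L) :=
  ⨆ (L' : Sim A) (_ : ¬ o.le L' L) (φ : projCover k L' →ₗ[A] projCover k L), LinearMap.range φ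

/-- The standard module `Δ_L`. -/
abbrev Standard (o : PartialOrder (Sim A)) (L : Sim A) : Type u :=
  projCover k L ⧸ standardKer k o L

/-- `(A, ≤)` is left standardly stratified: `≤` is adapted and `A` has a filtration by standard
modules. -/
def IsLeftStandardlyStratified (o : PartialOrder (Sim A)) : Prop :=
  IsAdapted o ∧ HasFiltration (A := A) (Standard k o) A

/-- `(A, ≤)` is quasi-hereditary. -/
def IsQuasiHereditary (o : PartialOrder (Sim A)) : Prop :=
  IsLeftStandardlyStratified k o ∧ ∀ L : Sim A, IsExceptional (A := A) k (Standard k o L)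

/-- `(A, ≤)` is strongly quasi-hereditary: it is quasi-hereditary and the standard modules have
projective dimension at most one. -/
def IsStronglyQuasiHereditary (o : PartialOrder (Sim A)) : Prop :=
  IsQuasiHereditary k o ∧ ∀ L : Sim A,
    CategoryTheory.HasProjectiveDimensionLE (ModuleCat.of A (Standard k o L)) 1

/-- `(A, ≤)` is directed: `≤` is adapted and `Δ_L ≅ L` for all `L`. -/
def IsDirectedAlgebra (o : PartialOrder (Sim A)) : Prop :=
  IsAdapted o ∧ ∀ L : Sim A, Nonempty (Standard k o L ≃ₗ[A] L.module)

end QuasiHereditary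

/-!
The skew group algebra `A * G` is `SkewMonoidAlgebra A G`, with basis elements `single g a`
(i.e. `a ⊗ g`) and product `single g a * single h b = single (g * h) (a * g • b)`.
-/

section SkewModules

open SkewMonoidAlgebra TensorProduct

/-- The restriction of a module along a ring homomorphism. -/
def Res {R B : Type*} [Ring R] [Ring B] (_f : R →+* B) (M : Type*) : Type _ := M

instance {R B : Type*} [Ring R] [Ring B] (f : R →+* B) (M : Type*) [AddCommGroup M] :
    AddCommGroup (Res f M) :=
  inferInstanceAs (AddCommGroup M)

instance {R B : Type*} [Ring R] [Ring B] (f : R →+* B) (M : Type*) [AddCommGroup M]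
    [Module B M] : Module R (Res f M) :=
  Module.compHom M f

variable {A : Type u} [Ring A] {G : Type v} [Group G] [MulSemiringAction G A]

/-- The twisted module `gM`: the group `M` on which `a` acts as `g⁻¹ • a` does on `M`. -/
abbrev Twist (g : G) (M : Type*) : Type _ := Res (MulSemiringAction.toRingHom G A g⁻¹) M

variable (A G) in
/-- The restriction of an `A * G`-module to `A`. -/
abbrev ResG (M : Type*) : Type _ :=
  Res (singleOneRingHom : A →+* SkewMonoidAlgebra A G) M

/-- The induced module `kG ⊗ M`, with `Ind.single g m` in the role of `g ⊗ m`; the action of `A * G`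
is given by `h (g ⊗ m) = hg ⊗ m` and `a (g ⊗ m) = g ⊗ g⁻¹(a) m`. -/
def Ind (G : Type*) (M : Type*) [AddCommGroup M] : Type _ := G →₀ M

noncomputable instance (M : Type*) [AddCommGroup M] : AddCommGroup (Ind G M) :=
  inferInstanceAs (AddCommGroup (G →₀ M))

/-- The element `g ⊗ m`. -/
noncomputable def Ind.single {M : Type*} [AddCommGroup M] (g : G) (m : M) : Ind G M :=
  Finsupp.single g m

/-- The map `g ⊗ m ↦ g ⊗ g⁻¹(a) m`. -/
noncomputable def Ind.coeffHom (M : Type*) [AddCommGroup M] [Module A M] (a : A) :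
    (G →₀ M) →+ (G →₀ M) :=
  Finsupp.liftAddHom fun g =>
    (Finsupp.singleAddHom g).comp (DistribSMul.toAddMonoidHom M (g⁻¹ • a))

theorem Ind.coeffHom_single {M : Type*} [AddCommGroup M] [Module A M] (a : A) (g : G) (m : M) :
    Ind.coeffHom M a (Finsupp.single g m) = Finsupp.single g ((g⁻¹ • a) • m) := by
  simp [Ind.coeffHom]

/-- The action of `A`. -/
noncomputable def Ind.coeffEnd (M : Type*) [AddCommGroup M] [Module A M] :
    A →+* AddMonoid.End (G →₀ M) where
  toFun a := Ind.coeffHom M a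
  map_one' := by
    refine Finsupp.addHom_ext fun g m => ?_
    change Ind.coeffHom M 1 _ = Finsupp.single g m
    simp [Ind.coeffHom_single]
  map_mul' a b := by
    refine Finsupp.addHom_ext fun g m => ?_
    change Ind.coeffHom M _ _ = Ind.coeffHom M a (Ind.coeffHom M b _)
    simp [Ind.coeffHom_single, mul_smul]
  map_zero' := by
    refine Finsupp.addHom_ext fun g m => ?_
    change Ind.coeffHom M 0 _ = 0
    simp [Ind.coeffHom_single]
  map_add' a b := by
    refine Finsupp.addHom_ext fun g m => ?_
    change Ind.coeffHom M _ _ = Ind.coeffHom M a _ + Ind.coeffHom M b _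
    simp [Ind.coeffHom_single, add_smul]

/-- The action `g ⊗ m ↦ hg ⊗ m` of the group. -/
noncomputable def Ind.groupEnd (M : Type*) [AddCommGroup M] : G →* AddMonoid.End (G →₀ M) where
  toFun h := Finsupp.mapDomain.addMonoidHom (h * ·)
  map_one' := by
    refine Finsupp.addHom_ext fun g m => ?_
    change Finsupp.mapDomain _ _ = Finsupp.single g m
    simp
  map_mul' h h' := by
    refine Finsupp.addHom_ext fun g m => ?_
    change Finsupp.mapDomain _ _ = Finsupp.mapDomain _ (Finsupp.mapDomain _ _)
    simp [mul_assoc]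

/-- The action of `A * G`. -/
noncomputable def Ind.toEnd (M : Type*) [AddCommGroup M] [Module A M] :
    SkewMonoidAlgebra A G →+* AddMonoid.End (G →₀ M) :=
  liftNCRingHom (Ind.coeffEnd M) (Ind.groupEnd M) (by
    intro a h
    refine Finsupp.addHom_ext fun g m => ?_
    change Ind.coeffHom M _ (Finsupp.mapDomain _ _) = Finsupp.mapDomain _ (Ind.coeffHom M a _)
    simp [Ind.coeffHom_single, mul_smul])

noncomputable instance (M : Type*) [AddCommGroup M] [Module A M] :
    Module (SkewMonoidAlgebra A G) (Ind G M) :=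
  Module.compHom (G →₀ M) (Ind.toEnd M)

theorem Ind.single_smul_single {M : Type*} [AddCommGroup M] [Module A M] (h g : G) (a : A) (m : M) :
    SkewMonoidAlgebra.single h a • Ind.single g m = Ind.single (h * g) (((h * g)⁻¹ • a) • m) := by
  change Ind.toEnd M (SkewMonoidAlgebra.single h a) (Finsupp.single g m) = Finsupp.single _ _
  have : Ind.toEnd M (SkewMonoidAlgebra.single h a) = Ind.coeffEnd M a * Ind.groupEnd M h := by
    simp [Ind.toEnd, liftNCRingHom]
  rw [this]
  change Ind.coeffHom M _ (Finsupp.mapDomain _ _) = _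
  simp [Ind.coeffHom_single]

variable {k : Type w} [Field k] [Algebra k A] [SMulCommClass G k A]

/-- The tensor product `S ⊗ V` of an `A * G`-module `S` and a representation `V` of `G`, on which
`A * G` acts by `g (s ⊗ v) = g s ⊗ g v` and `a (s ⊗ v) = a s ⊗ v`. -/
def TensorRep {V : Type*} [AddCommGroup V] [Module k V] (_ρ : Representation k G V) (S : Type*)
    [AddCommGroup S] [Module k S] : Type _ := S ⊗[k] V

noncomputable instance {V : Type*} [AddCommGroup V] [Module k V] (ρ : Representation k G V)
    (S : Type*) [AddCommGroup S] [Module k S] : AddCommGroup (TensorRep ρ S) :=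
  inferInstanceAs (AddCommGroup (S ⊗[k] V))

variable {V : Type*} [AddCommGroup V] [Module k V] (ρ : Representation k G V) {S : Type*}
    [AddCommGroup S] [Module k S]

/-- The element `s ⊗ v`. -/
def TensorRep.tmul (s : S) (v : V) : TensorRep ρ S := s ⊗ₜ[k] v

variable [Module (SkewMonoidAlgebra A G) S] [IsScalarTower k (SkewMonoidAlgebra A G) S]

variable (A S) in
/-- The action of `A` on `S ⊗ V`. -/
noncomputable def TensorRep.coeffEnd : A →+* Module.End k (S ⊗[k] V) where
  toFun a := TensorProduct.map
    (Algebra.lsmul k k S (SkewMonoidAlgebra.singleOneRingHom (G := G) a)) LinearMap.id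
  map_one' := by rw [map_one, map_one]; exact TensorProduct.map_id
  map_mul' a b := by
    rw [map_mul, map_mul]; ext s v; rfl
  map_zero' := by rw [map_zero, map_zero, TensorProduct.map_zero_left]
  map_add' a b := by rw [map_add, map_add, TensorProduct.map_add_left]

variable (A S) in
/-- The diagonal action of `G` on `S ⊗ V`. -/
noncomputable def TensorRep.groupEnd : G →* Module.End k (S ⊗[k] V) where
  toFun g := TensorProduct.map (Algebra.lsmul k k S (SkewMonoidAlgebra.of A G g)) (ρ g)
  map_one' := by rw [map_one, map_one, map_one]; exact TensorProduct.map_id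
  map_mul' g h := by
    rw [map_mul, map_mul, map_mul]; ext s v; rfl

variable (A S) in
/-- The action of `A * G` on `S ⊗ V`. -/
noncomputable def TensorRep.toEnd : SkewMonoidAlgebra A G →+* Module.End k (S ⊗[k] V) :=
  liftNCRingHom (TensorRep.coeffEnd A S) (TensorRep.groupEnd A ρ S) (by
    intro a g
    ext s v
    change (single (1 : G) (g • a) • SkewMonoidAlgebra.of A G g • s) ⊗ₜ[k] ρ g v =
      (SkewMonoidAlgebra.of A G g • single (1 : G) a • s) ⊗ₜ[k] ρ g v
    rw [← mul_smul, ← mul_smul]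
    simp [single_mul_single])

noncomputable instance : Module (SkewMonoidAlgebra A G) (TensorRep ρ S) :=
  Module.compHom (S ⊗[k] V) (TensorRep.toEnd A ρ S)

theorem TensorRep.single_smul_tmul (g : G) (a : A) (s : S) (v : V) :
    single g a • TensorRep.tmul ρ s v = TensorRep.tmul ρ (single g a • s) (ρ g v) := by
  change TensorRep.toEnd A ρ S (single g a) (s ⊗ₜ v) = _ ⊗ₜ _
  have : (single g a : SkewMonoidAlgebra A G) = single 1 a * single g 1 := by
    simp [single_mul_single]
  rw [this, mul_smul]
  simp [TensorRep.toEnd, liftNCRingHom, single_mul_single]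
  rfl

instance [Finite G] [FiniteDimensional k A] : FiniteDimensional k (SkewMonoidAlgebra A G) :=
  Module.Finite.equiv (coeffLinearEquiv (S := k) (k := A) (G := G)).symm

end SkewModules

section Orders

open SkewMonoidAlgebra

variable {A : Type u} [Ring A]

/-- The comparison of semisimple modules by means of a partial order on `Sim A`: `M < N` if `L < L'`
for all simple summands `L` of `M` and `L'` of `N`. -/
def SemisimpleLT (o : PartialOrder (Sim A)) (M N : Type*) [AddCommGroup M] [Module A M]
    [AddCommGroup N] [Module A N] : Prop :=
  ∀ L L' : Sim A, IsSummand A L.module M → IsSummand A L'.module N → o.lt L L'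

theorem exists_isSummand (M : Type*) [AddCommGroup M] [Module A M] [IsSemisimpleModule A M]
    [Nontrivial M] : ∃ L : Sim A, IsSummand A L.module M := by
  obtain ⟨S, hS⟩ := IsSemisimpleModule.exists_simple_submodule A M
  obtain ⟨L, ⟨e⟩, -⟩ := Sim.existsUnique (A := A) S
  obtain ⟨T, hT⟩ := exists_isCompl S
  refine ⟨L, S.subtype ∘ₗ e.symm.toLinearMap, e.toLinearMap ∘ₗ S.projectionOnto T hT, ?_⟩
  ext
  simp

/-- The partial order with a given strict order. -/
@[reducible]
def orderOfLT {X : Type*} (r : X → X → Prop) (irrefl : ∀ x, ¬ r x x)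
    (trans : ∀ x y z, r x y → r y z → r x z) : PartialOrder X where
  le x y := x = y ∨ r x y
  lt := r
  le_refl x := Or.inl rfl
  le_trans := by
    rintro x y z (rfl | h) (rfl | h')
    exacts [Or.inl rfl, Or.inr h', Or.inr h, Or.inr (trans _ _ _ h h')]
  le_antisymm := by
    rintro x y (rfl | h) (h' | h')
    exacts [rfl, rfl, h'.symm, (irrefl _ (trans _ _ _ h h')).elim]
  lt_iff_le_not_ge x y := by
    constructor
    · intro h
      refine ⟨Or.inr h, ?_⟩
      rintro (rfl | h')
      exacts [irrefl _ h, irrefl _ (trans _ _ _ h h')]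
    · rintro ⟨rfl | h, h'⟩
      exacts [(h' (Or.inl rfl)).elim, h]

theorem SemisimpleLT.irrefl (o : PartialOrder (Sim A)) (M : Type*) [AddCommGroup M] [Module A M]
    [IsSemisimpleModule A M] [Nontrivial M] : ¬ SemisimpleLT o M M := by
  intro h
  obtain ⟨L, hL⟩ := exists_isSummand (A := A) M
  exact lt_irrefl L (h L L hL hL)

theorem SemisimpleLT.trans (o : PartialOrder (Sim A)) {M N P : Type*} [AddCommGroup M] [Module A M]
    [AddCommGroup N] [Module A N] [AddCommGroup P] [Module A P]
    [IsSemisimpleModule A N] [Nontrivial N] (h : SemisimpleLT o M N) (h' : SemisimpleLT o N P) :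
    SemisimpleLT o M P := by
  intro L L'' hL hL''
  obtain ⟨L', hL'⟩ := exists_isSummand (A := A) N
  exact lt_trans (h L L' hL hL') (h' L' L'' hL' hL'')

variable {G : Type v} [Group G] [MulSemiringAction G A]

theorem single_eq (g : G) (a : A) :
    (single g a : SkewMonoidAlgebra A G) = single 1 a * single g 1 := by
  simp [single_mul_single]

instance (g : G) : RingHomSurjective (MulSemiringAction.toRingHom G A g) :=
  ⟨MulAction.surjective g⟩

/-- The action of `g` on the restriction of an `A * G`-module, as a semilinear map. -/
noncomputable def ResG.act (S : Type*) [AddCommGroup S] [Module (SkewMonoidAlgebra A G) S] (g : G) :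
    ResG A G S →ₛₗ[MulSemiringAction.toRingHom G A g] ResG A G S where
  toFun x := (single g (1 : A) • (show S from x) : S)
  map_add' x y := smul_add (single g (1 : A)) (show S from x) (show S from y)
  map_smul' a x := by
    change (single g (1 : A) • (single (1 : G) a • (show S from x)) : S) =
      single (1 : G) (g • a) • (single g (1 : A) • (show S from x) : S)
    rw [← mul_smul, ← mul_smul]
    simp [single_mul_single]

theorem ResG.act_bijective (S : Type*) [AddCommGroup S] [Module (SkewMonoidAlgebra A G) S] (g : G) :
    Function.Bijective (ResG.act (A := A) S g) := by
  have key : ∀ (g : G) (x : S), (single g (1 : A) • (single g⁻¹ (1 : A) • x) : S) = x := by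
    intro g x
    rw [← mul_smul, single_mul_single]
    simp
  refine ⟨Function.LeftInverse.injective (g := ResG.act S g⁻¹) fun x => ?_,
    Function.RightInverse.surjective (g := ResG.act S g⁻¹) fun x => key g x⟩
  have := key g⁻¹ x
  rwa [inv_inv] at this


theorem ResG.finite [Finite G] (S : Type*) [AddCommGroup S]
    [Module (SkewMonoidAlgebra A G) S] [IsSimpleModule (SkewMonoidAlgebra A G) S] :
    Module.Finite A (ResG A G S) := by
  have : Nontrivial S := IsSimpleModule.nontrivial (SkewMonoidAlgebra A G) S
  obtain ⟨s, hs⟩ := exists_ne (0 : S)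
  let f : SkewMonoidAlgebra A G →ₗ[A] ResG A G S :=
    { toFun := fun x => (x • s : S)
      map_add' := fun x y => add_smul x y s
      map_smul' := fun a x => by
        change ((a • x) • s : S) = (single (1 : G) a) • (x • s)
        rw [← mul_smul]
        congr 1
        ext g
        simp }
  have : Module.Finite A (SkewMonoidAlgebra A G) := Module.Finite.of_basis basisSingleOne
  exact Module.Finite.of_surjective f
    (IsSimpleModule.toSpanSingleton_surjective (SkewMonoidAlgebra A G) (M := S) hs)

theorem ResG.isSemisimple [IsArtinianRing A] [Finite G] (S : Type*) [AddCommGroup S]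
    [Module (SkewMonoidAlgebra A G) S] [IsSimpleModule (SkewMonoidAlgebra A G) S] :
    IsSemisimpleModule A (ResG A G S) := by
  have := ResG.finite (A := A) (G := G) S
  have : Nontrivial (ResG A G S) := IsSimpleModule.nontrivial (SkewMonoidAlgebra A G) S
  set N : Submodule A (ResG A G S) := sSup {m | IsSimpleModule A m} with hN
  have hg : ∀ g : G, ∀ x ∈ N, ResG.act S g x ∈ N := by
    intro g x hx
    have : N ≤ N.comap (ResG.act S g) := by
      refine sSup_le fun m hm => ?_
      rw [← Submodule.map_le_iff_le_comap]
      refine le_sSup ?_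
      have hm : IsSimpleModule A m := hm
      let l := (ResG.act (A := A) S g).restrict (p := m) (q := m.map (ResG.act S g))
        (fun x hx => ⟨x, hx, rfl⟩)
      refine (LinearMap.isSimpleModule_iff_of_bijective l ⟨?_, ?_⟩).1 hm
      · intro x y hxy
        exact Subtype.ext ((ResG.act_bijective S g).1 (congrArg Subtype.val hxy))
      · rintro ⟨_, x, hx, rfl⟩
        exact ⟨⟨x, hx⟩, rfl⟩
    exact this hx
  let N' : Submodule (SkewMonoidAlgebra A G) S :=
    { carrier := {x | (show ResG A G S from x) ∈ N}
      add_mem' := fun ha hb => N.add_mem ha hb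
      zero_mem' := N.zero_mem
      smul_mem' := by
        intro c x hx
        induction c using SkewMonoidAlgebra.induction_on with
        | zero => rw [zero_smul]; exact N.zero_mem
        | single g a =>
          rw [single_eq, mul_smul]
          exact N.smul_mem a (hg g x hx)
        | add p q hp hq => rw [add_smul]; exact N.add_mem hp hq }
  have hne : N ≠ ⊥ := by
    obtain ⟨m, hm, -⟩ := (eq_bot_or_exists_atom_le (⊤ : Submodule A (ResG A G S))).resolve_left
      top_ne_bot
    intro h
    have : m ≤ ⊥ := h ▸ le_sSup (isSimpleModule_iff_isAtom.2 hm)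
    exact hm.1 (le_bot_iff.1 this)
  have htop : N' = ⊤ := by
    refine (eq_bot_or_eq_top N').resolve_left fun h => hne ?_
    rw [eq_bot_iff]
    intro x hx
    have : x ∈ N' := hx
    rwa [h] at this
  rw [← sSup_simples_eq_top_iff_isSemisimpleModule, ← hN, eq_top_iff]
  intro x _
  have : (show S from x) ∈ N' := htop ▸ Submodule.mem_top
  exact this

theorem isSemisimple_of_ResG [Finite G] {k : Type*} [Field k] [Algebra k A] [SMulCommClass G k A]
    (hG : (Nat.card G : k) ≠ 0) (M : Type*) [AddCommGroup M] [Module (SkewMonoidAlgebra A G) M]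
    [IsSemisimpleModule A (ResG A G M)] : IsSemisimpleModule (SkewMonoidAlgebra A G) M := by
  have := Fintype.ofFinite G
  refine (isSemisimpleModule_iff _ _).2 ⟨fun N => ?_⟩
  let N₀ : Submodule A (ResG A G M) :=
    { carrier := {x | (show M from x) ∈ N}
      add_mem' := fun ha hb => N.add_mem ha hb
      zero_mem' := N.zero_mem
      smul_mem' := fun a _ hx => N.smul_mem (single (1 : G) a) hx }
  obtain ⟨T, hT⟩ := exists_isCompl N₀
  let p : M →+ M := (N₀.subtype ∘ₗ N₀.projectionOnto T hT).toAddMonoidHom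
  have hpN : ∀ x, p x ∈ N := fun x => (N₀.projectionOnto T hT x).2
  have hpid : ∀ x ∈ N, p x = x := fun x hx =>
    congrArg Subtype.val (Submodule.projectionOnto_apply_left hT ⟨x, hx⟩)
  have hpA : ∀ (a : A) (x : M), p ((single (1 : G) a : SkewMonoidAlgebra A G) • x) =
      (single (1 : G) a : SkewMonoidAlgebra A G) • p x := fun a x =>
    (N₀.subtype ∘ₗ N₀.projectionOnto T hT).map_smul a x
  let c : SkewMonoidAlgebra A G := algebraMap k _ (Nat.card G : k)⁻¹
  have hc : ∀ y : SkewMonoidAlgebra A G, c * y = y * c := fun y => Algebra.commutes _ _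
  let u (g : G) : SkewMonoidAlgebra A G := single g 1
  have hu : ∀ g h, u g * u h = u (g * h) := fun g h => by simp [u, single_mul_single]
  have hua : ∀ g (a : A), u g * single 1 a = single 1 (g • a) * u g := fun g a => by
    simp [u, single_mul_single]
  have hu1 : u 1 = 1 := rfl
  let q : M → M := fun x => c • ∑ g, u g • p (u g⁻¹ • x)
  have hqN : ∀ x, q x ∈ N := fun x =>
    N.smul_mem _ (N.sum_mem fun g _ => N.smul_mem _ (hpN _))
  have hqid : ∀ x ∈ N, q x = x := by
    intro x hx
    have : ∀ g, u g • p (u g⁻¹ • x) = x := fun g => by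
      rw [hpid _ (N.smul_mem _ hx), ← mul_smul, hu, mul_inv_cancel, hu1, one_smul]
    simp only [q, this, Finset.sum_const, Finset.card_univ, ← Nat.card_eq_fintype_card]
    rw [← Nat.cast_smul_eq_nsmul (SkewMonoidAlgebra A G), ← mul_smul]
    have : c * (Nat.card G : SkewMonoidAlgebra A G) = 1 := by
      rw [← map_natCast (algebraMap k (SkewMonoidAlgebra A G)), ← map_mul, inv_mul_cancel₀ hG,
        map_one]
    rw [this, one_smul]
  have hqadd : ∀ x y, q (x + y) = q x + q y := fun x y => by
    simp only [q, smul_add, map_add, Finset.sum_add_distrib]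
  have hqA : ∀ (a : A) x, q ((single (1 : G) a : SkewMonoidAlgebra A G) • x) =
      (single (1 : G) a : SkewMonoidAlgebra A G) • q x := fun a x => by
    simp only [q]
    rw [← mul_smul, ← hc, mul_smul, Finset.smul_sum (r := (single (1 : G) a : SkewMonoidAlgebra A G))]
    congr 1
    refine Finset.sum_congr rfl fun g _ => ?_
    rw [← mul_smul, hua, mul_smul, hpA, ← mul_smul, hua, mul_smul, smul_inv_smul]
  have hqu : ∀ h x, q (u h • x) = u h • q x := fun h x => by
    simp only [q]
    rw [← mul_smul, ← hc, mul_smul, Finset.smul_sum (r := u h)]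
    congr 1
    refine (Fintype.sum_equiv (Equiv.mulLeft h) _ _ fun g => ?_).symm
    simp only [Equiv.coe_mulLeft]
    rw [← mul_smul, ← mul_smul, hu, hu]
    congr 4
    group
  let Q : M →ₗ[SkewMonoidAlgebra A G] N :=
    { toFun := fun x => ⟨q x, hqN x⟩
      map_add' := fun x y => Subtype.ext (hqadd x y)
      map_smul' := fun y x => by
        refine Subtype.ext ?_
        change q (y • x) = y • q x
        induction y using SkewMonoidAlgebra.induction_on with
        | zero =>
          have := hqadd 0 0
          simpa using this
        | single g a =>
          rw [single_eq, mul_smul, mul_smul, hqA, hqu]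
        | add y z hy hz => rw [add_smul, add_smul, hqadd, hy, hz] }
  exact ⟨LinearMap.ker Q, LinearMap.isCompl_of_proj fun x => Subtype.ext (hqid x x.2)⟩

theorem Ind.isSemisimple_res [Finite G] (L : Type*) [AddCommGroup L] [Module A L]
    [IsSimpleModule A L] : IsSemisimpleModule A (ResG A G (Ind G L)) := by
  let s (g : G) : L →ₛₗ[MulSemiringAction.toRingHom G A g] ResG A G (Ind G L) :=
    { toFun := fun x => Ind.single g x
      map_add' := fun x y => Finsupp.single_add g x y
      map_smul' := fun a x => by
        change _ = (SkewMonoidAlgebra.single (1 : G) (g • a) : SkewMonoidAlgebra A G) • Ind.single g x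
        rw [Ind.single_smul_single]
        simp }
  rw [← sSup_simples_eq_top_iff_isSemisimpleModule, eq_top_iff]
  rintro x -
  let F : G →₀ L := x
  have hx : x = F.sum fun g m => s g m := (Finsupp.sum_single F).symm
  rw [hx]
  refine Submodule.sum_mem _ fun g _ => ?_
  have : IsSimpleModule A (LinearMap.range (s g)) := by
    refine (LinearMap.isSimpleModule_iff_of_bijective (s g).rangeRestrict ⟨?_, ?_⟩).1
      (inferInstance : IsSimpleModule A L)
    · intro x y h
      exact Finsupp.single_injective g (congrArg Subtype.val h)
    · exact LinearMap.surjective_rangeRestrict _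
  exact le_sSup (show LinearMap.range (s g) ∈ {m : Submodule A (ResG A G (Ind G L)) | IsSimpleModule A m} from this) ⟨_, rfl⟩

instance (L : Type*) [AddCommGroup L] [Nontrivial L] : Nontrivial (Ind G L) :=
  inferInstanceAs (Nontrivial (G →₀ L))

variable (G) in
/-- A partial order on `Sim A` is `G`-equivariant if `L < L'` iff `gL < hL'`, for all `g`, `h`. -/
def IsEquivariant (o : PartialOrder (Sim A)) : Prop :=
  ∀ (L L' : Sim A) (g h : G),
    o.lt L L' ↔ SemisimpleLT o (Twist (A := A) g L.module) (Twist (A := A) h L'.module)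

variable (k : Type w) [Field k] [Algebra k A] [SMulCommClass G k A]

/-- A partial order on `Sim (A * G)` is `G`-stable if `S < S'` iff `S ⊗ V < S' ⊗ W`, for all nonzero
finite-dimensional representations `V`, `W` of `G`. -/
def IsStable (o : PartialOrder (Sim (SkewMonoidAlgebra A G))) : Prop :=
  ∀ (S S' : Sim (SkewMonoidAlgebra A G))
    (V : Type w) [AddCommGroup V] [Module k V] [FiniteDimensional k V] [Nontrivial V]
    (W : Type w) [AddCommGroup W] [Module k W] [FiniteDimensional k W] [Nontrivial W]
    (ρ : Representation k G V) (σ : Representation k G W),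
    o.lt S S' ↔ SemisimpleLT o (TensorRep ρ S.module) (TensorRep σ S'.module)

variable [FiniteDimensional k A] [Finite G]

variable (G) in
/-- The order on `Sim (A * G)` induced by an order on `Sim A`: `S < S'` iff the restrictions to `A`
satisfy `S < S'`. -/
@[reducible]
noncomputable def inducedOrder (o : PartialOrder (Sim A)) :
    PartialOrder (Sim (SkewMonoidAlgebra A G)) :=
  have : IsArtinianRing A := IsArtinianRing.of_finite k A
  have (S : Sim (SkewMonoidAlgebra A G)) : IsSemisimpleModule A (ResG A G S.module) :=
    ResG.isSemisimple _
  have (S : Sim (SkewMonoidAlgebra A G)) : Nontrivial (ResG A G S.module) :=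
    IsSimpleModule.nontrivial (SkewMonoidAlgebra A G) S.module
  orderOfLT (fun S S' => SemisimpleLT o (ResG A G S.module) (ResG A G S'.module))
    (fun _ => SemisimpleLT.irrefl o _) (fun _ _ _ => SemisimpleLT.trans o)

variable {k}

/-- The order on `Sim A` induced by an order on `Sim (A * G)`: `L < L'` iff
`kG ⊗ L < kG ⊗ L'`. -/
@[reducible]
noncomputable def restrictedOrder (hG : (Nat.card G : k) ≠ 0)
    (o : PartialOrder (Sim (SkewMonoidAlgebra A G))) : PartialOrder (Sim A) :=
  have (L : Sim A) : IsSemisimpleModule (SkewMonoidAlgebra A G) (Ind G L.module) :=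
    have : IsSemisimpleModule A (ResG A G (Ind G L.module)) := Ind.isSemisimple_res _
    isSemisimple_of_ResG hG _
  have (L : Sim A) : Nontrivial L.module := IsSimpleModule.nontrivial A L.module
  orderOfLT (fun L L' => SemisimpleLT o (Ind G L.module) (Ind G L'.module))
    (fun _ => SemisimpleLT.irrefl o _) (fun _ _ _ => SemisimpleLT.trans o)

end Orders

end QuasiHereditary

open QuasiHereditary

namespace QuasiHereditary
universe u v w

/-! ### Traces of projective covers and composition factors. -/

section Trace

variable {R : Type u} [Ring R] (k : Type w) [Field k] [Algebra k R] [FiniteDimensional k R]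

/-! Both orders come from one poset: the set of `G`-orbits of simple `A`-modules. By Clifford theory
the simple constituents of the restriction of a simple `A * G`-module `S` form exactly one orbit,
`skewOrbit S` (`orbit_eq_of_hom`, `isSummand_skew_iff`). Equivariance makes `<` on `Sim A` depend on
orbits only. Stability does the same on `Sim (A * G)`, because every simple module with the same
orbit as `S` is a summand of `S` tensored with the regular representation. So in either case the two
strict orders are pulled back from one partial order on the orbits.

The conditions are then rephrased through traces: `tr k U M` is the smallest submodule of `M` whose
quotient has no composition factor in `U`. Let `D_L` be `P_L` modulo the trace of all classes above
that of `L` (`ClassStandard`). Adaptedness together with exceptional standard modules holds iff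
every `D_L` is layered, i.e. all factors of its radical lie in strictly smaller classes; in that
case `D_L = Δ_L` (`isAdapted_and_isExceptional_iff`, `standardKer_eq`). Given this, a standard
filtration of `R` exists iff for upper sets `U` and `V = U ∪ {c}` the trace of `V` in `R` is
projective relative to modules without factors in `U` (`isStratifying_of_hasFiltration`,
`hasFiltration_of_isStratifying`). The bound on projective dimensions means that the kernel of `P_L
→ D_L` is projective, and directedness means that all `D_L` are semisimple.

These conditions pass between `A` and `A * G`. On an `A * G`-module the traces over both rings
coincide (`ClassCompatible.mem_tr_skew_iff`). As `|G|` is invertible, semisimplicity and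
projectivity can be tested over `A`, and `A`-linear lifts can be averaged. Going down, `P_L` is a
summand of some restricted `P_S` of the same class, and `A` is a summand of `A * G`. Going up, a
restricted `D_S` is a quotient of a direct sum of modules `D_L` of its class, and a restricted `P_S`
is a summand of a direct sum of modules `P_L`. -/

instance (L : Sim R) : Nontrivial L.module := IsSimpleModule.nontrivial R L.module

instance (L : Sim R) : Module.Projective R (projCover k L) :=
  (projCoverMap_isProjectiveCover k L).projective

/-- Otherwise `N` and the kernel, which is a coatom, span `P_L`, and superfluousness forces `N = ⊤`.
So `P_L` has a unique maximal submodule. -/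
theorem le_ker_projCoverMap {L : Sim R} {N : Submodule R (projCover k L)} (hN : N ≠ ⊤) :
    N ≤ LinearMap.ker (projCoverMap k L) := by
  have h := projCoverMap_isProjectiveCover k L
  have hco : IsCoatom (LinearMap.ker (projCoverMap k L)) := by
    rw [← isSimpleModule_iff_isCoatom]
    exact IsSimpleModule.congr
      ((projCoverMap k L).quotKerEquivOfSurjective h.surjective)
  by_contra hle
  refine hN (h.superfluous N ?_)
  refine hco.2 _ (lt_of_le_of_ne le_sup_right fun he => hle ?_)
  rw [he]
  exact le_sup_left

theorem isCoatom_ker_projCoverMap (L : Sim R) : IsCoatom (LinearMap.ker (projCoverMap k L)) := by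
  rw [← isSimpleModule_iff_isCoatom]
  exact IsSimpleModule.congr ((projCoverMap k L).quotKerEquivOfSurjective
    (projCoverMap_isProjectiveCover k L).surjective)

theorem surjective_of_comp_projCoverMap {L : Sim R} {M : Type*} [AddCommGroup M] [Module R M]
    {f : M →ₗ[R] projCover k L}
    (hf : Function.Surjective (projCoverMap k L ∘ₗ f)) : Function.Surjective f := by
  rw [← LinearMap.range_eq_top]
  by_contra h
  have hle := le_ker_projCoverMap k h
  obtain ⟨y, hy⟩ := exists_ne (0 : L.module)
  obtain ⟨x, rfl⟩ := hf y
  exact hy (hle ⟨x, rfl⟩)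

instance (L : Sim R) : Nontrivial (projCover k L) :=
  (projCoverMap_isProjectiveCover k L).surjective.nontrivial

/-- A nonzero homomorphism between simple modules identifies their classes. -/
theorem Sim.eq_of_hom {L L' : Sim R} {f : L.module →ₗ[R] L'.module} (hf : f ≠ 0) : L = L' :=
  Sim.ext ⟨LinearEquiv.ofBijective f (f.bijective_of_ne_zero hf)⟩

theorem eq_of_hom_projCover {L L' : Sim R} {φ : projCover k L →ₗ[R] L'.module} (hφ : φ ≠ 0) :
    L = L' := by
  have hle : LinearMap.ker φ ≤ LinearMap.ker (projCoverMap k L) :=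
    le_ker_projCoverMap k fun h => hφ (LinearMap.ker_eq_top.1 h)
  have hco : IsCoatom (LinearMap.ker φ) := by
    rw [← isSimpleModule_iff_isCoatom]
    exact IsSimpleModule.congr (φ.quotKerEquivOfSurjective (φ.surjective_of_ne_zero hφ))
  have heq : LinearMap.ker φ = LinearMap.ker (projCoverMap k L) :=
    (hco.le_iff_eq (isCoatom_ker_projCoverMap k L).1).1 hle |>.symm
  refine Sim.ext ⟨?_⟩
  exact ((projCoverMap k L).quotKerEquivOfSurjective
      (projCoverMap_isProjectiveCover k L).surjective).symm.trans
    ((Submodule.quotEquivOfEq _ _ heq.symm).trans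
      (φ.quotKerEquivOfSurjective (φ.surjective_of_ne_zero hφ)))

variable {M : Type*} [AddCommGroup M] [Module R M] {N : Type*} [AddCommGroup N] [Module R N]

theorem mapQ_map_injective (φ : M →ₗ[R] N) {K : Submodule R M} (h : LinearMap.ker φ ≤ K) :
    Function.Injective (K.mapQ (K.map φ) φ (Submodule.le_comap_map φ K)) := by
  rw [← LinearMap.ker_eq_bot]
  refine (Submodule.eq_bot_iff _).2 fun x hx => ?_
  obtain ⟨x, rfl⟩ := K.mkQ_surjective x
  have : φ x ∈ K.map φ := by simpa using hx
  obtain ⟨y, hy, hxy⟩ := this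
  have h1 : x - y ∈ K := h (by simp [hxy])
  simpa using K.add_mem h1 hy

/-- An embedding `L → M / N` lifts to `P_L → M` by projectivity. Conversely `ker φ` lies in the
maximal submodule `K` of `P_L`, so `L = P_L / K` embeds in `M / φ(K)`. -/
theorem isCompositionFactor_iff {L : Sim R} :
    IsCompositionFactor L M ↔ ∃ φ : projCover k L →ₗ[R] M, φ ≠ 0 := by
  have hs := (projCoverMap_isProjectiveCover k L).surjective
  constructor
  · rintro ⟨N, f, hf⟩
    obtain ⟨φ, hφ⟩ := Module.projective_lifting_property N.mkQ (f ∘ₗ projCoverMap k L)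
      N.mkQ_surjective
    refine ⟨φ, ?_⟩
    rintro rfl
    obtain ⟨y, hy⟩ := exists_ne (0 : L.module)
    obtain ⟨x, rfl⟩ := hs y
    have := LinearMap.congr_fun hφ x
    exact hy (hf (by simpa using this.symm))
  · rintro ⟨φ, hφ⟩
    have hle : LinearMap.ker φ ≤ LinearMap.ker (projCoverMap k L) :=
      le_ker_projCoverMap k fun h => hφ (LinearMap.ker_eq_top.1 h)
    set K := LinearMap.ker (projCoverMap k L)
    exact ⟨K.map φ, K.mapQ (K.map φ) φ (Submodule.le_comap_map φ K) ∘ₗ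
      ((projCoverMap k L).quotKerEquivOfSurjective hs).symm.toLinearMap,
      (mapQ_map_injective φ hle).comp (LinearEquiv.injective _)⟩

/-- The trace in `M` of the projective covers of the simple modules in `U`. -/
noncomputable def tr (U : Set (Sim R)) (M : Type*) [AddCommGroup M] [Module R M] :
    Submodule R M :=
  ⨆ (L : Sim R) (_ : L ∈ U) (φ : projCover k L →ₗ[R] M), LinearMap.range φ

variable {k} {U V : Set (Sim R)}

theorem tr_le_iff {T : Submodule R M} :
    tr k U M ≤ T ↔ ∀ L ∈ U, ∀ φ : projCover k L →ₗ[R] M, LinearMap.range φ ≤ T := by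
  simp [tr, iSup_le_iff]

theorem range_le_tr {L : Sim R} (hL : L ∈ U) (φ : projCover k L →ₗ[R] M) :
    LinearMap.range φ ≤ tr k U M :=
  tr_le_iff.1 le_rfl L hL φ

theorem tr_eq_bot_iff :
    tr k U M = ⊥ ↔ ∀ L ∈ U, ∀ φ : projCover k L →ₗ[R] M, φ = 0 := by
  rw [eq_bot_iff, tr_le_iff]
  simp [LinearMap.range_eq_bot]

theorem tr_eq_bot_iff_isCompositionFactor :
    tr k U M = ⊥ ↔ ∀ L ∈ U, ¬ IsCompositionFactor L M := by
  simp [tr_eq_bot_iff, isCompositionFactor_iff k]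

theorem tr_mono (h : U ⊆ V) : tr k U M ≤ tr k V M :=
  tr_le_iff.2 fun _ hL φ => range_le_tr (h hL) φ

theorem map_tr_le (f : M →ₗ[R] N) : (tr k U M).map f ≤ tr k U N := by
  rw [Submodule.map_le_iff_le_comap, tr_le_iff]
  intro L hL φ
  rw [← Submodule.map_le_iff_le_comap, ← LinearMap.range_comp]
  exact range_le_tr hL _

theorem apply_mem_tr (f : M →ₗ[R] N) {x : M} (hx : x ∈ tr k U M) : f x ∈ tr k U N :=
  map_tr_le f ⟨x, hx, rfl⟩

/-- Maps from projective covers lift along `f`. -/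
theorem map_tr_of_surjective (f : M →ₗ[R] N) (hf : Function.Surjective f) :
    (tr k U M).map f = tr k U N := by
  refine le_antisymm (map_tr_le f) (tr_le_iff.2 fun L hL φ => ?_)
  obtain ⟨ψ, rfl⟩ := Module.projective_lifting_property f φ hf
  rw [LinearMap.range_comp]
  exact Submodule.map_mono (range_le_tr hL ψ)

theorem tr_eq_bot_of_injective (f : M →ₗ[R] N) (hf : Function.Injective f)
    (h : tr k U N = ⊥) : tr k U M = ⊥ := by
  rw [eq_bot_iff]
  intro x hx
  have := apply_mem_tr f hx
  rw [h, Submodule.mem_bot] at this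
  exact hf (by simpa using this)

theorem tr_eq_bot_of_surjective (f : M →ₗ[R] N) (hf : Function.Surjective f)
    (h : tr k U M = ⊥) : tr k U N = ⊥ := by
  rw [← map_tr_of_surjective f hf, h, Submodule.map_bot]

theorem tr_eq_top_of_surjective (f : M →ₗ[R] N) (hf : Function.Surjective f)
    (h : tr k U M = ⊤) : tr k U N = ⊤ := by
  rw [← map_tr_of_surjective f hf, h, Submodule.map_top, LinearMap.range_eq_top.2 hf]

theorem tr_submodule_eq_bot {T : Submodule R M} (h : tr k U M = ⊥) : tr k U T = ⊥ :=
  tr_eq_bot_of_injective T.subtype T.injective_subtype h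

theorem tr_quotient_eq_bot_iff {T : Submodule R M} : tr k U (M ⧸ T) = ⊥ ↔ tr k U M ≤ T := by
  rw [← map_tr_of_surjective T.mkQ T.mkQ_surjective, ← LinearMap.le_ker_iff_map, Submodule.ker_mkQ]

theorem tr_quotient_tr : tr k U (M ⧸ tr k U M) = ⊥ :=
  tr_quotient_eq_bot_iff.2 le_rfl

theorem tr_tr_of_subset (h : U ⊆ V) :
    (tr k U (tr k V M)).map (tr k V M).subtype = tr k U M := by
  refine le_antisymm (map_tr_le _) (tr_le_iff.2 fun L hL φ => ?_)
  have hφ : ∀ x, φ x ∈ tr k V M := fun x => range_le_tr (h hL) φ ⟨x, rfl⟩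
  rintro _ ⟨x, rfl⟩
  exact ⟨⟨φ x, hφ x⟩, range_le_tr hL (φ.codRestrict _ hφ) ⟨x, rfl⟩, rfl⟩

theorem tr_tr_eq_top : tr k U (tr k U M) = ⊤ := by
  refine Submodule.map_injective_of_injective (tr k U M).injective_subtype ?_
  rw [tr_tr_of_subset le_rfl, Submodule.map_top, Submodule.range_subtype]

/-- Images of modules generated by `U` are generated by `U`. This orthogonality is what kills the
`Ext¹` of standard modules. -/
theorem eq_zero_of_tr_eq_top (hM : tr k U M = ⊤) (hN : tr k U N = ⊥) (f : M →ₗ[R] N) : f = 0 := by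
  ext x
  have : f x ∈ tr k U N := apply_mem_tr f (hM ▸ Submodule.mem_top)
  simpa [hN] using this

theorem apply_eq_zero_of_mem_tr (f : M →ₗ[R] N) (hN : tr k U N = ⊥) {x : M} (hx : x ∈ tr k U M) :
    f x = 0 := by
  simpa [hN] using apply_mem_tr f hx

theorem tr_union : tr k (U ∪ V) M = tr k U M ⊔ tr k V M := by
  refine le_antisymm (tr_le_iff.2 ?_)
    (sup_le (tr_mono Set.subset_union_left) (tr_mono Set.subset_union_right))
  rintro L (hL | hL) φ
  exacts [(range_le_tr hL φ).trans le_sup_left, (range_le_tr hL φ).trans le_sup_right]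

theorem tr_simple_eq_bot {L : Sim R} (hL : L ∉ U) : tr k U L.module = ⊥ := by
  rw [tr_eq_bot_iff]
  intro L' hL' φ
  by_contra hφ
  exact hL (eq_of_hom_projCover k hφ ▸ hL')

theorem tr_projCover_eq_top {L : Sim R} (hL : L ∈ U) : tr k U (projCover k L) = ⊤ := by
  have := range_le_tr hL (LinearMap.id : projCover k L →ₗ[R] projCover k L)
  rwa [LinearMap.range_id, top_le_iff] at this

theorem mem_of_tr_eq_top (h : tr k U M = ⊤) {L : Sim R} {f : M →ₗ[R] L.module} (hf : f ≠ 0) :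
    L ∈ U := by
  by_contra hL
  exact hf (eq_zero_of_tr_eq_top h (tr_simple_eq_bot hL) f)

theorem exists_surjective_simple (R : Type u) [Ring R] (M : Type*) [AddCommGroup M] [Module R M]
    [Module.Finite R M] [Nontrivial M] :
    ∃ (L : Sim R) (f : M →ₗ[R] L.module), Function.Surjective f := by
  obtain ⟨T, hT, -⟩ := (eq_top_or_exists_le_coatom (⊥ : Submodule R M)).resolve_left bot_ne_top
  have := isSimpleModule_iff_isCoatom.2 hT
  obtain ⟨L, ⟨e⟩, -⟩ := Sim.existsUnique (A := R) (M ⧸ T)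
  exact ⟨L, e.toLinearMap ∘ₗ T.mkQ, e.surjective.comp T.mkQ_surjective⟩

/-- Pass to a cyclic submodule, which has a simple quotient; no finiteness of `M` is required. -/
theorem exists_isCompositionFactor (R : Type u) [Ring R] (M : Type*) [AddCommGroup M] [Module R M]
    [Nontrivial M] : ∃ L : Sim R, IsCompositionFactor L M := by
  obtain ⟨x, hx⟩ := exists_ne (0 : M)
  have : Nontrivial (R ∙ x) := ⟨⟨⟨x, Submodule.mem_span_singleton_self x⟩, 0,
    fun h => hx (congrArg Subtype.val h)⟩⟩
  obtain ⟨L, f, hf⟩ := exists_surjective_simple R (R ∙ x)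
  let K := LinearMap.ker f
  exact ⟨L, K.map (R ∙ x).subtype, K.mapQ _ (R ∙ x).subtype (Submodule.le_comap_map _ K) ∘ₗ
    (f.quotKerEquivOfSurjective hf).symm.toLinearMap,
    (mapQ_map_injective (R ∙ x).subtype (by simp)).comp (LinearEquiv.injective _)⟩

theorem tr_univ : tr (R := R) k Set.univ M = ⊤ := by
  by_contra h
  have : Nontrivial (M ⧸ tr (R := R) k Set.univ M) := Submodule.Quotient.nontrivial_iff.2 h
  obtain ⟨L, hL⟩ := exists_isCompositionFactor R (M ⧸ tr (R := R) k Set.univ M)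
  exact tr_eq_bot_iff_isCompositionFactor.1 (tr_quotient_tr (k := k) (U := Set.univ) (M := M)) L
    trivial hL

theorem tr_eq_top_of_compl (h : tr k Uᶜ M = ⊥) : tr k U M = ⊤ := by
  have := tr_union (k := k) (U := U) (V := Uᶜ) (M := M)
  rwa [Set.union_compl_self, tr_univ, h, sup_bot_eq, eq_comm] at this

/-- Quotients of `P_L` have unique maximal submodules. -/
theorem surjective_of_projCover_surjective {L : Sim R} {π : projCover k L →ₗ[R] M}
    (hπ : Function.Surjective π) {f : M →ₗ[R] L.module} (hf : f ≠ 0) {T : Submodule R M}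
    (hT : T ≠ ⊤) : T ≤ LinearMap.ker f := by
  have h1 : T.comap π ≠ ⊤ := fun h => hT (by
    rw [← Submodule.map_comap_eq_of_surjective hπ T, h, Submodule.map_top,
      LinearMap.range_eq_top.2 hπ])
  have h2 : LinearMap.ker (f ∘ₗ π) = LinearMap.ker (projCoverMap k L) := by
    have hne : f ∘ₗ π ≠ 0 := fun h => hf (by
      ext x
      obtain ⟨y, rfl⟩ := hπ x
      exact LinearMap.congr_fun h y)
    have hco : IsCoatom (LinearMap.ker (f ∘ₗ π)) := by
      rw [← isSimpleModule_iff_isCoatom]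
      exact IsSimpleModule.congr
        ((f ∘ₗ π).quotKerEquivOfSurjective (LinearMap.surjective_of_ne_zero hne))
    exact ((hco.le_iff_eq (isCoatom_ker_projCoverMap k L).1).1
      (le_ker_projCoverMap k hco.1)).symm
  intro x hx
  obtain ⟨y, rfl⟩ := hπ x
  have : y ∈ LinearMap.ker (f ∘ₗ π) := h2 ▸ le_ker_projCoverMap k h1 hx
  exact this

end Trace

end QuasiHereditary

namespace QuasiHereditary
universe u v w

/-! ### Modules with simple top and quotients with simple socle. -/

section Local

variable {R : Type u} [Ring R]

/-- A simple submodule of a noetherian module is the socle of some quotient. -/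
theorem exists_quotient_socle {M : Type*} [AddCommGroup M] [Module R M] [IsNoetherian R M]
    (S : Submodule R M) [hS : IsSimpleModule R S] :
    ∃ Y : Submodule R M, Disjoint Y S ∧ socle R (M ⧸ Y) = S.map Y.mkQ ∧
      Nonempty (S ≃ₗ[R] socle R (M ⧸ Y)) := by
  -- Any submodule strictly containing this maximal `Y` meets `S`, so every simple submodule of `M /
  -- Y` lies in the image of `S`.
  obtain ⟨Y, hY, hmax⟩ := set_has_maximal_iff_noetherian.2 (inferInstance : IsNoetherian R M)
    {Y : Submodule R M | Disjoint Y S} ⟨⊥, disjoint_bot_left⟩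
  have hinj : Function.Injective (Y.mkQ.domRestrict S) := by
    rw [← LinearMap.ker_eq_bot, Submodule.eq_bot_iff]
    rintro ⟨x, hx⟩ hxY
    have hxY : x ∈ Y := by simpa using hxY
    exact Subtype.ext (Submodule.disjoint_def.1 hY x hxY hx)
  have hrange : LinearMap.range (Y.mkQ.domRestrict S) = S.map Y.mkQ :=
    LinearMap.range_domRestrict _ _
  have e : S ≃ₗ[R] S.map Y.mkQ :=
    (LinearEquiv.ofInjective _ hinj).trans (LinearEquiv.ofEq _ _ hrange)
  have hsoc : socle R (M ⧸ Y) = S.map Y.mkQ := by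
    refine le_antisymm (sSup_le fun Z hZ => ?_) (le_sSup ?_)
    · have hZa : IsAtom Z := isSimpleModule_iff_isAtom.1 hZ
      have hlt : Y < Z.comap Y.mkQ := by
        refine lt_of_le_of_ne (fun x hx => by simp [(Submodule.Quotient.mk_eq_zero Y).2 hx]) ?_
        intro h
        refine hZa.1 ?_
        rw [← Submodule.map_comap_eq_of_surjective Y.mkQ_surjective Z, ← h, Submodule.mkQ_map_self]
      have hnd : ¬ Disjoint (Z.comap Y.mkQ) S := fun h => hmax _ h hlt
      rw [Submodule.disjoint_def] at hnd
      push Not at hnd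
      obtain ⟨x, hxZ, hxS, hx0⟩ := hnd
      have hmem : Y.mkQ x ∈ Z ⊓ S.map Y.mkQ := ⟨hxZ, x, hxS, rfl⟩
      have hne : Z ⊓ S.map Y.mkQ ≠ ⊥ := by
        intro h
        rw [h, Submodule.mem_bot] at hmem
        have : x ∈ Y := by simpa using hmem
        exact hx0 (Submodule.disjoint_def.1 hY x this hxS)
      exact inf_eq_left.1 ((hZa.le_iff.1 inf_le_left).resolve_left hne)
    · exact IsSimpleModule.congr e.symm
  exact ⟨Y, hY, hsoc, ⟨e.trans (LinearEquiv.ofEq _ _ hsoc.symm)⟩⟩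

variable (k : Type w) [Field k] [Algebra k R] [FiniteDimensional k R]

variable {M : Type*} [AddCommGroup M] [Module R M] {L : Sim R} {π : projCover k L →ₗ[R] M}

variable {k}

theorem finite_of_projCover_surjective (hπ : Function.Surjective π) : Module.Finite R M := by
  have : IsArtinianRing R := IsArtinianRing.of_finite k R
  exact Module.Finite.of_surjective π hπ

theorem exists_hom_simple [Nontrivial M] (hπ : Function.Surjective π) :
    ∃ f : M →ₗ[R] L.module, f ≠ 0 := by
  have := finite_of_projCover_surjective hπ
  obtain ⟨L', f, hf⟩ := exists_surjective_simple R M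
  obtain rfl : L = L' := eq_of_hom_projCover k (φ := f ∘ₗ π) fun h => by
    obtain ⟨y, hy⟩ := exists_ne (0 : L'.module)
    obtain ⟨x, rfl⟩ := (hf.comp hπ) y
    exact hy (LinearMap.congr_fun h x)
  refine ⟨f, fun h => ?_⟩
  obtain ⟨y, hy⟩ := exists_ne (0 : L.module)
  obtain ⟨x, rfl⟩ := hf y
  exact hy (LinearMap.congr_fun h x)

theorem jacobson_eq_ker (hπ : Function.Surjective π) {f : M →ₗ[R] L.module} (hf : f ≠ 0) :
    Module.jacobson R M = LinearMap.ker f := by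
  have hco : IsCoatom (LinearMap.ker f) := by
    rw [← isSimpleModule_iff_isCoatom]
    exact IsSimpleModule.congr (f.quotKerEquivOfSurjective (LinearMap.surjective_of_ne_zero hf))
  refine le_antisymm (sInf_le hco) (le_sInf fun T hT => ?_)
  have hle := surjective_of_projCover_surjective hπ hf (T := T) hT.1
  exact ((hT.le_iff_eq hco.1).1 hle).le

theorem nonempty_modTop_equiv [Nontrivial M] (hπ : Function.Surjective π) :
    Nonempty (ModTop R M ≃ₗ[R] L.module) := by
  obtain ⟨f, hf⟩ := exists_hom_simple hπ
  exact ⟨(Submodule.quotEquivOfEq _ _ (jacobson_eq_ker hπ hf)).trans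
    (f.quotKerEquivOfSurjective (LinearMap.surjective_of_ne_zero hf))⟩

/-- Lift the cover of the top to `P_L → M`. A proper image would lie in a maximal submodule, which
also contains the radical; but image and radical together span `M`. -/
theorem exists_projCover_surjective_of_modTop [Module.Finite R M]
    (e : ModTop R M ≃ₗ[R] L.module) :
    ∃ π : projCover k L →ₗ[R] M, Function.Surjective π := by
  have : IsArtinianRing R := IsArtinianRing.of_finite k R
  obtain ⟨π, hπ⟩ := Module.projective_lifting_property
    (e.toLinearMap ∘ₗ (Module.jacobson R M).mkQ) (projCoverMap k L)
    (e.surjective.comp (Submodule.mkQ_surjective _))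
  refine ⟨π, ?_⟩
  rw [← LinearMap.range_eq_top]
  by_contra h
  obtain ⟨T, hT, hle⟩ := (eq_top_or_exists_le_coatom _).resolve_left h
  have hJ : Module.jacobson R M ≤ T := sInf_le hT
  refine hT.1 (eq_top_iff.2 fun m _ => ?_)
  obtain ⟨p, hp⟩ := (projCoverMap_isProjectiveCover k L).surjective
    ((e.toLinearMap ∘ₗ (Module.jacobson R M).mkQ) m)
  have h1 : m - π p ∈ Module.jacobson R M := by
    have := LinearMap.congr_fun hπ p
    rw [hp] at this
    have := e.injective this
    rw [← Submodule.Quotient.mk_eq_zero, Submodule.Quotient.mk_sub, sub_eq_zero]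
    exact this.symm
  have := T.add_mem (hJ h1) (hle ⟨p, rfl⟩)
  simpa using this

/-- Take a complement `C` of the image of `ker f` in `M / T`. If its preimage is everything, `ker f`
dies in the quotient. If it is proper, it lies in `ker f`, so the image of `ker f` is all of `M /
T`, which is possible only for `T = ⊤`. -/
theorem ker_le_of_isSemisimple_quotient (hπ : Function.Surjective π) {f : M →ₗ[R] L.module}
    (hf : f ≠ 0) {T : Submodule R M} [IsSemisimpleModule R (M ⧸ T)] : LinearMap.ker f ≤ T := by
  set K := LinearMap.ker f
  have hK : K ≠ ⊤ := fun h => hf (LinearMap.ker_eq_top.1 h)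
  obtain ⟨C, hC⟩ := exists_isCompl (K.map T.mkQ)
  by_cases hC' : C.comap T.mkQ = ⊤
  · have hCt : C = ⊤ := by
      rw [← Submodule.map_comap_eq_of_surjective T.mkQ_surjective C, hC', Submodule.map_top,
        Submodule.range_mkQ]
    have hKb : K.map T.mkQ = ⊥ := by simpa [hCt] using hC.inf_eq_bot
    rw [← LinearMap.le_ker_iff_map, Submodule.ker_mkQ] at hKb
    exact hKb
  · have h1 : C ≤ K.map T.mkQ := by
      rw [← Submodule.map_comap_eq_of_surjective T.mkQ_surjective C]
      exact Submodule.map_mono (surjective_of_projCover_surjective hπ hf hC')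
    have h2 : K.map T.mkQ = ⊤ := by simpa [sup_eq_left.2 h1] using hC.sup_eq_top
    by_cases hT : T = ⊤
    · rw [hT]; exact le_top
    · have hTK : T ≤ K := surjective_of_projCover_surjective hπ hf hT
      refine absurd ?_ hK
      have := congrArg (Submodule.comap T.mkQ) h2
      rwa [Submodule.comap_map_mkQ, Submodule.comap_top, sup_eq_right.2 hTK] at this

end Local

end QuasiHereditary

namespace QuasiHereditary
universe u v w

/-! ### Finiteness of the set of simple modules. -/

section Finiteness

variable {R : Type u} [Ring R]

/-- Every simple module embeds in the semisimple module `R / rad R`, which has finitely many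
isotypic components, and non-isomorphic ones lie in different components. -/
theorem Sim.finite (k : Type w) [Field k] [Algebra k R] [FiniteDimensional k R] :
    Finite (Sim R) := by
  have : IsArtinianRing R := IsArtinianRing.of_finite k R
  have hss : IsSemisimpleModule R (R ⧸ Module.jacobson R R) :=
    (IsArtinian.isSemisimpleModule_iff_jacobson R _).2 (Module.jacobson_quotient_jacobson R R)
  have key : ∀ L : Sim R, ∃ S : Submodule R (R ⧸ Module.jacobson R R),
      Nonempty (S ≃ₗ[R] L.module) := by
    intro L
    have hle : Module.jacobson R R ≤ (Quotient.out L).1 := sInf_le (Quotient.out L).2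
    let f : (R ⧸ Module.jacobson R R) →ₗ[R] L.module := Submodule.factor hle
    have hf : Function.Surjective f := Submodule.factor_surjective hle
    obtain ⟨C, hC⟩ := exists_isCompl (LinearMap.ker f)
    exact ⟨C, ⟨(Submodule.quotientEquivOfIsCompl _ C hC).symm.trans
      (f.quotKerEquivOfSurjective hf)⟩⟩
  choose S e using key
  have hS : ∀ L, IsSimpleModule R (S L) := fun L => IsSimpleModule.congr (e L).some
  let c : Sim R → isotypicComponents R (R ⧸ Module.jacobson R R) := fun L =>
    ⟨isotypicComponent R _ (S L), S L, hS L, rfl⟩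
  refine Finite.of_injective c fun L L' h => ?_
  have h : isotypicComponent R _ (S L) = isotypicComponent R _ (S L') := congrArg Subtype.val h
  obtain ⟨f⟩ := isIsotypicOfType_submodule_iff.1
    (IsIsotypicOfType.isotypicComponent R (R ⧸ Module.jacobson R R) (S L')) (S L)
    (h ▸ (S L).le_isotypicComponent)
  exact Sim.ext ⟨(e L).some.symm.trans (f.trans (e L').some)⟩

end Finiteness

/-! ### Layered modules, adapted orders and standard modules. -/

section Layers

variable {R : Type u} [Ring R] (k : Type w) [Field k] [Algebra k R] [FiniteDimensional k R]
  {X : Type*} [PartialOrder X] (a : Sim R → X)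

/-- The largest quotient of `P_L` without composition factors in classes above that of `L`. -/
abbrev ClassStandard (L : Sim R) : Type u :=
  projCover k L ⧸ tr k (a ⁻¹' Set.Ioi (a L)) (projCover k L)

/-- All composition factors of `M` in classes that are not below `x` occur in a semisimple quotient
of `M`. -/
def IsLayered (x : X) (M : Type*) [AddCommGroup M] [Module R M] : Prop :=
  IsSemisimpleModule R (M ⧸ tr k (a ⁻¹' Set.Iio x) M) ∧
    tr k (a ⁻¹' (Set.Iio x)ᶜ) (tr k (a ⁻¹' Set.Iio x) M) = ⊥

variable {k a}

theorem IsLayered.of_surjective {x : X} {M N : Type*} [AddCommGroup M] [Module R M]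
    [AddCommGroup N] [Module R N] (h : IsLayered k a x M) (f : M →ₗ[R] N)
    (hf : Function.Surjective f) : IsLayered k a x N := by
  obtain ⟨h1, h2⟩ := h
  have hmap := map_tr_of_surjective (k := k) (U := a ⁻¹' Set.Iio x) f hf
  constructor
  · refine IsSemisimpleModule.of_surjective (Submodule.mapQ (tr k (a ⁻¹' Set.Iio x) M)
      (tr k (a ⁻¹' Set.Iio x) N) f (Submodule.map_le_iff_le_comap.1 hmap.le)) ?_
    intro y
    obtain ⟨y, rfl⟩ := Submodule.mkQ_surjective _ y
    obtain ⟨x, rfl⟩ := hf y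
    exact ⟨Submodule.mkQ _ x, rfl⟩
  · refine tr_eq_bot_of_surjective (f.restrict (p := tr k (a ⁻¹' Set.Iio x) M)
      (q := tr k (a ⁻¹' Set.Iio x) N) fun m hm => apply_mem_tr f hm) ?_ h2
    rintro ⟨y, hy⟩
    rw [← hmap] at hy
    obtain ⟨z, hz, rfl⟩ := hy
    exact ⟨⟨z, hz⟩, rfl⟩

theorem tr_Ioi_ne_top (L : Sim R) : tr k (a ⁻¹' Set.Ioi (a L)) (projCover k L) ≠ ⊤ := by
  intro h
  have hs := (projCoverMap_isProjectiveCover k L).surjective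
  refine lt_irrefl (a L) (mem_of_tr_eq_top h (f := projCoverMap k L) fun h0 => ?_)
  obtain ⟨y, hy⟩ := exists_ne (0 : L.module)
  obtain ⟨x, rfl⟩ := hs y
  exact hy (LinearMap.congr_fun h0 x)

instance (L : Sim R) : Nontrivial (ClassStandard k a L) :=
  Submodule.Quotient.nontrivial_iff.2 (tr_Ioi_ne_top L)

section ProjCoverQuotient

variable {L : Sim R} {M : Type*} [AddCommGroup M] [Module R M] {π : projCover k L →ₗ[R] M}

/-- Quotients of `P_L` without composition factors in higher classes are quotients of the
class standard module. -/
theorem exists_classStandard_surjective (hπ : Function.Surjective π)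
    (hM : tr k (a ⁻¹' Set.Ioi (a L)) M = ⊥) :
    ∃ f : ClassStandard k a L →ₗ[R] M, Function.Surjective f := by
  refine ⟨(tr k (a ⁻¹' Set.Ioi (a L)) (projCover k L)).liftQ π ?_, ?_⟩
  · exact fun x hx => apply_eq_zero_of_mem_tr π hM hx
  · intro y
    obtain ⟨x, rfl⟩ := hπ y
    exact ⟨Submodule.mkQ _ x, rfl⟩

/-- For quotients of `P_L` being layered is a statement about the radical: it is the trace of the
classes strictly below that of `L`. -/
theorem IsLayered.ker_eq (hπ : Function.Surjective π) (hM : IsLayered k a (a L) M)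
    {f : M →ₗ[R] L.module} (hf : f ≠ 0) : LinearMap.ker f = tr k (a ⁻¹' Set.Iio (a L)) M := by
  have := hM.1
  refine le_antisymm (ker_le_of_isSemisimple_quotient hπ hf) fun x hx => ?_
  exact apply_eq_zero_of_mem_tr f (tr_simple_eq_bot (lt_irrefl (a L))) hx

theorem IsLayered.hom_eq_zero (hπ : Function.Surjective π) (hM : IsLayered k a (a L) M)
    {f : M →ₗ[R] L.module} (hf : f ≠ 0) {L' : Sim R} (hL' : ¬ a L' < a L)
    {φ : projCover k L' →ₗ[R] M} (hφ : f ∘ₗ φ = 0) : φ = 0 := by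
  have hmem : ∀ x, φ x ∈ tr k (a ⁻¹' Set.Iio (a L)) M := fun x => by
    rw [← hM.ker_eq hπ hf]
    exact LinearMap.congr_fun hφ x
  have := tr_eq_bot_iff.1 hM.2 L' hL' (φ.codRestrict _ hmem)
  ext x
  exact congrArg Subtype.val (LinearMap.congr_fun this x)

/-- If `φ` survives in the top, then `L' = L`; otherwise it lands in the radical, whose factors lie
in strictly smaller classes. -/
theorem IsLayered.lt_or_eq_of_hom_ne_zero (hπ : Function.Surjective π)
    (hM : IsLayered k a (a L) M) {L' : Sim R} {φ : projCover k L' →ₗ[R] M} (hφ : φ ≠ 0) :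
    a L' < a L ∨ L' = L := by
  have : Nontrivial M := ⟨⟨_, _, (DFunLike.ne_iff.1 hφ).choose_spec⟩⟩
  obtain ⟨f, hf⟩ := exists_hom_simple hπ
  by_contra! h
  exact hφ (hM.hom_eq_zero hπ hf h.1 (by_contra fun hne => h.2 (eq_of_hom_projCover k hne)))

theorem isLayered_of_ker {f : M →ₗ[R] L.module} (hf : f ≠ 0)
    (h : tr k (a ⁻¹' (Set.Iio (a L))ᶜ) (LinearMap.ker f) = ⊥) : IsLayered k a (a L) M := by
  have heq : LinearMap.ker f = tr k (a ⁻¹' Set.Iio (a L)) M := by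
    refine le_antisymm ?_ fun x hx =>
      apply_eq_zero_of_mem_tr f (tr_simple_eq_bot (lt_irrefl (a L))) hx
    have htop : tr k (a ⁻¹' Set.Iio (a L)) (LinearMap.ker f) = ⊤ :=
      tr_eq_top_of_compl h
    have := map_tr_le (k := k) (U := a ⁻¹' Set.Iio (a L)) (LinearMap.ker f).subtype
    rwa [htop, Submodule.map_top, Submodule.range_subtype] at this
  constructor
  · rw [← heq]
    exact IsSemisimpleModule.congr
      (f.quotKerEquivOfSurjective (LinearMap.surjective_of_ne_zero hf))
  · rwa [← heq]

end ProjCoverQuotient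

theorem tr_Ioi_le_standardKer (o : PartialOrder (Sim R)) (ha : ∀ L L', o.lt L L' ↔ a L < a L')
    (L : Sim R) :
    tr k (a ⁻¹' Set.Ioi (a L)) (projCover k L) ≤ standardKer k o L := by
  refine tr_mono (V := {L' | ¬ o.le L' L}) fun L' hL' => ?_
  exact o.lt_iff_le_not_ge L L' |>.1 ((ha L L').2 hL') |>.2

/-- The standard module kills every `L' ≰ L`, including incomparable ones and other members of the
class of `L`, whereas `ClassStandard` kills only classes above. The two agree when no other such
`L'` occurs. -/
theorem standardKer_eq_of_hom (o : PartialOrder (Sim R)) (ha : ∀ L L', o.lt L L' ↔ a L < a L')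
    {L : Sim R}
    (h : ∀ L' ≠ L, ¬ a L' < a L → ∀ φ : projCover k L' →ₗ[R] ClassStandard k a L, φ = 0) :
    standardKer k o L = tr k (a ⁻¹' Set.Ioi (a L)) (projCover k L) := by
  refine le_antisymm ?_ (tr_Ioi_le_standardKer o ha L)
  have : tr k {L' | ¬ o.le L' L} (ClassStandard k a L) = ⊥ := by
    refine tr_eq_bot_iff.2 fun L' hL' φ => h L' ?_ ?_ φ
    · rintro rfl
      exact hL' (o.le_refl _)
    · intro hlt
      exact hL' (o.lt_iff_le_not_ge _ _ |>.1 ((ha _ _).2 hlt) |>.1)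
  exact tr_quotient_eq_bot_iff.1 this

theorem standardKer_eq (o : PartialOrder (Sim R)) (ha : ∀ L L', o.lt L L' ↔ a L < a L')
    (hF : ∀ L, IsLayered k a (a L) (ClassStandard k a L)) (L : Sim R) :
    standardKer k o L = tr k (a ⁻¹' Set.Ioi (a L)) (projCover k L) := by
  refine standardKer_eq_of_hom o ha fun L' hne hlt φ => ?_
  by_contra hφ
  exact ((hF L).lt_or_eq_of_hom_ne_zero (Submodule.mkQ_surjective _) hφ).elim hlt hne

/-- Suppose `L' ≠ L` occurs in `ClassStandard` without being below `L`. It is then the socle of a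
quotient with top `L`, and adaptedness yields a factor above `L`, although all of these were
removed. Hence `ClassStandard` is the standard module, and a copy of `L` in its radical would give a
nonzero endomorphism that is not surjective. -/
theorem IsAdapted.isLayered (o : PartialOrder (Sim R)) (ha : ∀ L L', o.lt L L' ↔ a L < a L')
    (had : IsAdapted o)
    (hend : ∀ L, ∀ f : Standard k o L →ₗ[R] Standard k o L, f ≠ 0 → Function.Surjective f)
    (L : Sim R) : IsLayered k a (a L) (ClassStandard k a L) := by
  have : IsArtinianRing R := IsArtinianRing.of_finite k R
  have hπ := (tr k (a ⁻¹' Set.Ioi (a L)) (projCover k L)).mkQ_surjective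
  obtain ⟨f, hf⟩ := exists_hom_simple hπ
  have hD : tr k (a ⁻¹' Set.Ioi (a L)) (ClassStandard k a L) = ⊥ := tr_quotient_tr
  have hne : ∀ L' ≠ L, ¬ a L' < a L → ∀ φ : projCover k L' →ₗ[R] ClassStandard k a L, φ = 0 := by
    intro L' hL' hlt φ
    by_contra hφ
    have hsub : LinearMap.ker φ ≤ LinearMap.ker (projCoverMap k L') :=
      le_ker_projCoverMap k fun h => hφ (LinearMap.ker_eq_top.1 h)
    obtain ⟨N, i, hi⟩ := (isCompositionFactor_iff k).2 ⟨φ, hφ⟩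
    have hS : IsSimpleModule R (LinearMap.range i) :=
      IsSimpleModule.congr (LinearEquiv.ofInjective i hi).symm
    obtain ⟨Y, hY, -, ⟨e⟩⟩ := exists_quotient_socle (LinearMap.range i)
    have hq : Function.Surjective (Y.mkQ ∘ₗ N.mkQ) :=
      Y.mkQ_surjective.comp N.mkQ_surjective
    have hY' : Y ≠ ⊤ := by
      rintro rfl
      have h0 : LinearMap.range i = ⊥ := by simpa using hY
      exact (isSimpleModule_iff_isAtom.1 hS).1 h0
    have : Nontrivial ((ClassStandard k a L ⧸ N) ⧸ Y) := Submodule.Quotient.nontrivial_iff.2 hY'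
    have hfin : Module.Finite R ((ClassStandard k a L ⧸ N) ⧸ Y) := inferInstance
    -- `L < L'` is excluded because nothing above `L` occurs in the module, and `L' < L` by `hlt`.
    obtain ⟨L'', h1, h2, -⟩ := had ((ClassStandard k a L ⧸ N) ⧸ Y) L L'
      (nonempty_modTop_equiv (π := (Y.mkQ ∘ₗ N.mkQ) ∘ₗ Submodule.mkQ _) (hq.comp hπ))
      ⟨e.symm.trans (LinearEquiv.ofInjective i hi).symm⟩ (fun hle => by
        refine hφ (tr_eq_bot_iff.1 hD L' ((ha L L').1 ?_) φ)
        rcases o.lt_iff_le_not_ge L L' with h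
        exact h.2 ⟨hle, fun hge => hL' (o.le_antisymm _ _ hge hle)⟩) (fun hle => by
        refine hlt ((ha L' L).1 ?_)
        exact (o.lt_iff_le_not_ge _ _).2 ⟨hle, fun hge => hL' (o.le_antisymm _ _ hle hge)⟩)
    refine tr_eq_bot_iff_isCompositionFactor.1 (tr_eq_bot_of_surjective _ hq hD) L''
      ((ha L L'').1 h2) h1
  refine isLayered_of_ker hf (tr_eq_bot_iff.2 fun L' hL' φ => ?_)
  have hφf : f ∘ₗ (LinearMap.ker f).subtype ∘ₗ φ = 0 := by
    ext x
    exact (φ x).2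
  suffices h : (LinearMap.ker f).subtype ∘ₗ φ = 0 by
    ext x
    exact LinearMap.congr_fun h x
  by_cases hL : L' = L
  · subst hL
    set ψ := (LinearMap.ker f).subtype ∘ₗ φ
    let e : ClassStandard k a L' ≃ₗ[R] Standard k o L' :=
      Submodule.quotEquivOfEq _ _ (standardKer_eq_of_hom o ha hne).symm
    let ψ' : ClassStandard k a L' →ₗ[R] ClassStandard k a L' :=
      Submodule.liftQ _ ψ fun x hx => apply_eq_zero_of_mem_tr ψ hD hx
    have hψ' : ψ' ∘ₗ Submodule.mkQ _ = ψ := Submodule.liftQ_mkQ _ _ _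
    by_contra hψ
    -- A nonzero `ψ'` would be surjective by `hend`, but its image lies in the proper submodule `ker
    -- f`.
    have hs := hend L' (e.toLinearMap ∘ₗ ψ' ∘ₗ e.symm.toLinearMap) fun h => hψ (by
      rw [← hψ']
      ext x
      have := LinearMap.congr_fun h (e (Submodule.mkQ _ x))
      simpa using this)
    refine hf ?_
    ext y
    obtain ⟨z, hz⟩ := hs (e (Submodule.mkQ _ y))
    have hz : ψ' (e.symm z) = Submodule.mkQ _ y := e.injective hz
    obtain ⟨p, hp⟩ := Submodule.mkQ_surjective _ (e.symm z)
    rw [← hp] at hz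
    have hz : ψ p = Submodule.mkQ _ y := hz
    change f (Submodule.mkQ _ y) = 0
    rw [← hz]
    exact LinearMap.congr_fun hφf p
  · exact hne L' hL hL' _

/-- The simple socle lies in every nonzero submodule. If such a submodule is an image of `P_K`
without factors above `K`, it is a quotient of the class standard module of `K`, so `L'` is below
`K` or equal to it. For `K = L` this contradicts incomparability, so some factor lies above `L`, and
a maximal such factor lies above `L'` too. -/
theorem isAdapted_of_isLayered (o : PartialOrder (Sim R)) (ha : ∀ L L', o.lt L L' ↔ a L < a L')
    (hF : ∀ L, IsLayered k a (a L) (ClassStandard k a L)) :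
    IsAdapted o := by
  intro M _ _ _ L L' ⟨e⟩ ⟨e'⟩ h1 h2
  have : IsArtinianRing R := IsArtinianRing.of_finite k R
  obtain ⟨π, hπ⟩ := exists_projCover_surjective_of_modTop (k := k) e
  have hsoc : IsSimpleModule R (socle R M) := IsSimpleModule.congr e'
  have key : ∀ (K : Sim R) (φ : projCover k K →ₗ[R] M), φ ≠ 0 →
      tr k (a ⁻¹' Set.Ioi (a K)) (LinearMap.range φ) = ⊥ → a L' < a K ∨ L' = K := by
    intro K φ hφ htr
    obtain ⟨g, hg⟩ := exists_classStandard_surjective φ.surjective_rangeRestrict htr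
    have hl := (hF K).of_surjective g hg
    have hle : socle R M ≤ LinearMap.range φ := by
      obtain ⟨S, hS, hSle⟩ := (eq_bot_or_exists_atom_le (LinearMap.range φ)).resolve_left
        (fun h => hφ (LinearMap.range_eq_bot.1 h))
      have h3 : S ≤ socle R M := le_sSup (isSimpleModule_iff_isAtom.2 hS)
      have h4 : S = socle R M :=
        ((isSimpleModule_iff_isAtom.1 hsoc).le_iff_eq hS.1).1 h3
      exact h4 ▸ hSle
    refine hl.lt_or_eq_of_hom_ne_zero φ.surjective_rangeRestrict
      (φ := Submodule.inclusion hle ∘ₗ e'.symm.toLinearMap ∘ₗ projCoverMap k L') fun h0 => ?_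
    obtain ⟨y, hy⟩ := exists_ne (0 : L'.module)
    obtain ⟨x, rfl⟩ := (projCoverMap_isProjectiveCover k L').surjective y
    have h5 := LinearMap.congr_fun h0 x
    have h6 := (Submodule.inclusion_injective hle) (h5.trans (map_zero _).symm)
    exact hy (e'.symm.injective (h6.trans (map_zero _).symm))
  have hlt : ∀ {K K'}, a K < a K' → o.le K K' := fun h =>
    ((o.lt_iff_le_not_ge _ _).1 ((ha _ _).2 h)).1
  have hπ0 : π ≠ 0 := by
    rintro rfl
    have : Nontrivial (socle R M) := e'.nontrivial
    obtain ⟨x, hx⟩ := exists_ne (0 : socle R M)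
    obtain ⟨p, hp⟩ := hπ x
    exact hx (Subtype.ext hp.symm)
  have hex : ∃ K, a L < a K ∧ IsCompositionFactor K M := by
    by_contra! hno
    have hM : tr k (a ⁻¹' Set.Ioi (a L)) M = ⊥ :=
      tr_eq_bot_iff_isCompositionFactor.2 fun K hK => hno K hK
    rcases key L π hπ0 (tr_submodule_eq_bot hM) with h | h
    · exact h2 (hlt h)
    · exact h1 (h ▸ o.le_refl _)
  have := Sim.finite (R := R) k
  -- Maximality guarantees that no factor above `K` occurs in the image of `P_K`, as `key` requires.
  obtain ⟨K, ⟨hK1, hK2⟩, hmax⟩ := (Set.toFinite {K : Sim R | a L < a K ∧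
    IsCompositionFactor K M}).exists_maximalFor a _ hex
  refine ⟨K, hK2, (ha _ _).2 hK1, (ha _ _).2 ?_⟩
  obtain ⟨φ, hφ⟩ := (isCompositionFactor_iff k).1 hK2
  refine (key K φ hφ ?_).resolve_right fun h => h1 (hlt (h ▸ hK1))
  refine tr_submodule_eq_bot (tr_eq_bot_iff_isCompositionFactor.2 fun K' hK' hf => ?_)
  exact (hmax ⟨hK1.trans hK', hf⟩ (le_of_lt hK')).not_gt hK'

end Layers

end QuasiHereditary

namespace QuasiHereditary
universe u v w

/-! ### `Ext¹` and projective dimension of quotients of projective modules. -/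

section Homological

open CategoryTheory

variable {R : Type u} [Ring R] {P : Type u} [AddCommGroup P] [Module R P] [Module.Projective R P]
  (T : Submodule R P)

/-- In the long exact sequence of `0 → T → P → P / T → 0` one has `Ext¹(P, Y) = 0`, so every class
in `Ext¹(P / T, Y)` comes from `Hom(T, Y)`. -/
theorem subsingleton_ext_one_quotient {Y : Type u} [AddCommGroup Y] [Module R Y]
    (h : ∀ f : T →ₗ[R] Y, f = 0) :
    Subsingleton (Abelian.Ext (ModuleCat.of R (P ⧸ T)) (ModuleCat.of R Y) 1) := by
  have hS := LinearMap.shortExact_shortComplexKer T.mkQ_surjective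
  have : Projective (ModuleCat.of R P) :=
    (IsProjective.iff_projective P).1 inferInstance
  refine subsingleton_of_forall_eq 0 fun x => ?_
  obtain ⟨y, rfl⟩ := Abelian.Ext.contravariant_sequence_exact₃ hS (ModuleCat.of R Y) x
    (Abelian.Ext.eq_zero_of_projective (P := ModuleCat.of R P) _) (n₀ := 0) rfl
  have hy : y = 0 := by
    rw [← Abelian.Ext.mk₀_homEquiv₀_apply y]
    have h0 : Abelian.Ext.homEquiv₀ y = 0 := by
      ext ⟨z, hz⟩
      have hz' : z ∈ T := by simpa using hz
      exact LinearMap.congr_fun (h ((Abelian.Ext.homEquiv₀ y).hom ∘ₗ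
        (LinearEquiv.ofEq T _ T.ker_mkQ.symm).toLinearMap)) ⟨z, hz'⟩
    rw [h0, Abelian.Ext.mk₀_zero]
  rw [hy, Abelian.Ext.comp_zero]

theorem hasProjectiveDimensionLE_one_quotient_iff :
    HasProjectiveDimensionLE (ModuleCat.of R (P ⧸ T)) 1 ↔ Module.Projective R T := by
  have hS := LinearMap.shortExact_shortComplexKer T.mkQ_surjective
  have hP : Projective (ModuleCat.of R P) :=
    (IsProjective.iff_projective P).1 inferInstance
  have e : T ≃ₗ[R] LinearMap.ker T.mkQ := LinearEquiv.ofEq T _ T.ker_mkQ.symm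
  have h1 := hS.hasProjectiveDimensionLT_X₃_iff 0 hP
  have h2 : Projective (ModuleCat.of R (LinearMap.ker T.mkQ)) ↔
      HasProjectiveDimensionLT (ModuleCat.of R (LinearMap.ker T.mkQ)) 1 :=
    projective_iff_hasProjectiveDimensionLT_one
  refine h1.trans (h2.symm.trans ((IsProjective.iff_projective _).symm.trans ?_))
  exact ⟨fun _ => Module.Projective.of_equiv e.symm, fun _ => Module.Projective.of_equiv e⟩

end Homological

/-! ### Exceptional standard modules, projective dimension and directedness in terms of class
standard modules. -/

section Exceptional

theorem surjective_of_end_equiv {R : Type*} [Ring R] {k : Type*} [Field k] [Algebra k R]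
    {M : Type*} [AddCommGroup M] [Module R M] [Module k M]
    [IsScalarTower k R M] (e : Module.End R M ≃ₐ[k] k) (f : M →ₗ[R] M) (hf : f ≠ 0) :
    Function.Surjective f := by
  have he : e f ≠ 0 := by simpa using hf
  have h1 : (f : Module.End R M) * e.symm (e f)⁻¹ = 1 := by
    apply e.injective
    rw [map_mul, AlgEquiv.apply_symm_apply, mul_inv_cancel₀ he, map_one]
  exact fun x => ⟨_, LinearMap.congr_fun h1 x⟩

variable {R : Type u} [Ring R] {k : Type w} [Field k] [Algebra k R] [FiniteDimensional k R]
  {X : Type*} [PartialOrder X] {a : Sim R → X}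

/-- The kernel of `P_L → Δ_L` is generated by covers `P_{L'}` with `L' ≰ L`, and no such `L'` occurs
in `Δ_L`. Hence the `Ext¹` condition holds for every order. -/
theorem subsingleton_ext_one_standard (o : PartialOrder (Sim R)) (L : Sim R) :
    Subsingleton (CategoryTheory.Abelian.Ext (ModuleCat.of R (Standard k o L))
      (ModuleCat.of R (Standard k o L)) 1) :=
  subsingleton_ext_one_quotient _ fun f =>
    eq_zero_of_tr_eq_top (U := {L' | ¬ o.le L' L}) tr_tr_eq_top tr_quotient_tr f

/-- An endomorphism `f` has an eigenvalue `c`, as `k` is algebraically closed. Then `f - c` is not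
injective, hence not surjective, so its image lies in the radical, where `L` does not occur; thus `f
= c`. -/
theorem nonempty_end_equiv_of_isLayered [IsAlgClosed k] {L : Sim R} {T : Submodule R (projCover k L)}
    (hT : T ≠ ⊤) (h : IsLayered k a (a L) (projCover k L ⧸ T)) :
    Nonempty (Module.End R (projCover k L ⧸ T) ≃ₐ[k] k) := by
  have : IsArtinianRing R := IsArtinianRing.of_finite k R
  have hnt : Nontrivial (projCover k L ⧸ T) := Submodule.Quotient.nontrivial_iff.2 hT
  have : Module.Finite R (projCover k L ⧸ T) := inferInstance
  have : Module.Finite k (projCover k L ⧸ T) := Module.Finite.trans R _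
  obtain ⟨p, hp⟩ := exists_hom_simple T.mkQ_surjective
  have hbij : Function.Bijective (Algebra.ofId k (Module.End R (projCover k L ⧸ T))) := by
    refine ⟨(algebraMap k (Module.End R (projCover k L ⧸ T))).injective, fun f => ?_⟩
    obtain ⟨c, hc⟩ := Module.End.exists_eigenvalue (f.restrictScalars k)
    obtain ⟨v, hv⟩ := hc.exists_hasEigenvector
    refine ⟨c, ?_⟩
    set g : Module.End R (projCover k L ⧸ T) := f - algebraMap k _ c
    suffices hg : g = 0 from (sub_eq_zero.1 hg).symm
    have hgv : g v = 0 := by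
      have := hv.apply_eq_smul
      simp only [LinearMap.restrictScalars_apply] at this
      simp [g, this]
    have hr : LinearMap.range g ≠ ⊤ := fun hr => hv.2 (by
      have hinj : Function.Injective g :=
        IsNoetherian.injective_of_surjective_endomorphism g (LinearMap.range_eq_top.1 hr)
      exact hinj (hgv.trans (map_zero g).symm))
    have hle := surjective_of_projCover_surjective T.mkQ_surjective hp hr
    have h0 := h.hom_eq_zero T.mkQ_surjective hp (lt_irrefl (a L)) (φ := g ∘ₗ T.mkQ) (by
      ext x
      exact hle ⟨_, rfl⟩)
    ext x
    exact LinearMap.congr_fun h0 x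
  exact ⟨(AlgEquiv.ofBijective _ hbij).symm⟩

theorem isAdapted_and_isExceptional_iff (o : PartialOrder (Sim R)) (ha : ∀ L L', o.lt L L' ↔ a L < a L')
    [IsAlgClosed k] :
    (IsAdapted o ∧ ∀ L, IsExceptional (A := R) k (Standard k o L)) ↔
      ∀ L, IsLayered k a (a L) (ClassStandard k a L) := by
  constructor
  · rintro ⟨h1, h2⟩
    exact h1.isLayered o ha fun L f hf => surjective_of_end_equiv (h2 L).2.some f hf
  · intro h
    refine ⟨isAdapted_of_isLayered o ha h, fun L => ⟨subsingleton_ext_one_standard o L, ?_⟩⟩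
    have heq := standardKer_eq o ha h L
    refine nonempty_end_equiv_of_isLayered (a := a) ?_ ?_
    · rw [heq]; exact tr_Ioi_ne_top L
    · rw [heq]; exact h L

theorem hasProjectiveDimensionLE_standard_iff
    (o : PartialOrder (Sim R)) (ha : ∀ L L', o.lt L L' ↔ a L < a L')
    (h : ∀ L, IsLayered k a (a L) (ClassStandard k a L)) (L : Sim R) :
    CategoryTheory.HasProjectiveDimensionLE (ModuleCat.of R (Standard k o L)) 1 ↔
      Module.Projective R (tr k (a ⁻¹' Set.Ioi (a L)) (projCover k L)) := by
  rw [hasProjectiveDimensionLE_one_quotient_iff, standardKer_eq o ha h L]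

/-- A nonzero semisimple quotient of `P_L` is `L` itself. In the other direction, Schur's lemma for
simple standard modules supplies the condition on endomorphisms in `IsAdapted.isLayered`. -/
theorem isDirectedAlgebra_iff (o : PartialOrder (Sim R)) (ha : ∀ L L', o.lt L L' ↔ a L < a L') :
    IsDirectedAlgebra k o ↔ ∀ L, IsSemisimpleModule R (ClassStandard k a L) := by
  constructor
  · rintro ⟨h1, h2⟩ L
    have hF := h1.isLayered (k := k) o ha fun L f hf => by
      have := IsSimpleModule.congr (h2 L).some
      exact LinearMap.surjective_of_ne_zero hf
    have e : ClassStandard k a L ≃ₗ[R] L.module :=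
      (Submodule.quotEquivOfEq _ _ (standardKer_eq o ha hF L).symm).trans (h2 L).some
    exact IsSemisimpleModule.congr e
  · intro h
    have e : ∀ L, Nonempty (ClassStandard k a L ≃ₗ[R] L.module) := fun L => by
      obtain ⟨f, hf⟩ := exists_hom_simple
        (tr k (a ⁻¹' Set.Ioi (a L)) (projCover k L)).mkQ_surjective
      have : IsSemisimpleModule R (ClassStandard k a L ⧸ (⊥ : Submodule R _)) :=
        IsSemisimpleModule.congr (Submodule.quotEquivOfEqBot _ rfl)
      have hker := ker_le_of_isSemisimple_quotient (T := ⊥)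
        (tr k (a ⁻¹' Set.Ioi (a L)) (projCover k L)).mkQ_surjective hf
      exact ⟨LinearEquiv.ofBijective f
        ⟨LinearMap.ker_eq_bot.1 (le_bot_iff.1 hker), LinearMap.surjective_of_ne_zero hf⟩⟩
    have hF : ∀ L, IsLayered k a (a L) (ClassStandard k a L) := fun L => by
      have h0 : tr k (a ⁻¹' Set.Iio (a L)) (ClassStandard k a L) = ⊥ :=
        tr_eq_bot_of_injective _ (e L).some.injective (tr_simple_eq_bot (lt_irrefl (a L)))
      refine ⟨inferInstance, ?_⟩
      rw [h0]
      exact Subsingleton.elim _ _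
    exact ⟨isAdapted_of_isLayered o ha hF, fun L =>
      ⟨(Submodule.quotEquivOfEq _ _ (standardKer_eq o ha hF L)).trans (e L).some⟩⟩

end Exceptional

end QuasiHereditary

namespace QuasiHereditary
universe u v w x

/-! ### Relative projectivity and the stratifying condition. -/

section RelativeProjectivity

variable {R : Type u} [Ring R] (k : Type w) [Field k] [Algebra k R] [FiniteDimensional k R]

/-- `Q` is projective relative to the modules without composition factors in `U`. -/
def RelProj (U : Set (Sim R)) (Q : Type*) [AddCommGroup Q] [Module R Q] : Prop :=
  ∀ (N₁ N₂ : Type x) [AddCommGroup N₁] [Module R N₁] [AddCommGroup N₂] [Module R N₂]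
    (g : N₁ →ₗ[R] N₂), Function.Surjective g → tr k U N₁ = ⊥ →
    ∀ f : Q →ₗ[R] N₂, ∃ f' : Q →ₗ[R] N₁, g ∘ₗ f' = f

/-- All layers `tr V R / tr U R`, where `V` is obtained from `U` by adding one class, are projective
relative to the modules without composition factors in `U`. -/
def IsStratifying {X : Type*} [PartialOrder X] (a : Sim R → X) : Prop :=
  ∀ (U : Set X) (c : X), IsUpperSet U → c ∉ U → IsUpperSet (insert c U) →
    RelProj.{u, w, x} k (a ⁻¹' U) (tr k (a ⁻¹' insert c U) R)

variable {k} {U V : Set (Sim R)}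

theorem RelProj.of_retract {Q Q' : Type*} [AddCommGroup Q] [Module R Q] [AddCommGroup Q']
    [Module R Q'] (h : RelProj.{u, w, x} k U Q') (i : Q →ₗ[R] Q') (p : Q' →ₗ[R] Q)
    (hpi : p ∘ₗ i = LinearMap.id) : RelProj.{u, w, x} k U Q := by
  intro N₁ N₂ _ _ _ _ g hg hN f
  obtain ⟨f', hf'⟩ := h N₁ N₂ g hg hN (f ∘ₗ p)
  exact ⟨f' ∘ₗ i, by rw [← LinearMap.comp_assoc, hf', LinearMap.comp_assoc, hpi, LinearMap.comp_id]⟩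

theorem exists_comp_eq_of_ker_le {M N P : Type*} [AddCommGroup M] [Module R M] [AddCommGroup N]
    [Module R N] [AddCommGroup P] [Module R P] {s : M →ₗ[R] N} (hs : Function.Surjective s)
    {f : M →ₗ[R] P} (h : LinearMap.ker s ≤ LinearMap.ker f) : ∃ g : N →ₗ[R] P, g ∘ₗ s = f :=
  ⟨(LinearMap.ker s).liftQ f h ∘ₗ (s.quotKerEquivOfSurjective hs).symm.toLinearMap, by
    ext m
    have : (s.quotKerEquivOfSurjective hs).symm (s m) = Submodule.Quotient.mk m :=
      (LinearEquiv.symm_apply_eq _).2 rfl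
    simp [this]⟩

/-- Maps to modules without factors in `U` kill the trace of `U`, hence the kernel of `s`, so lifts
descend. -/
theorem RelProj.of_surjective {Q Q' : Type*} [AddCommGroup Q] [Module R Q] [AddCommGroup Q']
    [Module R Q'] (h : RelProj.{u, w, x} k U Q) (s : Q →ₗ[R] Q') (hs : Function.Surjective s)
    (hker : ∀ q, s q = 0 → q ∈ tr k U Q) : RelProj.{u, w, x} k U Q' := by
  intro N₁ N₂ _ _ _ _ g hg hN f
  obtain ⟨f', hf'⟩ := h N₁ N₂ g hg hN (f ∘ₗ s)
  obtain ⟨f'', hf''⟩ := exists_comp_eq_of_ker_le hs (f := f') fun q hq =>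
    apply_eq_zero_of_mem_tr f' hN (hker q hq)
  refine ⟨f'', ?_⟩
  rw [← LinearMap.cancel_right hs, LinearMap.comp_assoc, hf'', hf']

/-- The map induced on traces. -/
noncomputable def trMap {M N : Type*} [AddCommGroup M] [Module R M] [AddCommGroup N] [Module R N]
    (U : Set (Sim R)) (f : M →ₗ[R] N) : tr k U M →ₗ[R] tr k U N :=
  f.restrict fun _ hm => apply_mem_tr f hm

theorem RelProj.tr_of_retract {M M' : Type*} [AddCommGroup M] [Module R M] [AddCommGroup M']
    [Module R M'] (h : RelProj.{u, w, x} k U (tr k V M')) (i : M →ₗ[R] M') (p : M' →ₗ[R] M)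
    (hpi : p ∘ₗ i = LinearMap.id) : RelProj.{u, w, x} k U (tr k V M) :=
  h.of_retract (trMap V i) (trMap V p) (by
    ext m
    exact LinearMap.congr_fun hpi m.1)

end RelativeProjectivity

/-! ### From a standard filtration to relative projectivity. -/

section FiltrationToStratification

variable {R : Type u} [Ring R] {k : Type w} [Field k] [Algebra k R] [FiniteDimensional k R]
  {X : Type*} [PartialOrder X] {a : Sim R → X}
  {M' M : Type*} [AddCommGroup M'] [Module R M'] [AddCommGroup M] [Module R M]

theorem tr_classStandard_eq_bot (hF : ∀ L, IsLayered k a (a L) (ClassStandard k a L)) {V : Set X}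
    (hV : IsUpperSet V) {L : Sim R} (hL : a L ∉ V) :
    tr k (a ⁻¹' V) (ClassStandard k a L) = ⊥ := by
  refine tr_eq_bot_iff.2 fun L' hL' φ => ?_
  by_contra hφ
  rcases (hF L).lt_or_eq_of_hom_ne_zero (Submodule.mkQ_surjective _) hφ with h | h
  · exact hL (hV h.le hL')
  · exact hL (h ▸ hL')

/-- Relative projectivity of traces passes to an extension by a class standard module. -/
theorem RelProj.tr_extension (hF : ∀ L, IsLayered k a (a L) (ClassStandard k a L)) {U : Set X}
    {c : X} (hU : IsUpperSet U) (hV : IsUpperSet (insert c U)) {L : Sim R}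
    {i : M' →ₗ[R] M} (hi : Function.Injective i) {q : M →ₗ[R] ClassStandard k a L}
    (hq : Function.Surjective q) (hiq : Function.Exact i q)
    (h : RelProj.{u, w, x} k (a ⁻¹' U) (tr k (a ⁻¹' insert c U) M')) :
    RelProj.{u, w, x} k (a ⁻¹' U) (tr k (a ⁻¹' insert c U) M) := by
  set V := insert c U
  have hUV : a ⁻¹' U ⊆ a ⁻¹' V := Set.preimage_mono (Set.subset_insert c U)
  have lift : ∀ {K : Type u} [AddCommGroup K] [Module R K] (ψ : K →ₗ[R] M), q ∘ₗ ψ = 0 →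
      ∃ ψ' : K →ₗ[R] M', i ∘ₗ ψ' = ψ := by
    intro K _ _ ψ hψ
    have hr : ∀ z, ψ z ∈ LinearMap.range i := fun z => (hiq _).1 (LinearMap.congr_fun hψ z)
    refine ⟨(LinearEquiv.ofInjective i hi).symm.toLinearMap ∘ₗ ψ.codRestrict _ hr, ?_⟩
    ext z
    exact congrArg Subtype.val ((LinearEquiv.ofInjective i hi).apply_symm_apply ⟨ψ z, hr z⟩)
  by_cases hL : a L ∈ V
  -- If `a L ∈ V`, the trace of `V` in `M` is generated by that in `M'` and by a lift `φ` of `P_L`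
  -- to `M`.
  · obtain ⟨φ, hφ⟩ := Module.projective_lifting_property q
      (tr k (a ⁻¹' Set.Ioi (a L)) (projCover k L)).mkQ hq
    have hIoi : a ⁻¹' Set.Ioi (a L) ⊆ a ⁻¹' U := by
      intro K hK
      rcases hL with hL | hL
      · refine (hV (le_of_lt hK) (Or.inl hL)).resolve_left ?_
        rw [← hL]
        exact ne_of_gt hK
      · exact hU (le_of_lt hK) hL
    have hφV : ∀ p, φ p ∈ tr k (a ⁻¹' V) M := fun p => range_le_tr hL φ ⟨p, rfl⟩
    let φ' : projCover k L →ₗ[R] tr k (a ⁻¹' V) M := φ.codRestrict _ hφV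
    let s : (tr k (a ⁻¹' V) M' × projCover k L) →ₗ[R] tr k (a ⁻¹' V) M :=
      (trMap (a ⁻¹' V) i).coprod φ'
    have hs : Function.Surjective s := by
      have hle : tr k (a ⁻¹' V) M ≤ LinearMap.range ((tr k (a ⁻¹' V) M).subtype ∘ₗ s) := by
        refine tr_le_iff.2 fun L' hL' ψ => ?_
        obtain ⟨l, hl⟩ := Module.projective_lifting_property
          (tr k (a ⁻¹' Set.Ioi (a L)) (projCover k L)).mkQ (q ∘ₗ ψ) (Submodule.mkQ_surjective _)
        obtain ⟨ψ', hψ'⟩ := lift (ψ - φ ∘ₗ l) (by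
          rw [LinearMap.comp_sub, ← LinearMap.comp_assoc, hφ, hl, sub_self])
        rintro _ ⟨z, rfl⟩
        refine ⟨(⟨ψ' z, range_le_tr hL' ψ' ⟨z, rfl⟩⟩, l z), ?_⟩
        have := LinearMap.congr_fun hψ' z
        change i (ψ' z) + φ (l z) = ψ z
        rw [LinearMap.comp_apply] at this
        rw [this]
        simp
      intro y
      obtain ⟨z, hz⟩ := hle y.2
      exact ⟨z, Subtype.ext hz⟩
    intro N₁ N₂ _ _ _ _ g hg hN f
    obtain ⟨h₁, hh₁⟩ := h N₁ N₂ g hg hN (f ∘ₗ trMap (a ⁻¹' V) i)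
    obtain ⟨h₂, hh₂⟩ := Module.projective_lifting_property g (f ∘ₗ φ') hg
    -- The two lifts glue. A relation `i m + φ p = 0` puts `p` into the trace above `L`, which `h₂`
    -- kills. Moreover `m = -θ p` comes from that trace, which is generated by `U`, so `h₁` kills
    -- `m`.
    have hker : LinearMap.ker s ≤ LinearMap.ker (h₁.coprod h₂) := by
      rintro ⟨m, p⟩ hmp
      have hmp : i m.1 + φ p = 0 := congrArg Subtype.val hmp
      have hp : p ∈ tr k (a ⁻¹' Set.Ioi (a L)) (projCover k L) := by
        have h1 : q (i m.1 + φ p) = 0 := by rw [hmp, map_zero]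
        rw [map_add, hiq.apply_apply_eq_zero, zero_add] at h1
        have h2 := LinearMap.congr_fun hφ p
        rw [LinearMap.comp_apply, h1] at h2
        simpa using h2.symm
      have hp2 : h₂ p = 0 := apply_eq_zero_of_mem_tr h₂ hN (tr_mono hIoi hp)
      obtain ⟨θ, hθ⟩ := lift (φ ∘ₗ (tr k (a ⁻¹' Set.Ioi (a L)) (projCover k L)).subtype) (by
        rw [← LinearMap.comp_assoc, hφ]
        ext z
        simp)
      have htop : tr k (a ⁻¹' U) (tr k (a ⁻¹' Set.Ioi (a L)) (projCover k L)) = ⊤ :=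
        top_le_iff.1 (tr_tr_eq_top.symm.le.trans (tr_mono hIoi))
      have hθV : ∀ z, θ z ∈ tr k (a ⁻¹' V) M' := fun z =>
        apply_mem_tr θ (tr_mono hUV (htop ▸ Submodule.mem_top))
      have h3 : h₁ ∘ₗ θ.codRestrict _ hθV = 0 := eq_zero_of_tr_eq_top htop hN _
      have h4 : θ ⟨p, hp⟩ = - m.1 := hi (by
        have := LinearMap.congr_fun hθ ⟨p, hp⟩
        rw [map_neg]
        exact this.trans (eq_neg_of_add_eq_zero_right hmp))
      have h5 : m = - (θ.codRestrict _ hθV) ⟨p, hp⟩ := Subtype.ext (by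
        change m.1 = - θ ⟨p, hp⟩
        rw [h4, neg_neg])
      have h6 : h₁ m = 0 := by
        rw [h5, map_neg, neg_eq_zero]
        exact LinearMap.congr_fun h3 _
      simp [h6, hp2]
    obtain ⟨f', hf'⟩ := exists_comp_eq_of_ker_le hs hker
    refine ⟨f', ?_⟩
    rw [← LinearMap.cancel_right hs, LinearMap.comp_assoc, hf', LinearMap.comp_coprod, hh₁, hh₂,
      LinearMap.comp_coprod]
  -- If `a L ∉ V`, maps from covers in `V` vanish in the quotient, so `M` and `M'` have the same
  -- trace.
  · have hbot := tr_classStandard_eq_bot hF hV hL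
    have hbij : Function.Bijective (trMap (k := k) (a ⁻¹' V) i) := by
      refine ⟨fun m m' h => Subtype.ext (hi (congrArg Subtype.val h)), ?_⟩
      have hle : tr k (a ⁻¹' V) M ≤ (tr k (a ⁻¹' V) M').map i := by
        refine tr_le_iff.2 fun L' hL' ψ => ?_
        obtain ⟨ψ', rfl⟩ := lift ψ (tr_eq_bot_iff.1 hbot L' hL' _)
        rw [LinearMap.range_comp]
        exact Submodule.map_mono (range_le_tr hL' ψ')
      intro y
      obtain ⟨z, hz, hzy⟩ := hle y.2
      exact ⟨⟨z, hz⟩, Subtype.ext hzy⟩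
    let e := LinearEquiv.ofBijective _ hbij
    exact h.of_retract e.symm.toLinearMap e.toLinearMap (by ext; simp)

theorem isStratifying_of_hasFiltration
    (hF : ∀ L, IsLayered k a (a L) (ClassStandard k a L)) {Δ : Sim R → Type*}
    [∀ L, AddCommGroup (Δ L)] [∀ L, Module R (Δ L)]
    (hΔ : ∀ L, Nonempty (ClassStandard k a L ≃ₗ[R] Δ L)) (h : HasFiltration (A := R) Δ R) :
    IsStratifying.{u, w, x} k a := by
  intro U c hU _ hV
  obtain ⟨m, F, hmono, h0, hlast, hstep⟩ := h
  have key : ∀ j, RelProj.{u, w, x} k (a ⁻¹' U) (tr k (a ⁻¹' insert c U) (F j)) := by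
    intro j
    induction j using Fin.induction with
    | zero =>
      rw [h0]
      intro N₁ N₂ _ _ _ _ g hg hN f
      exact ⟨0, by ext z; rw [Subsingleton.elim z 0]; simp⟩
    | succ j ih =>
      obtain ⟨L, ⟨e⟩⟩ := hstep j
      obtain ⟨e'⟩ := hΔ L
      refine ih.tr_extension hF hU hV
        (i := Submodule.inclusion (hmono (Fin.castSucc_le_succ j)))
        (q := e'.symm.toLinearMap ∘ₗ e.toLinearMap ∘ₗ Submodule.mkQ _)
        (Submodule.inclusion_injective _)
        (e'.symm.surjective.comp (e.surjective.comp (Submodule.mkQ_surjective _))) ?_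
      intro y
      have h1 : e'.symm (e (Submodule.Quotient.mk y)) = 0 ↔ y.1 ∈ F j.castSucc :=
        (e.trans e'.symm).map_eq_zero_iff.trans (Submodule.Quotient.mk_eq_zero _)
      exact h1.trans ⟨fun hy => ⟨⟨_, hy⟩, rfl⟩, by rintro ⟨z, rfl⟩; exact z.2⟩
  refine (key (Fin.last m)).tr_of_retract
    (LinearMap.codRestrict _ LinearMap.id fun r => by rw [hlast]; trivial)
    (F (Fin.last m)).subtype ?_
  ext
  rfl

end FiltrationToStratification

end QuasiHereditary

namespace QuasiHereditary
universe u v w x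

/-! ### Filtrations as chains of single steps. -/

section FiltrationSteps

variable {R : Type u} [Ring R] {ι : Type*} (Δ : ι → Type*) [∀ i, AddCommGroup (Δ i)]
  [∀ i, Module R (Δ i)]

/-- An inclusion of submodules with subquotient in the family `Δ`. -/
def FiltStep {M : Type*} [AddCommGroup M] [Module R M] (N N' : Submodule R M) : Prop :=
  N ≤ N' ∧ ∃ i, Nonempty ((N' ⧸ N.submoduleOf N') ≃ₗ[R] Δ i)

variable {Δ}

theorem hasFiltration_of_reflTransGen {M : Type*} [AddCommGroup M] [Module R M]
    (h : Relation.ReflTransGen (FiltStep (R := R) Δ (M := M)) ⊥ ⊤) :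
    HasFiltration (A := R) Δ M := by
  have key : ∀ N : Submodule R M, Relation.ReflTransGen (FiltStep (R := R) Δ (M := M)) ⊥ N →
      ∃ (m : ℕ) (F : Fin (m + 1) → Submodule R M), Monotone F ∧ F 0 = ⊥ ∧ F (Fin.last m) = N ∧
        ∀ j : Fin m, FiltStep Δ (F j.castSucc) (F j.succ) := by
    intro N hN
    induction hN with
    | refl => exact ⟨0, fun _ => ⊥, monotone_const, rfl, rfl, fun j => j.elim0⟩
    | @tail N N' _ hstep ih =>
      obtain ⟨m, F, hF, h0, hl, hs⟩ := ih
      have hs' : ∀ j : Fin (m + 1), FiltStep Δ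
          (Fin.snoc (α := fun _ => Submodule R M) F N' j.castSucc)
          (Fin.snoc (α := fun _ => Submodule R M) F N' j.succ) := by
        intro j
        induction j using Fin.lastCases with
        | last => simpa [hl] using hstep
        | cast j =>
          rw [Fin.succ_castSucc, Fin.snoc_castSucc, Fin.snoc_castSucc]
          exact hs j
      refine ⟨m + 1, Fin.snoc F N', Fin.monotone_iff_le_succ.2 fun j => (hs' j).1, ?_, by simp,
        hs'⟩
      rw [← Fin.castSucc_zero, Fin.snoc_castSucc, h0]
  obtain ⟨m, F, h1, h2, h3, h4⟩ := key ⊤ h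
  exact ⟨m, F, h1, h2, h3, fun j => (h4 j).2⟩

/-- Used to move a filtration of a layer, the quotient of two traces, into the ring between these
traces. -/
theorem FiltStep.map_comap {M Q P : Type*} [AddCommGroup M] [Module R M] [AddCommGroup Q]
    [Module R Q] [AddCommGroup P] [Module R P] {f : M →ₗ[R] Q} (hf : Function.Surjective f)
    {g : M →ₗ[R] P} (hg : Function.Injective g) {N N' : Submodule R Q} (h : FiltStep Δ N N') :
    FiltStep Δ ((N.comap f).map g) ((N'.comap f).map g) := by
  obtain ⟨hle, i, ⟨e⟩⟩ := h
  refine ⟨Submodule.map_mono (Submodule.comap_mono hle), i, ⟨?_⟩⟩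
  let e₁ := (N'.comap f).equivMapOfInjective g hg
  let f₁ : N'.comap f →ₗ[R] N' := f.restrict fun _ hx => hx
  have hf₁ : Function.Surjective f₁ := by
    rintro ⟨y, hy⟩
    obtain ⟨x, rfl⟩ := hf y
    exact ⟨⟨x, hy⟩, rfl⟩
  let s : (N'.comap f).map g →ₗ[R] N' ⧸ N.submoduleOf N' :=
    (N.submoduleOf N').mkQ ∘ₗ f₁ ∘ₗ e₁.symm.toLinearMap
  have hs : Function.Surjective s :=
    (Submodule.mkQ_surjective _).comp (hf₁.comp e₁.symm.surjective)
  have hker : ((N.comap f).map g).submoduleOf ((N'.comap f).map g) = LinearMap.ker s := by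
    ext y
    obtain ⟨x, rfl⟩ := e₁.surjective y
    have h1 : s (e₁ x) = (N.submoduleOf N').mkQ (f₁ x) := by simp [s]
    rw [LinearMap.mem_ker, h1, Submodule.mkQ_apply, Submodule.Quotient.mk_eq_zero]
    change g x.1 ∈ (N.comap f).map g ↔ f x.1 ∈ N
    constructor
    · rintro ⟨z, hz, hzx⟩
      exact hg hzx ▸ hz
    · exact fun hx => ⟨x.1, hx, rfl⟩
  exact (Submodule.quotEquivOfEq _ _ hker).trans ((s.quotKerEquivOfSurjective hs).trans e)

end FiltrationSteps

/-! ### From relative projectivity to a standard filtration. -/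

section StratificationToFiltration

variable {R : Type u} [Ring R] {k : Type w} [Field k] [Algebra k R] [FiniteDimensional k R]
  {X : Type*} [PartialOrder X] {a : Sim R → X} {Δ : Sim R → Type*}
  [∀ L, AddCommGroup (Δ L)] [∀ L, Module R (Δ L)]

/-- Class standard modules can be split off from relatively projective modules. -/
theorem RelProj.reflTransGen_filtStep
    (hF : ∀ L, IsLayered k a (a L) (ClassStandard k a L))
    (hΔ : ∀ L, Nonempty (ClassStandard k a L ≃ₗ[R] Δ L)) {U : Set X} {c : X}
    (hU : IsUpperSet U) (hV : IsUpperSet (insert c U)) {Q : Type u} [AddCommGroup Q]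
    [Module R Q] [Module.Finite R Q] (h : RelProj.{u, w, u} k (a ⁻¹' U) Q)
    (hQU : tr k (a ⁻¹' U) Q = ⊥) (hQV : tr k (a ⁻¹' insert c U) Q = ⊤) :
    Relation.ReflTransGen (FiltStep (R := R) Δ (M := Q)) ⊥ ⊤ := by
  have : IsArtinianRing R := IsArtinianRing.of_finite k R
  -- Induct on the direct summands `N` of `Q`, splitting off one class standard module at a time.
  suffices key : ∀ (N : Submodule R Q) (p : Q →ₗ[R] N), p ∘ₗ N.subtype = LinearMap.id →
      Relation.ReflTransGen (FiltStep (R := R) Δ (M := Q)) ⊥ N from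
    key ⊤ (LinearMap.id.codRestrict ⊤ fun _ => trivial) rfl
  intro N
  induction N using WellFoundedLT.induction with
  | ind N ih =>
  intro p hp
  by_cases hN : N = ⊥
  · rw [hN]
  have : Nontrivial N := Submodule.nontrivial_iff_ne_bot.2 hN
  have hps : Function.Surjective p := fun y => ⟨y, LinearMap.congr_fun hp y⟩
  obtain ⟨L, f, hf⟩ := exists_surjective_simple R N
  have hf0 : f ≠ 0 := by
    rintro rfl
    obtain ⟨y, hy⟩ := exists_ne (0 : L.module)
    obtain ⟨x, rfl⟩ := hf y
    exact hy rfl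
  have hL1 : a L ∈ insert c U := mem_of_tr_eq_top (tr_eq_top_of_surjective p hps hQV) hf0
  have hL2 : a L ∉ U := fun hL => by
    have h1 : tr k (a ⁻¹' U) N = ⊥ := tr_submodule_eq_bot hQU
    obtain ⟨ψ, hψ⟩ := Module.projective_lifting_property f (projCoverMap k L) hf
    rw [tr_eq_bot_iff.1 h1 L hL ψ, LinearMap.comp_zero] at hψ
    obtain ⟨y, hy⟩ := exists_ne (0 : L.module)
    obtain ⟨x, rfl⟩ := (projCoverMap_isProjectiveCover k L).surjective y
    exact hy (LinearMap.congr_fun hψ x).symm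
  have hLc : a L = c := hL1.resolve_right hL2
  have hmk := (tr k (a ⁻¹' Set.Ioi (a L)) (projCover k L)).mkQ_surjective
  obtain ⟨r, hr⟩ := exists_hom_simple (M := ClassStandard k a L) hmk
  have hNproj : RelProj.{u, w, u} k (a ⁻¹' U) N := h.of_retract N.subtype p hp
  -- The class standard module has no factor in `U`, so relative projectivity lifts `N → L` to it.
  -- The lift is onto because its target has a unique maximal submodule.
  obtain ⟨t, ht⟩ := hNproj _ _ r (LinearMap.surjective_of_ne_zero hr)
    (tr_classStandard_eq_bot hF hU hL2) f
  have hts : Function.Surjective t := by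
    rw [← LinearMap.range_eq_top]
    by_contra hne
    refine hf0 ?_
    rw [← ht]
    ext x
    exact surjective_of_projCover_surjective hmk hr hne ⟨x, rfl⟩
  -- This becomes a section of `t`: nothing above `L` occurs in `N`, so `P_L → N` factors through
  -- the class standard module.
  obtain ⟨s', hs'⟩ := Module.projective_lifting_property t
    (tr k (a ⁻¹' Set.Ioi (a L)) (projCover k L)).mkQ hts
  have hIoi : a ⁻¹' Set.Ioi (a L) ⊆ a ⁻¹' U := fun K hK =>
    (hV (le_of_lt hK) hL1).resolve_left fun h => (ne_of_gt hK) (h.trans hLc.symm)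
  have hNIoi : tr k (a ⁻¹' Set.Ioi (a L)) N = ⊥ :=
    tr_submodule_eq_bot (eq_bot_mono (tr_mono hIoi) hQU)
  let s : ClassStandard k a L →ₗ[R] N :=
    Submodule.liftQ _ s' fun x hx => apply_eq_zero_of_mem_tr s' hNIoi hx
  have hts' : t ∘ₗ s = LinearMap.id := by
    ext x
    exact LinearMap.congr_fun hs' x
  set N₀ : Submodule R Q := (LinearMap.ker t).map N.subtype
  have hsub : N₀.submoduleOf N = LinearMap.ker t :=
    Submodule.comap_map_eq_of_injective N.injective_subtype _
  have hle : N₀ ≤ N := Submodule.map_subtype_le _ _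
  have hne : N₀ ≠ N := by
    intro heq
    have h1 : LinearMap.ker t = ⊤ := by rw [← hsub, heq, Submodule.submoduleOf_self]
    refine hf0 ?_
    rw [← ht, LinearMap.ker_eq_top.1 h1, LinearMap.comp_zero]
  let e₀ := (LinearMap.ker t).equivMapOfInjective N.subtype N.injective_subtype
  let p₀ : N →ₗ[R] LinearMap.ker t := LinearMap.codRestrict _ (LinearMap.id - s ∘ₗ t) fun x => by
    have := LinearMap.congr_fun hts' (t x)
    simp only [LinearMap.comp_apply, LinearMap.id_apply] at this
    simp [this]
  refine (ih N₀ (lt_of_le_of_ne hle hne) (e₀.toLinearMap ∘ₗ p₀ ∘ₗ p) ?_).tail ⟨hle, L, ?_⟩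
  · ext y
    obtain ⟨z, rfl⟩ := e₀.surjective y
    have h1 : p z.1.1 = z.1 := LinearMap.congr_fun hp z.1
    have h2 : p₀ z.1 = z := Subtype.ext (by
      change z.1 - s (t z.1) = z.1
      rw [LinearMap.mem_ker.1 z.2, map_zero, sub_zero])
    change ((e₀ (p₀ (p z.1.1)) : N₀) : Q) = e₀ z
    rw [h1, h2]
  · obtain ⟨e⟩ := hΔ L
    exact ⟨(Submodule.quotEquivOfEq _ _ hsub).trans ((t.quotKerEquivOfSurjective hts).trans e)⟩

/-- Remove a minimal class `c` from an upper set. The quotient of the two traces has only factors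
outside the smaller set, is generated by `c`, and is still relatively projective, so it can be
filtered. -/
theorem hasFiltration_of_isStratifying [Finite X]
    (hF : ∀ L, IsLayered k a (a L) (ClassStandard k a L))
    (hΔ : ∀ L, Nonempty (ClassStandard k a L ≃ₗ[R] Δ L))
    (hS : IsStratifying.{u, w, u} k a) : HasFiltration (A := R) Δ R := by
  have : IsArtinianRing R := IsArtinianRing.of_finite k R
  suffices key : ∀ U : Set X, IsUpperSet U →
      Relation.ReflTransGen (FiltStep (R := R) Δ (M := R)) ⊥ (tr k (a ⁻¹' U) R) by
    have := key Set.univ isUpperSet_univ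
    rw [Set.preimage_univ, tr_univ] at this
    exact hasFiltration_of_reflTransGen this
  intro U
  induction U using WellFoundedLT.induction with
  | ind U ih =>
  intro hU
  rcases U.eq_empty_or_nonempty with rfl | hne
  · have : tr (R := R) k (a ⁻¹' ∅) R = ⊥ := tr_eq_bot_iff.2 fun _ hL => hL.elim
    rw [this]
  obtain ⟨c, hcU, hmin⟩ := U.toFinite.exists_minimal hne
  have hins : insert c (U \ {c}) = U := by simp [Set.insert_eq_of_mem hcU]
  have hup : IsUpperSet (U \ {c}) := by
    rintro y z hyz ⟨hy, hyc⟩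
    refine ⟨hU hyz hy, fun hz => hyc ?_⟩
    rw [Set.mem_singleton_iff] at hz
    exact le_antisymm (hz ▸ hyz) (hmin hy (hz ▸ hyz))
  have hlt : U \ {c} < U := Set.sdiff_singleton_ssubset.2 hcU
  refine (ih _ hlt hup).trans ?_
  have hS' := hS (U \ {c}) c hup (by simp) (by rwa [hins])
  rw [hins] at hS'
  set T := tr (R := R) k (a ⁻¹' U) R
  set T' := tr (R := R) k (a ⁻¹' (U \ {c})) R
  have hsub : a ⁻¹' (U \ {c}) ⊆ a ⁻¹' U := Set.preimage_mono Set.sdiff_subset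
  have hmap : (tr k (a ⁻¹' (U \ {c})) T).map T.subtype = T' := tr_tr_of_subset hsub
  have heq : T'.submoduleOf T = tr k (a ⁻¹' (U \ {c})) T := by
    rw [← hmap]
    exact Submodule.comap_map_eq_of_injective T.injective_subtype _
  have hQ := RelProj.reflTransGen_filtStep (Q := T ⧸ T'.submoduleOf T) hF hΔ hup
    (c := c) (by rwa [hins]) (hS'.of_surjective _ (Submodule.mkQ_surjective _) fun q hq => by
      rw [← heq]
      simpa using hq) (by rw [heq]; exact tr_quotient_tr) (by
      rw [hins]
      exact tr_eq_top_of_surjective _ (Submodule.mkQ_surjective _) tr_tr_eq_top)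
  have hlift : Relation.ReflTransGen (FiltStep (R := R) Δ (M := R))
      (((⊥ : Submodule R _).comap (T'.submoduleOf T).mkQ).map T.subtype)
      (((⊤ : Submodule R _).comap (T'.submoduleOf T).mkQ).map T.subtype) :=
    hQ.lift (fun N => (N.comap (T'.submoduleOf T).mkQ).map T.subtype) fun N N' h =>
      h.map_comap (Submodule.mkQ_surjective _) T.injective_subtype
  rwa [Submodule.comap_bot, Submodule.ker_mkQ, Submodule.comap_top, Submodule.map_top,
    Submodule.range_subtype, heq, hmap] at hlift

end StratificationToFiltration

/-! ### Quasi-heredity as layered plus stratifying. -/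

section Characterizations

variable {R : Type u} [Ring R] {k : Type w} [Field k] [IsAlgClosed k] [Algebra k R]
  [FiniteDimensional k R] {X : Type*} [PartialOrder X] {a : Sim R → X}

theorem IsQuasiHereditary.isLayered_and_isStratifying (o : PartialOrder (Sim R))
    (ha : ∀ L L', o.lt L L' ↔ a L < a L') (h : IsQuasiHereditary k o) :
    (∀ L, IsLayered k a (a L) (ClassStandard k a L)) ∧ IsStratifying.{u, w, x} k a := by
  have hF := (isAdapted_and_isExceptional_iff o ha).1 ⟨h.1.1, h.2⟩
  exact ⟨hF, isStratifying_of_hasFiltration hF (fun L =>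
    ⟨Submodule.quotEquivOfEq _ _ (standardKer_eq o ha hF L).symm⟩) h.1.2⟩

theorem isQuasiHereditary_of_isLayered [Finite X] (o : PartialOrder (Sim R))
    (ha : ∀ L L', o.lt L L' ↔ a L < a L')
    (hF : ∀ L, IsLayered k a (a L) (ClassStandard k a L)) (hS : IsStratifying.{u, w, u} k a) :
    IsQuasiHereditary k o := by
  have h := (isAdapted_and_isExceptional_iff (k := k) o ha).2 hF
  exact ⟨⟨h.1, hasFiltration_of_isStratifying hF (fun L =>
    ⟨Submodule.quotEquivOfEq _ _ (standardKer_eq o ha hF L).symm⟩) hS⟩, h.2⟩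

end Characterizations

end QuasiHereditary

namespace QuasiHereditary
universe u v w x

/-! ### Traces and layers of direct sums. -/

section DirectSums

variable {R : Type u} [Ring R] {k : Type w} [Field k] [Algebra k R] [FiniteDimensional k R]
  {U : Set (Sim R)} {ι : Type*} {M : ι → Type*} [∀ i, AddCommGroup (M i)] [∀ i, Module R (M i)]

theorem mem_tr_dfinsupp {z : Π₀ i, M i} :
    z ∈ tr k U (Π₀ i, M i) ↔ ∀ i, z i ∈ tr k U (M i) := by
  classical
  refine ⟨fun hz i => apply_mem_tr (DFinsupp.lapply i) hz, fun hz => ?_⟩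
  rw [← DFinsupp.sum_single (f := z)]
  exact Submodule.sum_mem _ fun i _ => apply_mem_tr (DFinsupp.lsingle (R := R) i) (hz i)

variable (k U M) in
theorem nonempty_tr_dfinsupp_equiv :
    Nonempty ((Π₀ i, tr k U (M i)) ≃ₗ[R] tr k U (Π₀ i, M i)) := by
  classical
  let j : (Π₀ i, tr k U (M i)) →ₗ[R] (Π₀ i, M i) :=
    DFinsupp.mapRange.linearMap fun i => (tr k U (M i)).subtype
  have hj : Function.Injective j := fun y z h => by
    ext i
    exact DFunLike.congr_fun h i
  have hr : LinearMap.range j = tr k U (Π₀ i, M i) := by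
    refine le_antisymm ?_ fun z hz => ?_
    · rintro _ ⟨y, rfl⟩
      exact mem_tr_dfinsupp.2 fun i => (y i).2
    · rw [mem_tr_dfinsupp] at hz
      rw [← DFinsupp.sum_single (f := z)]
      refine Submodule.sum_mem _ fun i _ => ⟨DFinsupp.single i ⟨z i, hz i⟩, ?_⟩
      simp [j]
  exact ⟨(LinearEquiv.ofInjective j hj).trans (LinearEquiv.ofEq _ _ hr)⟩

theorem projective_tr_dfinsupp [∀ i, Module.Projective R (tr k U (M i))] :
    Module.Projective R (tr k U (Π₀ i, M i)) :=
  Module.Projective.of_equiv (nonempty_tr_dfinsupp_equiv k U M).some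

theorem RelProj.tr_dfinsupp {V : Set (Sim R)} (h : ∀ i, RelProj.{u, w, x} k U (tr k V (M i))) :
    RelProj.{u, w, x} k U (tr k V (Π₀ i, M i)) := by
  classical
  obtain ⟨e⟩ := nonempty_tr_dfinsupp_equiv k V M
  refine RelProj.of_retract (Q' := Π₀ i, tr k V (M i)) ?_ e.symm.toLinearMap e.toLinearMap
    (by ext; simp)
  intro N₁ N₂ _ _ _ _ g hg hN f
  choose f' hf' using fun i => h i N₁ N₂ g hg hN 
    (f ∘ₗ DFinsupp.lsingle (R := R) (M := fun i => tr k V (M i)) i)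
  refine ⟨DFinsupp.lsum ℕ f', DFinsupp.lhom_ext' fun i => ?_⟩
  rw [← hf' i]
  ext y
  simp

variable {X : Type*} [PartialOrder X] {a : Sim R → X}

theorem isLayered_dfinsupp {c : X} (h : ∀ i, IsLayered k a c (M i)) :
    IsLayered k a c (Π₀ i, M i) := by
  classical
  constructor
  · have := fun i => (h i).1
    let q : (Π₀ i, M i) →ₗ[R] Π₀ i, (M i ⧸ tr k (a ⁻¹' Set.Iio c) (M i)) :=
      DFinsupp.mapRange.linearMap fun i => (tr k (a ⁻¹' Set.Iio c) (M i)).mkQ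
    have hker : LinearMap.ker q = tr k (a ⁻¹' Set.Iio c) (Π₀ i, M i) := by
      ext z
      rw [mem_tr_dfinsupp, LinearMap.mem_ker, DFinsupp.ext_iff]
      refine forall_congr' fun i => ?_
      simp [q]
    rw [← hker]
    exact IsSemisimpleModule.of_injective
      ((LinearMap.range q).subtype ∘ₗ q.quotKerEquivRange.toLinearMap)
      ((LinearMap.range q).injective_subtype.comp q.quotKerEquivRange.injective)
  · refine tr_eq_bot_iff.2 fun L hL φ => ?_
    ext y i
    have := tr_eq_bot_iff.1 (h i).2 L hL
      (trMap (a ⁻¹' Set.Iio c) (DFinsupp.lapply (R := R) (M := M) i) ∘ₗ φ)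
    exact congrArg Subtype.val (LinearMap.congr_fun this y)

end DirectSums

/-! ### Modules generated by a single class. -/

section Generated

variable {R : Type u} [Ring R] {k : Type w} [Field k] [Algebra k R] [FiniteDimensional k R]
  {X : Type*} {a : Sim R → X} {M : Type*} [AddCommGroup M] [Module R M]

variable (k a M) in
/-- The homomorphisms to `M` from projective covers of the simple modules in the class `c`. -/
abbrev ClassHom (c : X) : Type _ := Σ L : {L : Sim R // a L = c}, projCover k L.1 →ₗ[R] M

open Classical in
theorem lsum_surjective_of_tr_eq_top {c : X} (h : tr k (a ⁻¹' {c}) M = ⊤)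
    {D : ClassHom k a M c → Type*} [∀ i, AddCommGroup (D i)] [∀ i, Module R (D i)]
    (f : ∀ i, D i →ₗ[R] M) (hf : ∀ i, LinearMap.range i.2 ≤ LinearMap.range (f i)) :
    Function.Surjective (DFinsupp.lsum ℕ f : (Π₀ i, D i) →ₗ[R] M) := by
  rw [← LinearMap.range_eq_top, eq_top_iff, ← h, tr_le_iff]
  intro L hL φ
  refine (hf ⟨⟨L, hL⟩, φ⟩).trans ?_
  rintro _ ⟨y, rfl⟩
  exact ⟨DFinsupp.single _ y, by simp⟩

variable [PartialOrder X]

/-- As nothing above `c` occurs in `M`, each map `P_L → M` with `L` in class `c` factors through the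
class standard module. Summing over all these maps avoids any finiteness condition. -/
theorem exists_dfinsupp_classStandard_surjective {c : X} (h : tr k (a ⁻¹' {c}) M = ⊤)
    (h' : tr k (a ⁻¹' Set.Ioi c) M = ⊥) :
    ∃ f : (Π₀ i : ClassHom k a M c, ClassStandard k a i.1.1) →ₗ[R] M, Function.Surjective f := by
  classical
  have key : ∀ i : ClassHom k a M c, ∃ f : ClassStandard k a i.1.1 →ₗ[R] M,
      LinearMap.range i.2 ≤ LinearMap.range f := by
    rintro ⟨⟨L, rfl⟩, φ⟩
    refine ⟨Submodule.liftQ _ φ fun y hy => apply_eq_zero_of_mem_tr φ h' hy, ?_⟩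
    rintro _ ⟨y, rfl⟩
    exact ⟨Submodule.Quotient.mk y, rfl⟩
  choose f hf using key
  exact ⟨_, lsum_surjective_of_tr_eq_top h f hf⟩

theorem isLayered_of_tr_eq_top (hF : ∀ L, IsLayered k a (a L) (ClassStandard k a L)) {c : X}
    (h : tr k (a ⁻¹' {c}) M = ⊤) (h' : tr k (a ⁻¹' Set.Ioi c) M = ⊥) : IsLayered k a c M := by
  obtain ⟨f, hf⟩ := exists_dfinsupp_classStandard_surjective h h'
  refine IsLayered.of_surjective (isLayered_dfinsupp ?_) f hf
  rintro ⟨⟨L, rfl⟩, φ⟩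
  exact hF L

theorem isSemisimpleModule_of_tr_eq_top
    (hF : ∀ L, IsSemisimpleModule R (ClassStandard k a L)) {c : X}
    (h : tr k (a ⁻¹' {c}) M = ⊤) (h' : tr k (a ⁻¹' Set.Ioi c) M = ⊥) :
    IsSemisimpleModule R M := by
  obtain ⟨f, hf⟩ := exists_dfinsupp_classStandard_surjective h h'
  exact IsSemisimpleModule.of_surjective f hf

theorem projective_tr_of_retract {M' : Type*} [AddCommGroup M'] [Module R M'] {U : Set (Sim R)}
    [Module.Projective R (tr k U M')] (i : M →ₗ[R] M') (p : M' →ₗ[R] M)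
    (hpi : p ∘ₗ i = LinearMap.id) : Module.Projective R (tr k U M) :=
  Module.Projective.of_split (trMap U i) (trMap U p) (by
    ext m
    exact LinearMap.congr_fun hpi m.1)

/-- `M` is a summand of a direct sum of covers `P_L` with `L` in class `c`, and traces respect
direct sums and summands. -/
theorem projective_tr_of_tr_eq_top [Module.Projective R M]
    (hP : ∀ L, Module.Projective R (tr k (a ⁻¹' Set.Ioi (a L)) (projCover k L))) {c : X}
    (h : tr k (a ⁻¹' {c}) M = ⊤) : Module.Projective R (tr k (a ⁻¹' Set.Ioi c) M) := by
  classical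
  have hs := lsum_surjective_of_tr_eq_top (D := fun i : ClassHom k a M c => projCover k i.1.1) h
    (fun i => i.2) fun _ => le_rfl
  obtain ⟨s, hs⟩ := Module.projective_lifting_property _ LinearMap.id hs
  have : ∀ i : ClassHom k a M c,
      Module.Projective R (tr k (a ⁻¹' Set.Ioi c) (projCover k i.1.1)) := by
    rintro ⟨⟨L, rfl⟩, φ⟩
    exact hP L
  have := projective_tr_dfinsupp (k := k) (U := a ⁻¹' Set.Ioi c)
    (M := fun i : ClassHom k a M c => projCover k i.1.1)
  exact projective_tr_of_retract s _ hs

end Generated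

end QuasiHereditary

namespace QuasiHereditary
universe u v w x

open SkewMonoidAlgebra

/-! ### Modules over the skew group algebra and averaging. -/

section SkewBasics

theorem single_smul_single_smul {A : Type u} [Ring A] {G : Type v} [Group G]
    [MulSemiringAction G A] {N : Type*} [AddCommGroup N] [Module (SkewMonoidAlgebra A G) N] (g h : G) (n : N) :
    (single g (1 : A) : SkewMonoidAlgebra A G) • (single h (1 : A) : SkewMonoidAlgebra A G) • n =
      (single (g * h) (1 : A) : SkewMonoidAlgebra A G) • n := by
  rw [← mul_smul]
  simp [single_mul_single]

variable {A : Type u} [Ring A] {G : Type v} [Group G] [MulSemiringAction G A]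
  {N : Type*} [AddCommGroup N] [Module A N] [Module (SkewMonoidAlgebra A G) N]
  [IsScalarTower A (SkewMonoidAlgebra A G) N]

theorem single_one_smul (a : A) (n : N) :
    (single (1 : G) a : SkewMonoidAlgebra A G) • n = a • n := by
  have : (single (1 : G) a : SkewMonoidAlgebra A G) = a • (1 : SkewMonoidAlgebra A G) := by
    change _ = a • single (1 : G) (1 : A)
    rw [smul_single, smul_eq_mul, mul_one]
  rw [this, smul_assoc, one_smul]

theorem single_smul_smul (g : G) (a : A) (n : N) :
    (single g (1 : A) : SkewMonoidAlgebra A G) • a • n =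
      (g • a) • (single g (1 : A) : SkewMonoidAlgebra A G) • n := by
  rw [← single_one_smul (G := G) a n, ← single_one_smul (G := G) (g • a), ← mul_smul, ← mul_smul]
  simp [single_mul_single]

theorem single_one_one_smul (n : N) :
    (single (1 : G) (1 : A) : SkewMonoidAlgebra A G) • n = n := by
  rw [single_one_smul, one_smul]

variable (A) in
/-- The semilinear automorphism of a module over the skew group algebra given by `g`. -/
noncomputable def gAct (N : Type*) [AddCommGroup N] [Module A N] [Module (SkewMonoidAlgebra A G) N]
    [IsScalarTower A (SkewMonoidAlgebra A G) N] (g : G) :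
    N →ₛₗ[MulSemiringAction.toRingHom G A g] N where
  toFun n := (single g (1 : A) : SkewMonoidAlgebra A G) • n
  map_add' := smul_add _
  map_smul' a n := single_smul_smul g a n

/-- A submodule over `A` that is stable under the group, as a submodule over the skew group
algebra. -/
def toSkew (T : Submodule A N)
    (h : ∀ (g : G), ∀ n ∈ T, (single g (1 : A) : SkewMonoidAlgebra A G) • n ∈ T) :
    Submodule (SkewMonoidAlgebra A G) N where
  carrier := T
  add_mem' := T.add_mem
  zero_mem' := T.zero_mem
  smul_mem' c n hn := by
    induction c using SkewMonoidAlgebra.induction_on with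
    | zero => rw [zero_smul]; exact T.zero_mem
    | single g a =>
      rw [single_eq, mul_smul, single_one_smul]
      exact T.smul_mem a (h g n hn)
    | add p q hp hq => rw [add_smul]; exact T.add_mem hp hq

variable {N' : Type*} [AddCommGroup N'] [Module A N'] [Module (SkewMonoidAlgebra A G) N']
  [IsScalarTower A (SkewMonoidAlgebra A G) N']

/-- An additive map commuting with `A` and `G` is linear over the skew group algebra. -/
def skewLinearMap (f : N →ₗ[A] N')
    (h : ∀ (g : G) n, f ((single g (1 : A) : SkewMonoidAlgebra A G) • n) =
      (single g (1 : A) : SkewMonoidAlgebra A G) • f n) : N →ₗ[SkewMonoidAlgebra A G] N' where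
  toFun := f
  map_add' := f.map_add
  map_smul' c n := by
    induction c using SkewMonoidAlgebra.induction_on with
    | zero => simp
    | single g a =>
      rw [single_eq, mul_smul, single_one_smul, map_smul, h, RingHom.id_apply, mul_smul,
        single_one_smul]
    | add p q hp hq => rw [add_smul, map_add, hp, hq, RingHom.id_apply, RingHom.id_apply,
        RingHom.id_apply, add_smul]

/-- The sum of the conjugates of an `A`-linear map. -/
noncomputable def sumConj [Fintype G] (f : N →ₗ[A] N') : N →ₗ[SkewMonoidAlgebra A G] N' :=
  skewLinearMap
    { toFun := fun n => ∑ g : G, (single g (1 : A) : SkewMonoidAlgebra A G) •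
        f ((single g⁻¹ (1 : A) : SkewMonoidAlgebra A G) • n)
      map_add' := fun m n => by simp only [smul_add, map_add, Finset.sum_add_distrib]
      map_smul' := fun a n => by
        simp only [single_smul_smul, map_smul, smul_inv_smul, Finset.smul_sum, RingHom.id_apply] }
    (fun h n => by
      change (∑ g : G, _) = _ • ∑ g : G, _
      rw [Finset.smul_sum]
      refine (Fintype.sum_equiv (Equiv.mulLeft h) _ _ fun g => ?_).symm
      rw [single_smul_single_smul, single_smul_single_smul, Equiv.coe_mulLeft, mul_inv_rev,
        inv_mul_cancel_right])

theorem sumConj_apply [Fintype G] (f : N →ₗ[A] N') (n : N) :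
    sumConj (G := G) f n = ∑ g : G, (single g (1 : A) : SkewMonoidAlgebra A G) •
        f ((single g⁻¹ (1 : A) : SkewMonoidAlgebra A G) • n) := rfl

/-- Lifts over `A` can be averaged to lifts over the skew group algebra. -/
theorem exists_lift_of_restrictScalars [Finite G] {k : Type w} [Field k] [Algebra k A]
    [SMulCommClass G k A] (hG : (Nat.card G : k) ≠ 0) {P : Type*} [AddCommGroup P] [Module A P]
    [Module (SkewMonoidAlgebra A G) P] [IsScalarTower A (SkewMonoidAlgebra A G) P]
    (q : N →ₗ[SkewMonoidAlgebra A G] N') (f : P →ₗ[SkewMonoidAlgebra A G] N') (f' : P →ₗ[A] N)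
    (hf' : ∀ y, q (f' y) = f y) : ∃ f'' : P →ₗ[SkewMonoidAlgebra A G] N, q ∘ₗ f'' = f := by
  have := Fintype.ofFinite G
  let c : SkewMonoidAlgebra A G := algebraMap k _ (Nat.card G : k)⁻¹
  have hc : c * (Nat.card G : SkewMonoidAlgebra A G) = 1 := by
    rw [← map_natCast (algebraMap k (SkewMonoidAlgebra A G)), ← map_mul, inv_mul_cancel₀ hG,
      map_one]
  let s : P →ₗ[SkewMonoidAlgebra A G] N :=
    { toFun := fun y => c • sumConj f' y
      map_add' := fun y z => by rw [map_add, smul_add]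
      map_smul' := fun b y => by
        rw [map_smul, ← mul_smul, Algebra.commutes, mul_smul, RingHom.id_apply] }
  refine ⟨s, ?_⟩
  ext y
  change q (c • sumConj f' y) = f y
  rw [map_smul, sumConj_apply, _root_.map_sum]
  have : ∀ g : G, q ((single g (1 : A) : SkewMonoidAlgebra A G) •
      f' ((single g⁻¹ (1 : A) : SkewMonoidAlgebra A G) • y)) = f y := fun g => by
    rw [map_smul, hf', map_smul, single_smul_single_smul, mul_inv_cancel, single_one_one_smul]
  simp only [this, Finset.sum_const, Finset.card_univ, ← Nat.card_eq_fintype_card]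
  rw [← Nat.cast_smul_eq_nsmul (SkewMonoidAlgebra A G), ← mul_smul, hc, one_smul]

/-- A splitting of a free presentation over `A * G` is also one over `A`, since `A * G` is free over
`A`. -/
theorem projective_of_projective_skew [Module.Projective (SkewMonoidAlgebra A G) N] :
    Module.Projective A N := by
  obtain ⟨s, hs⟩ := Module.projective_def'.1 (inferInstance :
    Module.Projective (SkewMonoidAlgebra A G) N)
  have : Module.Projective A (N →₀ SkewMonoidAlgebra A G) := inferInstance
  refine Module.Projective.of_split (s.restrictScalars A)
    ((Finsupp.linearCombination (SkewMonoidAlgebra A G) id).restrictScalars A) ?_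
  ext n
  exact LinearMap.congr_fun hs n

end SkewBasics

/-! ### Semisimplicity and projectivity under restriction. -/

section RestrictionProperties

variable {A : Type u} [Ring A] {G : Type v} [Group G] [MulSemiringAction G A] [Finite G]
  {N : Type*} [AddCommGroup N] [Module A N] [Module (SkewMonoidAlgebra A G) N]
  [IsScalarTower A (SkewMonoidAlgebra A G) N]

variable (A G) in
/-- The restriction to `A` of a module over the skew group algebra, with either action of `A`. -/
def resEquiv (N : Type*) [AddCommGroup N] [Module A N] [Module (SkewMonoidAlgebra A G) N]
    [IsScalarTower A (SkewMonoidAlgebra A G) N] : N ≃ₗ[A] ResG A G N where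
  toFun n := n
  invFun n := n
  map_add' _ _ := rfl
  map_smul' a n := (single_one_smul (G := G) a n).symm
  left_inv _ := rfl
  right_inv _ := rfl

/-- Clifford for the forward direction, Maschke for the converse. -/
theorem isSemisimple_skew_iff [IsArtinianRing A] {k : Type w} [Field k] [Algebra k A]
    [SMulCommClass G k A] (hG : (Nat.card G : k) ≠ 0) :
    IsSemisimpleModule (SkewMonoidAlgebra A G) N ↔ IsSemisimpleModule A N := by
  constructor
  · classical
    intro h
    have h1 := sSup_simples_eq_top_iff_isSemisimpleModule
      (R := SkewMonoidAlgebra A G) (M := N) |>.2 h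
    refine isSemisimpleModule_of_isSemisimpleModule_submodule'
      (p := fun S : {m : Submodule (SkewMonoidAlgebra A G) N |
        IsSimpleModule (SkewMonoidAlgebra A G) m} => S.1.restrictScalars A) ?_ ?_
    · rintro ⟨S, hS⟩
      have : IsSimpleModule (SkewMonoidAlgebra A G) S := hS
      have := ResG.isSemisimple (A := A) (G := G) S
      exact IsSemisimpleModule.congr (resEquiv A G S)
    · rw [eq_top_iff]
      rintro n -
      have hn : n ∈ sSup {m : Submodule (SkewMonoidAlgebra A G) N |
        IsSimpleModule (SkewMonoidAlgebra A G) m} := h1 ▸ Submodule.mem_top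
      rw [sSup_eq_iSup', Submodule.mem_iSup_iff_exists_dfinsupp'] at hn
      obtain ⟨z, rfl⟩ := hn
      exact Submodule.sum_mem _ fun i _ => Submodule.mem_iSup_of_mem i (z i).2
  · intro h
    have : IsSemisimpleModule A (ResG A G N) := IsSemisimpleModule.congr (resEquiv A G N).symm
    exact isSemisimple_of_ResG hG N

/-- Average an `A`-linear section of a free presentation over `A * G`. -/
theorem projective_skew_of_projective {k : Type w} [Field k] [Algebra k A]
    [SMulCommClass G k A] (hG : (Nat.card G : k) ≠ 0) [Module.Projective A N] :
    Module.Projective (SkewMonoidAlgebra A G) N := by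
  let q : (N →₀ SkewMonoidAlgebra A G) →ₗ[SkewMonoidAlgebra A G] N :=
    Finsupp.linearCombination (SkewMonoidAlgebra A G) id
  have hq : Function.Surjective q := fun n => ⟨Finsupp.single n 1, by simp [q]⟩
  obtain ⟨s, hs⟩ := Module.projective_lifting_property (q.restrictScalars A) LinearMap.id hq
  obtain ⟨s', hs'⟩ := exists_lift_of_restrictScalars hG q LinearMap.id s
    (LinearMap.congr_fun hs)
  exact Module.Projective.of_split s' q hs'

end RestrictionProperties

end QuasiHereditary

namespace QuasiHereditary
universe u v w x

open SkewMonoidAlgebra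

/-- Twisted counterpart of `isCompositionFactor_iff`. It lets group elements act inside a module
without forming twisted modules. -/
theorem exists_isCompositionFactor_of_semilinear {R : Type u} [Ring R] {k : Type w} [Field k]
    [Algebra k R] [FiniteDimensional k R] {M : Type*} [AddCommGroup M] [Module R M]
    {σ : R →+* R} [RingHomSurjective σ] {L : Sim R} (ψ : projCover k L →ₛₗ[σ] M) (hψ : ψ ≠ 0) :
    ∃ L₀ : Sim R, IsCompositionFactor L₀ M ∧
      ∃ e : L.module →ₛₗ[σ] L₀.module, Function.Bijective e := by
  have hle : LinearMap.ker ψ ≤ LinearMap.ker (projCoverMap k L) :=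
    le_ker_projCoverMap k fun h => hψ (LinearMap.ker_eq_top.1 h)
  set K := LinearMap.ker (projCoverMap k L)
  let eK : (projCover k L ⧸ K) ≃ₗ[R] L.module := (projCoverMap k L).quotKerEquivOfSurjective
    (projCoverMap_isProjectiveCover k L).surjective
  let l : (projCover k L ⧸ K) →ₛₗ[σ] M ⧸ K.map ψ :=
    K.mapQ (K.map ψ) ψ (Submodule.le_comap_map ψ K)
  have hl : Function.Injective l := by
    rw [← LinearMap.ker_eq_bot]
    refine (Submodule.eq_bot_iff _).2 fun y hy => ?_
    obtain ⟨y, rfl⟩ := K.mkQ_surjective y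
    have : ψ y ∈ K.map ψ := by simpa [l] using hy
    obtain ⟨z, hz, hzy⟩ := this
    have h1 : y - z ∈ K := hle (by simp [hzy])
    simpa using K.add_mem h1 hz
  let l' : L.module →ₛₗ[σ] LinearMap.range l := l.rangeRestrict.comp eK.symm.toLinearMap
  have hl' : Function.Bijective l' :=
    Function.Bijective.comp (g := l.rangeRestrict)
      ⟨fun y z h => hl (congrArg Subtype.val h), l.surjective_rangeRestrict⟩ eK.symm.bijective
  have : IsSimpleModule R (LinearMap.range l) :=
    (LinearMap.isSimpleModule_iff_of_bijective l' hl').1 inferInstance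
  obtain ⟨L₀, ⟨e₀⟩, -⟩ := Sim.existsUnique (A := R) (LinearMap.range l)
  exact ⟨L₀, ⟨K.map ψ, (LinearMap.range l).subtype ∘ₗ e₀.symm.toLinearMap,
    (LinearMap.range l).injective_subtype.comp e₀.symm.injective⟩,
    e₀.toLinearMap.comp l', e₀.bijective.comp hl'⟩

/-! ### Comparison of traces over `A` and over `A * G`. -/

section Transfer

variable {A : Type u} [Ring A] {G : Type v} [Group G] [MulSemiringAction G A]
  {k : Type w} [Field k] [Algebra k A] [FiniteDimensional k A] {X : Type*} {a : Sim A → X}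
  {b : Sim (SkewMonoidAlgebra A G) → X}

/-- A partition of the simple modules over `A` and over `A * G` into classes, such that the class
of `L` is stable under the group and the composition factors of the restriction of `S` form the
class of `S`. -/
structure ClassCompatible (a : Sim A → X) (b : Sim (SkewMonoidAlgebra A G) → X) : Prop where
  eq_iff : ∀ (L : Sim A) (S : Sim (SkewMonoidAlgebra A G)),
    IsCompositionFactor L S.module ↔ a L = b S
  eq_of_semilinear : ∀ (L L' : Sim A) (g : G)
    (e : L.module →ₛₗ[MulSemiringAction.toRingHom G A g] L'.module),
    Function.Bijective e → a L = a L'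

variable {N : Type*} [AddCommGroup N] [Module A N] [Module (SkewMonoidAlgebra A G) N]
  [IsScalarTower A (SkewMonoidAlgebra A G) N]

namespace ClassCompatible

variable {U : Set X}

/-- Otherwise `g` after some `φ : P_L → N` is a nonzero semilinear map to `N / tr`, which then has a
twist of `L` as a factor; but twists stay in the same class. -/
theorem smul_mem_tr (hc : ClassCompatible a b) (g : G) {n : N} (hn : n ∈ tr k (a ⁻¹' U) N) :
    (single g (1 : A) : SkewMonoidAlgebra A G) • n ∈ tr k (a ⁻¹' U) N := by
  set T := tr k (a ⁻¹' U) N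
  have hle : T ≤ T.comap (gAct A N g) := by
    refine tr_le_iff.2 fun L hL φ => ?_
    rintro _ ⟨y, rfl⟩
    let ψ : projCover k L →ₛₗ[MulSemiringAction.toRingHom G A g] N ⧸ T :=
      (T.mkQ.comp (gAct A N g)).comp φ
    have hψ : ψ = 0 := by
      by_contra hψ
      obtain ⟨L₀, hL₀, e, he⟩ := exists_isCompositionFactor_of_semilinear ψ hψ
      refine tr_eq_bot_iff_isCompositionFactor.1 (tr_quotient_tr (k := k) (U := a ⁻¹' U) (M := N))
        L₀ ?_ hL₀
      change a L₀ ∈ U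
      rw [← hc.eq_of_semilinear L L₀ g e he]
      exact hL
    have := LinearMap.congr_fun hψ y
    exact (Submodule.Quotient.mk_eq_zero T).1 this
  exact hle hn

variable [Finite G] [SMulCommClass G k A]

/-- Let `W` be the `A * G`-span of the image of a nonzero `P_L → N`. The trace over `A` is
`G`-stable, so it is all of `W` and all of any simple quotient `S` of `W`. Hence `b S ∈ U`, and the
nonzero lift `P_S → W` contradicts the hypothesis. -/
theorem tr_eq_bot_of_skew (hc : ClassCompatible a b) (h : tr k (b ⁻¹' U) N = ⊥) :
    tr k (a ⁻¹' U) N = ⊥ := by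
  refine tr_eq_bot_iff.2 fun L hL φ => ?_
  by_contra hφ
  have : IsArtinianRing A := IsArtinianRing.of_finite k A
  obtain ⟨t, ht⟩ : (LinearMap.range φ).FG := Module.Finite.iff_fg.1 (Module.Finite.range φ)
  set W : Submodule (SkewMonoidAlgebra A G) N :=
    Submodule.span _ (LinearMap.range φ : Set N)
  have hW : Module.Finite (SkewMonoidAlgebra A G) W := by
    refine Module.Finite.iff_fg.2 ⟨t, le_antisymm (Submodule.span_mono ?_) ?_⟩
    · rw [← ht]; exact Submodule.subset_span
    · refine Submodule.span_le.2 ?_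
      have h1 : LinearMap.range φ ≤
          (Submodule.span (SkewMonoidAlgebra A G) (t : Set N)).restrictScalars A := by
        rw [← ht]
        exact Submodule.span_le.2 Submodule.subset_span
      exact h1
  have hφW : ∀ y, φ y ∈ W.restrictScalars A := fun y => Submodule.subset_span ⟨y, rfl⟩
  let φ' : projCover k L →ₗ[A] W := φ.codRestrict (W.restrictScalars A) hφW
  have hWtop : tr k (a ⁻¹' U) W = ⊤ := by
    let T : Submodule (SkewMonoidAlgebra A G) W :=
      toSkew (tr k (a ⁻¹' U) W) fun g n hn => hc.smul_mem_tr g hn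
    have h1 : W ≤ T.map W.subtype := by
      refine Submodule.span_le.2 ?_
      rintro _ ⟨y, rfl⟩
      exact ⟨φ' y, range_le_tr hL φ' ⟨y, rfl⟩, rfl⟩
    rw [eq_top_iff]
    rintro ⟨n, hn⟩ -
    obtain ⟨m, hm, hmn⟩ := h1 hn
    have : m = ⟨n, hn⟩ := Subtype.ext hmn
    exact this ▸ hm
  have : Nontrivial W := by
    obtain ⟨y, hy⟩ := DFunLike.ne_iff.1 hφ
    exact ⟨⟨φ' y, 0, fun h => hy (congrArg Subtype.val h)⟩⟩
  obtain ⟨S, f, hf⟩ := exists_surjective_simple (SkewMonoidAlgebra A G) W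
  have hS : tr k (a ⁻¹' U) S.module = ⊤ :=
    tr_eq_top_of_surjective (f.restrictScalars A) hf hWtop
  have hS' : tr k (a ⁻¹' U) S.module ≠ ⊥ := by rw [hS]; exact top_ne_bot
  rw [Ne, tr_eq_bot_iff_isCompositionFactor] at hS'
  push Not at hS'
  obtain ⟨L', hL', hL'S⟩ := hS'
  have hSU : b S ∈ U := by
    rw [← (hc.eq_iff L' S).1 hL'S]
    exact hL'
  obtain ⟨ψ, hψ⟩ := Module.projective_lifting_property f (projCoverMap k S) hf
  have h0 : W.subtype ∘ₗ ψ = 0 := tr_eq_bot_iff.1 h S hSU _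
  obtain ⟨y, hy⟩ := exists_ne (0 : S.module)
  obtain ⟨z, rfl⟩ := (projCoverMap_isProjectiveCover k S).surjective y
  have hz : ψ z = 0 := Subtype.ext (LinearMap.congr_fun h0 z)
  refine hy ?_
  rw [← hψ, LinearMap.comp_apply, hz, map_zero]

theorem tr_skew_eq_bot (hc : ClassCompatible a b) (h : tr k (a ⁻¹' U) N = ⊥) :
    tr k (b ⁻¹' U) N = ⊥ := by
  refine tr_eq_bot_iff_isCompositionFactor.2 fun S hS => ?_
  rintro ⟨T, i, hi⟩
  obtain ⟨L, hL⟩ := exists_isCompositionFactor A S.module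
  have h1 : tr k (a ⁻¹' U) (N ⧸ T) = ⊥ :=
    tr_eq_bot_of_surjective (T.mkQ.restrictScalars A) T.mkQ_surjective h
  have h2 : tr k (a ⁻¹' U) S.module = ⊥ :=
    tr_eq_bot_of_injective (i.restrictScalars A) hi h1
  refine tr_eq_bot_iff_isCompositionFactor.1 h2 L ?_ hL
  change a L ∈ U
  rw [(hc.eq_iff L S).1 hL]
  exact hS

theorem tr_eq_bot_iff_skew (hc : ClassCompatible a b) :
    tr k (b ⁻¹' U) N = ⊥ ↔ tr k (a ⁻¹' U) N = ⊥ :=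
  ⟨hc.tr_eq_bot_of_skew, hc.tr_skew_eq_bot⟩

/-- Each trace is the smallest submodule whose quotient has no factor in `U`, a condition that means
the same over both rings. The trace over `A` is a submodule over `A * G` by `smul_mem_tr`. -/
theorem mem_tr_skew_iff (hc : ClassCompatible a b) {n : N} :
    n ∈ tr k (b ⁻¹' U) N ↔ n ∈ tr k (a ⁻¹' U) N := by
  constructor
  · let T : Submodule (SkewMonoidAlgebra A G) N :=
      toSkew (tr k (a ⁻¹' U) N) fun g n hn => hc.smul_mem_tr g hn
    suffices h : tr k (b ⁻¹' U) N ≤ T from fun hn => h hn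
    rw [← tr_quotient_eq_bot_iff, hc.tr_eq_bot_iff_skew]
    rw [eq_bot_iff, ← map_tr_of_surjective (T.mkQ.restrictScalars A) T.mkQ_surjective]
    rintro _ ⟨n, hn, rfl⟩
    exact (Submodule.Quotient.mk_eq_zero T).2 hn
  · intro hn
    have h : tr k (a ⁻¹' U) (N ⧸ tr k (b ⁻¹' U) N) = ⊥ :=
      hc.tr_eq_bot_iff_skew.1 tr_quotient_tr
    have := apply_eq_zero_of_mem_tr ((tr k (b ⁻¹' U) N).mkQ.restrictScalars A) h hn
    exact (Submodule.Quotient.mk_eq_zero _).1 this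

theorem tr_skew_eq_top_iff (hc : ClassCompatible a b) :
    tr k (b ⁻¹' U) N = ⊤ ↔ tr k (a ⁻¹' U) N = ⊤ := by
  simp only [Submodule.eq_top_iff', hc.mem_tr_skew_iff]

variable (N U) in
/-- The traces over `A * G` and over `A` agree. -/
noncomputable def trEquiv (hc : ClassCompatible a b) :
    tr k (b ⁻¹' U) N ≃ₗ[A] tr k (a ⁻¹' U) N where
  toFun n := ⟨n.1, hc.mem_tr_skew_iff.1 n.2⟩
  invFun n := ⟨n.1, hc.mem_tr_skew_iff.2 n.2⟩
  map_add' _ _ := rfl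
  map_smul' _ _ := rfl
  left_inv _ := rfl
  right_inv _ := rfl

variable (N U) in
theorem nonempty_quotient_tr_equiv (hc : ClassCompatible a b) :
    Nonempty ((N ⧸ tr k (b ⁻¹' U) N) ≃ₗ[A] (N ⧸ tr k (a ⁻¹' U) N)) := by
  have h : (tr k (b ⁻¹' U) N).restrictScalars A = tr k (a ⁻¹' U) N := by
    ext n
    exact hc.mem_tr_skew_iff
  exact ⟨((Submodule.Quotient.restrictScalarsEquiv A (tr k (b ⁻¹' U) N)).symm).trans
    (Submodule.quotEquivOfEq _ _ h)⟩

theorem isLayered_skew_iff [PartialOrder X] (hG : (Nat.card G : k) ≠ 0) (hc : ClassCompatible a b) {c : X} :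
    IsLayered k b c N ↔ IsLayered k a c N := by
  have : IsArtinianRing A := IsArtinianRing.of_finite k A
  obtain ⟨e⟩ := hc.nonempty_quotient_tr_equiv (k := k) N (Set.Iio c)
  let e' := hc.trEquiv (k := k) N (Set.Iio c)
  refine and_congr ((isSemisimple_skew_iff hG).trans
    ⟨fun _ => IsSemisimpleModule.congr e.symm, fun _ => IsSemisimpleModule.congr e⟩)
    (hc.tr_eq_bot_iff_skew.trans ⟨fun h => ?_, fun h => ?_⟩)
  · exact tr_eq_bot_of_surjective e'.toLinearMap e'.surjective h
  · exact tr_eq_bot_of_surjective e'.symm.toLinearMap e'.symm.surjective h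

end ClassCompatible

end Transfer

end QuasiHereditary

namespace QuasiHereditary
universe u v w x

open SkewMonoidAlgebra

theorem isSemisimpleModule_of_isSimpleModule_skew {A : Type u} [Ring A] [IsArtinianRing A]
    {G : Type v} [Group G] [MulSemiringAction G A] [Finite G] {N : Type*} [AddCommGroup N]
    [Module A N] [Module (SkewMonoidAlgebra A G) N] [IsScalarTower A (SkewMonoidAlgebra A G) N]
    [IsSimpleModule (SkewMonoidAlgebra A G) N] : IsSemisimpleModule A N :=
  have := ResG.isSemisimple (A := A) (G := G) N
  IsSemisimpleModule.congr (resEquiv A G N)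

/-- An `A`-linear map that vanishes on a submodule over `A * G` factors over the quotient. -/
theorem exists_factor_quotient {A : Type u} [Ring A] {G : Type v} [Group G]
    [MulSemiringAction G A] {N : Type*} [AddCommGroup N] [Module A N]
    [Module (SkewMonoidAlgebra A G) N] [IsScalarTower A (SkewMonoidAlgebra A G) N]
    {P : Type*} [AddCommGroup P] [Module A P] (T : Submodule (SkewMonoidAlgebra A G) N)
    (f : N →ₗ[A] P) (h : ∀ n ∈ T, f n = 0) :
    ∃ f' : (N ⧸ T) →ₗ[A] P, ∀ n, f' (T.mkQ n) = f n :=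
  ⟨((T.restrictScalars A).liftQ f h) ∘ₗ
    (Submodule.Quotient.restrictScalarsEquiv A T).symm.toLinearMap, fun _ => rfl⟩

/-! ### Transfer of the layered, semisimple, projective and stratifying conditions. -/

namespace ClassCompatible

variable {A : Type u} [Ring A] {G : Type v} [Group G] [MulSemiringAction G A]
  {k : Type w} [Field k] [Algebra k A] [FiniteDimensional k A] [Finite G] [SMulCommClass G k A]
  {X : Type*} {a : Sim A → X} {b : Sim (SkewMonoidAlgebra A G) → X}

/-- The nonzero map `P_L ⊆ A → A * G` shows that the class of `L` occurs in `A * G`, hence already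
among its simple factors over `A * G`. -/
theorem exists_class_eq (k : Type w) [Field k] [Algebra k A] [FiniteDimensional k A]
    [SMulCommClass G k A] (hc : ClassCompatible a b) (L : Sim A) : ∃ S, a L = b S := by
  by_contra! h
  have h1 : tr k (b ⁻¹' {a L}) (SkewMonoidAlgebra A G) = ⊥ :=
    tr_eq_bot_iff.2 fun S hS => (h S hS.symm).elim
  have h2 := tr_eq_bot_iff.1 (hc.tr_eq_bot_of_skew h1) L rfl
    (LinearMap.toSpanSingleton A (SkewMonoidAlgebra A G) 1 ∘ₗ (projCover k L).subtype)
  obtain ⟨y, hy⟩ := exists_ne (0 : projCover k L)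
  refine hy (Subtype.ext ?_)
  have h3 : (y : A) • (1 : SkewMonoidAlgebra A G) = 0 := LinearMap.congr_fun h2 y
  have h4 : (y : A) • (1 : SkewMonoidAlgebra A G) = single (1 : G) (y : A) := by
    change (y : A) • single (1 : G) (1 : A) = _
    rw [smul_single, smul_eq_mul, mul_one]
  rw [h4] at h3
  exact (single_eq_zero).1 h3

/-- Projective covers over `A` are direct summands of restrictions of projective covers over
`A * G`. -/
theorem exists_projCover_retract (hc : ClassCompatible a b) (L : Sim A) :
    ∃ S, a L = b S ∧ ∃ (i : projCover k L →ₗ[A] projCover k S)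
      (p : projCover k S →ₗ[A] projCover k L), p ∘ₗ i = LinearMap.id := by
  have : IsArtinianRing A := IsArtinianRing.of_finite k A
  obtain ⟨S, hS⟩ := hc.exists_class_eq k L
  refine ⟨S, hS, ?_⟩
  have hss : IsSemisimpleModule A S.module :=
    isSemisimpleModule_of_isSimpleModule_skew (G := G)
  obtain ⟨φ, hφ⟩ := (isCompositionFactor_iff k).1 ((hc.eq_iff L S).2 hS)
  have : Nontrivial (LinearMap.range φ) :=
    Submodule.nontrivial_iff_ne_bot.2 fun h => hφ (LinearMap.range_eq_bot.1 h)
  obtain ⟨f, hf⟩ := exists_hom_simple φ.surjective_rangeRestrict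
  obtain ⟨C, hC⟩ := exists_isCompl (LinearMap.range φ)
  let q : S.module →ₗ[A] L.module := f ∘ₗ (LinearMap.range φ).projectionOnto C hC
  have hq : Function.Surjective q := by
    refine (LinearMap.surjective_of_ne_zero hf).comp fun y => ⟨y, ?_⟩
    exact Submodule.projectionOnto_apply_left hC y
  have hproj : Module.Projective A (projCover k S) := projective_of_projective_skew (G := G)
  -- Lift `P_S → S → L` to `P_S → P_L`. This is onto because the kernel of a projective cover is
  -- superfluous, and it splits because `P_L` is projective.
  obtain ⟨p, hp⟩ := Module.projective_lifting_property (projCoverMap k L)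
    (q ∘ₗ (projCoverMap k S).restrictScalars A)
    (projCoverMap_isProjectiveCover k L).surjective
  have hps : Function.Surjective p := surjective_of_comp_projCoverMap k (by
    rw [hp]
    exact hq.comp (projCoverMap_isProjectiveCover k S).surjective)
  obtain ⟨i, hi⟩ := Module.projective_lifting_property p LinearMap.id hps
  exact ⟨i, p, hi⟩

theorem tr_singleton_projCover (hc : ClassCompatible a b) (S : Sim (SkewMonoidAlgebra A G)) :
    tr k (a ⁻¹' {b S}) (projCover k S) = ⊤ :=
  hc.tr_skew_eq_top_iff.1 (tr_projCover_eq_top (U := b ⁻¹' {b S}) rfl)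

/-- One lifting problem over `A * G` suffices: lift `Q → Q / tr Q` to `s : Q → F / tr F` with `F`
finite free over `A * G`. A problem over `A` is solved on `F`, which is `A`-projective; the solution
descends to `F / tr F` and is pulled back along `s`. The universe of the test modules over `A` is
thereby arbitrary. -/
theorem relProj_of_skew (hc : ClassCompatible a b) {U : Set X} {Q : Type max u v}
    [AddCommGroup Q] [Module A Q] [Module (SkewMonoidAlgebra A G) Q]
    [IsScalarTower A (SkewMonoidAlgebra A G) Q] [Module.Finite (SkewMonoidAlgebra A G) Q]
    (h : RelProj.{max u v, w, max u v} k (b ⁻¹' U) Q) : RelProj.{u, w, x} k (a ⁻¹' U) Q := by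
  obtain ⟨n, q, hq⟩ := Module.Finite.exists_fin' (SkewMonoidAlgebra A G) (Q ⧸ tr k (b ⁻¹' U) Q)
  let T := tr k (b ⁻¹' U) (Fin n → SkewMonoidAlgebra A G)
  let g : ((Fin n → SkewMonoidAlgebra A G) ⧸ T) →ₗ[SkewMonoidAlgebra A G] Q ⧸ tr k (b ⁻¹' U) Q :=
    T.liftQ q fun y hy => apply_eq_zero_of_mem_tr q tr_quotient_tr hy
  have hg : Function.Surjective g := fun y => by
    obtain ⟨z, rfl⟩ := hq y
    exact ⟨Submodule.Quotient.mk z, rfl⟩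
  obtain ⟨s, hs⟩ := h _ _ g hg tr_quotient_tr (Submodule.mkQ _)
  intro N₁ N₂ _ _ _ _ g' hg' hN f
  have hN₂ := tr_eq_bot_of_surjective g' hg' hN
  obtain ⟨f₁, hf₁⟩ := exists_factor_quotient (tr k (b ⁻¹' U) Q) f fun y hy =>
    apply_eq_zero_of_mem_tr f hN₂ (hc.mem_tr_skew_iff.1 hy)
  obtain ⟨f₂, hf₂⟩ := Module.projective_lifting_property g' (f₁ ∘ₗ q.restrictScalars A) hg'
  obtain ⟨f₃, hf₃⟩ := exists_factor_quotient T f₂ fun y hy =>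
    apply_eq_zero_of_mem_tr f₂ hN (hc.mem_tr_skew_iff.1 hy)
  refine ⟨f₃ ∘ₗ s.restrictScalars A, LinearMap.ext fun y => ?_⟩
  obtain ⟨z, hz⟩ := T.mkQ_surjective (s y)
  have h2 : q z = (tr k (b ⁻¹' U) Q).mkQ y := by
    rw [← hs, LinearMap.comp_apply, ← hz]
    rfl
  change g' (f₃ (s y)) = f y
  rw [← hz, hf₃, ← hf₁, ← h2]
  exact LinearMap.congr_fun hf₂ z

section Order

variable [PartialOrder X]

theorem tr_singleton_classStandard (hc : ClassCompatible a b) (S : Sim (SkewMonoidAlgebra A G)) :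
    tr k (a ⁻¹' {b S}) (ClassStandard k b S) = ⊤ :=
  hc.tr_skew_eq_top_iff.1 (tr_eq_top_of_surjective _ (Submodule.mkQ_surjective _)
    (tr_projCover_eq_top (U := b ⁻¹' {b S}) rfl))

theorem tr_Ioi_classStandard (hc : ClassCompatible a b) (S : Sim (SkewMonoidAlgebra A G)) :
    tr k (a ⁻¹' Set.Ioi (b S)) (ClassStandard k b S) = ⊥ :=
  hc.tr_eq_bot_iff_skew.1 tr_quotient_tr

theorem exists_classStandard_surjective_skew (hc : ClassCompatible a b) (L : Sim A) :
    ∃ S, a L = b S ∧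
      ∃ f : ClassStandard k b S →ₗ[A] ClassStandard k a L, Function.Surjective f := by
  obtain ⟨S, hS, i, p, hpi⟩ := hc.exists_projCover_retract (k := k) L
  refine ⟨S, hS, ?_⟩
  let q : projCover k S →ₗ[A] ClassStandard k a L := Submodule.mkQ _ ∘ₗ p
  have hps : Function.Surjective p := fun y => ⟨i y, LinearMap.congr_fun hpi y⟩
  have hq : Function.Surjective q := (Submodule.mkQ_surjective _).comp hps
  obtain ⟨f, hf⟩ := exists_factor_quotient (tr k (b ⁻¹' Set.Ioi (b S)) (projCover k S)) q
    fun y hy => by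
      have hy : y ∈ tr k (a ⁻¹' Set.Ioi (a L)) (projCover k S) := hS ▸ hc.mem_tr_skew_iff.1 hy
      exact apply_eq_zero_of_mem_tr q tr_quotient_tr hy
  refine ⟨f, fun y => ?_⟩
  obtain ⟨z, rfl⟩ := hq y
  exact ⟨_, hf z⟩

/-- Upwards, a restricted class standard module is generated by its class and has nothing above it,
so it is covered by class standard modules over `A`. Downwards, those over `A` are quotients of
restricted ones. -/
theorem forall_isLayered_iff (hG : (Nat.card G : k) ≠ 0) (hc : ClassCompatible a b) :
    (∀ L, IsLayered k a (a L) (ClassStandard k a L)) ↔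
      ∀ S, IsLayered k b (b S) (ClassStandard k b S) := by
  constructor
  · intro h S
    exact (hc.isLayered_skew_iff hG).2 (isLayered_of_tr_eq_top h
      (hc.tr_singleton_classStandard S) (hc.tr_Ioi_classStandard S))
  · intro h L
    obtain ⟨S, hS, f, hf⟩ := hc.exists_classStandard_surjective_skew (k := k) L
    have : IsLayered k a (a L) (ClassStandard k b S) := by
      rw [hS]
      exact (hc.isLayered_skew_iff hG).1 (h S)
    exact this.of_surjective f hf

theorem forall_isSemisimple_iff (hG : (Nat.card G : k) ≠ 0) (hc : ClassCompatible a b) :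
    (∀ L, IsSemisimpleModule A (ClassStandard k a L)) ↔
      ∀ S, IsSemisimpleModule (SkewMonoidAlgebra A G) (ClassStandard k b S) := by
  have : IsArtinianRing A := IsArtinianRing.of_finite k A
  constructor
  · intro h S
    exact (isSemisimple_skew_iff hG).2 (isSemisimpleModule_of_tr_eq_top h
      (hc.tr_singleton_classStandard S) (hc.tr_Ioi_classStandard S))
  · intro h L
    obtain ⟨S, hS, f, hf⟩ := hc.exists_classStandard_surjective_skew (k := k) L
    have := (isSemisimple_skew_iff hG).1 (h S)
    exact IsSemisimpleModule.of_surjective f hf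

/-- Quotients lose projectivity, so direct summands are used both ways: a restricted `P_S` is a
summand of a sum of modules `P_L`, and `P_L` is a summand of some restricted `P_S`. -/
theorem forall_projective_iff (hG : (Nat.card G : k) ≠ 0) (hc : ClassCompatible a b) :
    (∀ L, Module.Projective A (tr k (a ⁻¹' Set.Ioi (a L)) (projCover k L))) ↔
      ∀ S, Module.Projective (SkewMonoidAlgebra A G)
        (tr k (b ⁻¹' Set.Ioi (b S)) (projCover k S)) := by
  constructor
  · intro h S
    have : Module.Projective A (projCover k S) := projective_of_projective_skew (G := G)
    have := projective_tr_of_tr_eq_top h (hc.tr_singleton_projCover (k := k) S)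
    have : Module.Projective A (tr k (b ⁻¹' Set.Ioi (b S)) (projCover k S)) :=
      Module.Projective.of_equiv (hc.trEquiv (k := k) (projCover k S) (Set.Ioi (b S))).symm
    exact projective_skew_of_projective hG
  · intro h L
    obtain ⟨S, hS, i, p, hpi⟩ := hc.exists_projCover_retract (k := k) L
    have := h S
    have : Module.Projective A (tr k (b ⁻¹' Set.Ioi (b S)) (projCover k S)) :=
      projective_of_projective_skew (G := G)
    have : Module.Projective A (tr k (a ⁻¹' Set.Ioi (b S)) (projCover k S)) :=
      Module.Projective.of_equiv (hc.trEquiv (k := k) (projCover k S) (Set.Ioi (b S)))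
    rw [hS]
    exact projective_tr_of_retract i p hpi

/-- Over `A` the skew group algebra is a direct sum of copies of `A`, so lifts over `A` exist;
averaging makes them linear over `A * G`. -/
theorem isStratifying_skew (hG : (Nat.card G : k) ≠ 0) (hc : ClassCompatible a b)
    (h : IsStratifying.{u, w, x} k a) : IsStratifying.{max u v, w, x} k b := by
  intro U c hU hcU hV N₁ N₂ _ _ _ _ g hg hN f
  -- The test modules carry only an action of `A * G`; they are given the restricted action of `A`.
  let m₁ : Module A N₁ := Module.compHom N₁ (singleOneRingHom : A →+* SkewMonoidAlgebra A G)
  let m₂ : Module A N₂ := Module.compHom N₂ (singleOneRingHom : A →+* SkewMonoidAlgebra A G)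
  have hmul : ∀ (r : A) (c : SkewMonoidAlgebra A G), r • c = single (1 : G) r * c := fun r c => by
    exact (single_one_smul (G := G) r c).symm
  have t₁ : IsScalarTower A (SkewMonoidAlgebra A G) N₁ :=
    ⟨fun r c n => by rw [hmul, mul_smul]; rfl⟩
  have t₂ : IsScalarTower A (SkewMonoidAlgebra A G) N₂ :=
    ⟨fun r c n => by rw [hmul, mul_smul]; rfl⟩
  have h1 : RelProj.{u, w, x} k (a ⁻¹' U)
      (tr k (a ⁻¹' insert c U) (Π₀ _ : G, A)) :=
    RelProj.tr_dfinsupp fun _ => h U c hU hcU hV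
  classical
  let e : SkewMonoidAlgebra A G ≃ₗ[A] Π₀ _ : G, A :=
    basisSingleOne.repr.trans (finsuppLequivDFinsupp A)
  have h2 : RelProj.{u, w, x} k (a ⁻¹' U)
      (tr k (a ⁻¹' insert c U) (SkewMonoidAlgebra A G)) :=
    h1.tr_of_retract e.toLinearMap e.symm.toLinearMap (by ext; simp)
  let e' := hc.trEquiv (k := k) (SkewMonoidAlgebra A G) (insert c U)
  obtain ⟨f', hf'⟩ := h2 N₁ N₂ (g.restrictScalars A) hg (hc.tr_eq_bot_of_skew hN)
    (f.restrictScalars A ∘ₗ e'.symm.toLinearMap)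
  refine exists_lift_of_restrictScalars hG g f (f' ∘ₗ e'.toLinearMap) fun y => ?_
  have := LinearMap.congr_fun hf' (e' y)
  simpa using this

/-- `A` is the direct summand of `A * G` at the unit of the group. -/
theorem isStratifying_of_skew (hc : ClassCompatible a b)
    (h : IsStratifying.{max u v, w, max u v} k b) : IsStratifying.{u, w, x} k a := by
  intro U c hU hcU hV
  have : IsArtinianRing (SkewMonoidAlgebra A G) := IsArtinianRing.of_finite k _
  have hQ : RelProj.{u, w, x} k (a ⁻¹' U) (tr k (b ⁻¹' insert c U) (SkewMonoidAlgebra A G)) :=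
    hc.relProj_of_skew (h U c hU hcU hV)
  let e' := hc.trEquiv (k := k) (SkewMonoidAlgebra A G) (insert c U)
  have hQ' : RelProj.{u, w, x} k (a ⁻¹' U)
      (tr k (a ⁻¹' insert c U) (SkewMonoidAlgebra A G)) :=
    hQ.of_retract e'.symm.toLinearMap e'.toLinearMap
      (LinearMap.ext fun y => e'.apply_symm_apply y)
  let β : Module.Basis G A (SkewMonoidAlgebra A G) := basisSingleOne
  refine hQ'.tr_of_retract (LinearMap.toSpanSingleton A _ (β 1)) (β.coord 1) ?_
  ext
  simp

end Order

end ClassCompatible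

end QuasiHereditary

namespace QuasiHereditary
universe u v w

open SkewMonoidAlgebra

/-! ### The equivalences for compatible classes. -/

section Comparison

variable {A : Type u} [Ring A] {G : Type v} [Group G] [MulSemiringAction G A]
  {k : Type w} [Field k] [Algebra k A] [FiniteDimensional k A] [Finite G]
  [SMulCommClass G k A] {X : Type*} [PartialOrder X] {a : Sim A → X}
  {b : Sim (SkewMonoidAlgebra A G) → X}

namespace ClassCompatible

theorem isQuasiHereditary_iff [IsAlgClosed k] [Finite X] (hG : (Nat.card G : k) ≠ 0)
    (hc : ClassCompatible a b) (o : PartialOrder (Sim A)) (ha : ∀ L L', o.lt L L' ↔ a L < a L')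
    (o' : PartialOrder (Sim (SkewMonoidAlgebra A G))) (hb : ∀ S S', o'.lt S S' ↔ b S < b S') :
    IsQuasiHereditary k o ↔ IsQuasiHereditary k o' := by
  constructor
  · intro h
    obtain ⟨h1, h2⟩ := h.isLayered_and_isStratifying o ha
    exact isQuasiHereditary_of_isLayered o' hb ((hc.forall_isLayered_iff hG).1 h1)
      (hc.isStratifying_skew hG h2)
  · intro h
    obtain ⟨h1, h2⟩ := h.isLayered_and_isStratifying o' hb
    exact isQuasiHereditary_of_isLayered o ha ((hc.forall_isLayered_iff hG).2 h1)
      (hc.isStratifying_of_skew h2)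

theorem isStronglyQuasiHereditary_iff [IsAlgClosed k] [Finite X] (hG : (Nat.card G : k) ≠ 0)
    (hc : ClassCompatible a b) (o : PartialOrder (Sim A)) (ha : ∀ L L', o.lt L L' ↔ a L < a L')
    (o' : PartialOrder (Sim (SkewMonoidAlgebra A G))) (hb : ∀ S S', o'.lt S S' ↔ b S < b S') :
    IsStronglyQuasiHereditary k o ↔ IsStronglyQuasiHereditary k o' := by
  have key := hc.isQuasiHereditary_iff hG o ha o' hb
  rw [IsStronglyQuasiHereditary, IsStronglyQuasiHereditary, ← key, and_congr_right_iff]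
  intro h
  have h1 := (h.isLayered_and_isStratifying.{u, w, u} o ha).1
  have h2 := ((key.1 h).isLayered_and_isStratifying.{max u v, w, u} o' hb).1
  rw [forall_congr' (hasProjectiveDimensionLE_standard_iff o ha h1),
    forall_congr' (hasProjectiveDimensionLE_standard_iff o' hb h2)]
  exact hc.forall_projective_iff hG

theorem isDirectedAlgebra_iff (hG : (Nat.card G : k) ≠ 0) (hc : ClassCompatible a b)
    (o : PartialOrder (Sim A)) (ha : ∀ L L', o.lt L L' ↔ a L < a L')
    (o' : PartialOrder (Sim (SkewMonoidAlgebra A G))) (hb : ∀ S S', o'.lt S S' ↔ b S < b S') :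
    IsDirectedAlgebra k o ↔ IsDirectedAlgebra k o' := by
  rw [QuasiHereditary.isDirectedAlgebra_iff o ha, QuasiHereditary.isDirectedAlgebra_iff o' hb]
  exact hc.forall_isSemisimple_iff hG

end ClassCompatible

/-- An order that is compatible with a map descends along it. -/
theorem exists_partialOrder_lt_iff {Y X : Type*} (o : PartialOrder Y) (a : Y → X)
    (h : ∀ y z y' z', a y = a y' → a z = a z' → o.lt y z → o.lt y' z') :
    ∃ p : PartialOrder X, ∀ y z, o.lt y z ↔ p.lt (a y) (a z) := by
  refine ⟨orderOfLT (fun x x' => ∃ y z, a y = x ∧ a z = x' ∧ o.lt y z) ?_ ?_, fun y z => ?_⟩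
  · rintro _ ⟨y, z, rfl, hz, hyz⟩
    exact lt_irrefl y (h y z y y rfl hz hyz)
  · rintro _ _ _ ⟨y, z, rfl, rfl, hyz⟩ ⟨z', w, hz, rfl, hzw⟩
    exact ⟨y, w, rfl, rfl, lt_trans hyz (h z' w z w hz rfl hzw)⟩
  · refine ⟨fun hyz => ⟨y, z, rfl, rfl, hyz⟩, ?_⟩
    rintro ⟨y', z', hy, hz, hyz⟩
    exact h y' z' y z hy hz hyz

end Comparison

/-! ### Summands of semisimple modules. -/

section Semisimple

variable {R : Type u} [Ring R] {L : Sim R} {M : Type*} [AddCommGroup M] [Module R M]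

theorem isSummand_of_ne_zero [IsSemisimpleModule R M] {f : L.module →ₗ[R] M} (hf : f ≠ 0) :
    IsSummand R L.module M := by
  obtain ⟨p, hp⟩ := IsSemisimpleModule.extension_property f (LinearMap.injective_of_ne_zero hf)
    LinearMap.id
  exact ⟨f, p, hp⟩

theorem isSummand_of_ne_zero' [IsSemisimpleModule R M] {p : M →ₗ[R] L.module} (hp : p ≠ 0) :
    IsSummand R L.module M := by
  obtain ⟨f, hf⟩ := IsSemisimpleModule.lifting_property p (LinearMap.surjective_of_ne_zero hp)
    LinearMap.id
  exact ⟨f, p, hf⟩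

theorem IsSummand.exists_ne_zero (h : IsSummand R L.module M) :
    ∃ (f : L.module →ₗ[R] M) (p : M →ₗ[R] L.module), f ≠ 0 ∧ p ≠ 0 := by
  have : Nontrivial L.module := IsSimpleModule.nontrivial R L.module
  obtain ⟨x, hx⟩ := exists_ne (0 : L.module)
  obtain ⟨f, p, h⟩ := h
  have h := LinearMap.congr_fun h x
  refine ⟨f, p, ?_, ?_⟩ <;> rintro rfl <;> exact hx (by simpa using h.symm)

theorem isCompositionFactor_iff_isSummand [IsSemisimpleModule R M] :
    IsCompositionFactor L M ↔ IsSummand R L.module M := by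
  constructor
  · rintro ⟨N, f, hf⟩
    obtain ⟨s, hs⟩ := IsSemisimpleModule.lifting_property N.mkQ N.mkQ_surjective f
    have : Nontrivial L.module := IsSimpleModule.nontrivial R L.module
    refine isSummand_of_ne_zero (f := s) ?_
    rintro rfl
    obtain ⟨x, hx⟩ := exists_ne (0 : L.module)
    exact hx (hf (by simp [← hs]))
  · rintro ⟨f, p, h⟩
    refine ⟨⊥, (⊥ : Submodule R M).mkQ ∘ₗ f, ?_⟩
    refine Function.Injective.comp (g := (⊥ : Submodule R M).mkQ) ?_
      (Function.LeftInverse.injective (LinearMap.congr_fun h))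
    rw [← LinearMap.ker_eq_bot, Submodule.ker_mkQ]

end Semisimple

end QuasiHereditary

namespace QuasiHereditary
universe u v w

open SkewMonoidAlgebra

/-! ### Clifford theory: orbits of simple modules. -/

section Orbits

variable (A : Type u) [Ring A] (G : Type v) [Group G] [MulSemiringAction G A]

/-- The simple modules `L` and `gL` are identified, for all `g`. -/
def orbitSetoid : Setoid (Sim A) where
  r L L' := ∃ (g : G) (e : L.module ≃+ L'.module), ∀ (c : A) x, e (c • x) = (g • c) • e x
  iseqv := by
    refine ⟨fun L => ⟨1, AddEquiv.refl _, by simp⟩, ?_, ?_⟩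
    · rintro L L' ⟨g, e, he⟩
      refine ⟨g⁻¹, e.symm, fun c x => ?_⟩
      rw [AddEquiv.symm_apply_eq, he, smul_inv_smul, e.apply_symm_apply]
    · rintro L L' L'' ⟨g, e, he⟩ ⟨h, f, hf⟩
      exact ⟨h * g, e.trans f, fun c x => by simp [he, hf, mul_smul]⟩

/-- The classes of simple modules up to twists. -/
def SimOrbit : Type u := Quotient (orbitSetoid A G)

/-- The class of a simple module up to twists. -/
def orbit (L : Sim A) : SimOrbit A G := Quotient.mk _ L

variable {A G}

theorem orbit_eq_iff {L L' : Sim A} : orbit A G L = orbit A G L' ↔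
    ∃ (g : G) (e : L.module ≃+ L'.module), ∀ (c : A) x, e (c • x) = (g • c) • e x :=
  Quotient.eq

theorem orbit_eq_of_semilinear {L L' : Sim A} {g : G}
    {e : L.module →ₛₗ[MulSemiringAction.toRingHom G A g] L'.module} (he : Function.Bijective e) :
    orbit A G L = orbit A G L' :=
  orbit_eq_iff.2 ⟨g, AddEquiv.ofBijective e he, fun c x => e.map_smulₛₗ c x⟩

theorem orbit_eq_of_semilinear_ne_zero {L L' : Sim A} {g : G}
    {e : L.module →ₛₗ[MulSemiringAction.toRingHom G A g] L'.module} (he : e ≠ 0) :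
    orbit A G L = orbit A G L' := by
  refine orbit_eq_of_semilinear (e := e) ⟨?_, ?_⟩
  · rw [← LinearMap.ker_eq_bot]
    exact (eq_bot_or_eq_top _).resolve_right fun h => he (LinearMap.ker_eq_top.1 h)
  · rw [← LinearMap.range_eq_top]
    exact (eq_bot_or_eq_top _).resolve_left fun h => he (LinearMap.range_eq_bot.1 h)

variable {N : Type*} [AddCommGroup N] [Module A N] [Module (SkewMonoidAlgebra A G) N]
  [IsScalarTower A (SkewMonoidAlgebra A G) N] {L L' : Sim A}

/-- If all `p ∘ g ∘ f` vanish, `f` lands in the common kernel `T` of the maps `p ∘ g`. This is a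
submodule over `A * G`, so it is zero, which forces `f = 0`, or everything, which forces `p = 0`. -/
theorem orbit_eq_of_hom [IsSimpleModule (SkewMonoidAlgebra A G) N] {f : L.module →ₗ[A] N}
    {p : N →ₗ[A] L'.module} (hf : f ≠ 0) (hp : p ≠ 0) : orbit A G L = orbit A G L' := by
  by_contra h
  have key : ∀ (g : G) x, p ((single g (1 : A) : SkewMonoidAlgebra A G) • f x) = 0 :=
    fun g x => by
      by_contra hx
      refine h (orbit_eq_of_semilinear_ne_zero (g := g) (e := (p.comp (gAct A N g)).comp f) ?_)
      exact fun h0 => hx (LinearMap.congr_fun h0 x)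
  let T : Submodule (SkewMonoidAlgebra A G) N :=
    toSkew (⨅ g : G, (LinearMap.ker p).comap (gAct A N g)) fun g n hn => by
      rw [Submodule.mem_iInf] at hn ⊢
      intro h
      have := hn (h * g)
      change p ((single h (1 : A) : SkewMonoidAlgebra A G) •
        (single g (1 : A) : SkewMonoidAlgebra A G) • n) = 0
      rw [single_smul_single_smul]
      exact this
  have hT : ∀ n, n ∈ T ↔ ∀ g : G, p ((single g (1 : A) : SkewMonoidAlgebra A G) • n) = 0 :=
    fun n => Submodule.mem_iInf _
  rcases eq_bot_or_eq_top T with hb | ht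
  · refine hf (LinearMap.ext fun x => ?_)
    have : f x ∈ T := (hT _).2 fun g => key g x
    rwa [hb] at this
  · refine hp (LinearMap.ext fun n => ?_)
    have := (hT n).1 (ht ▸ Submodule.mem_top) 1
    rwa [single_one_one_smul] at this

theorem exists_hom_ne_zero_of_orbit_eq (h : orbit A G L = orbit A G L') {f : L.module →ₗ[A] N}
    (hf : f ≠ 0) : ∃ f' : L'.module →ₗ[A] N, f' ≠ 0 := by
  obtain ⟨g, e, he⟩ := orbit_eq_iff.1 h
  have he' : ∀ (c : A) x, e.symm (c • x) = (g⁻¹ • c) • e.symm x := fun c x => by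
    rw [AddEquiv.symm_apply_eq, he, smul_inv_smul, e.apply_symm_apply]
  refine ⟨{ toFun := fun x => (single g (1 : A) : SkewMonoidAlgebra A G) • f (e.symm x)
            map_add' := fun x y => by rw [map_add, map_add, smul_add]
            map_smul' := fun c x => by
              rw [he', map_smul, single_smul_smul, smul_inv_smul, RingHom.id_apply] },
    fun h0 => hf (LinearMap.ext fun x => ?_)⟩
  have h1 : (single g (1 : A) : SkewMonoidAlgebra A G) • f (e.symm (e x)) = 0 :=
    LinearMap.congr_fun h0 (e x)
  rw [e.symm_apply_apply] at h1
  have h2 := congrArg (fun n => (single g⁻¹ (1 : A) : SkewMonoidAlgebra A G) • n) h1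
  simp only [single_smul_single_smul, inv_mul_cancel, single_one_one_smul, smul_zero] at h2
  exact h2

variable [IsArtinianRing A] [Finite G]

theorem exists_isSummand_skew (S : Sim (SkewMonoidAlgebra A G)) :
    ∃ L : Sim A, IsSummand A L.module S.module :=
  have : IsSemisimpleModule A S.module := isSemisimpleModule_of_isSimpleModule_skew (G := G)
  have : Nontrivial S.module := IsSimpleModule.nontrivial (SkewMonoidAlgebra A G) S.module
  exists_isSummand S.module

/-- The class of the simple direct summands of the restriction of `S`. -/
noncomputable def skewOrbit (S : Sim (SkewMonoidAlgebra A G)) : SimOrbit A G :=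
  orbit A G (exists_isSummand_skew S).choose

/-- One direction is `orbit_eq_of_hom`; for the other, group elements acting on `S` carry a
constituent to all its twists. -/
theorem isSummand_skew_iff (L : Sim A) (S : Sim (SkewMonoidAlgebra A G)) :
    IsSummand A L.module S.module ↔ orbit A G L = skewOrbit S := by
  have : IsSemisimpleModule A S.module := isSemisimpleModule_of_isSimpleModule_skew (G := G)
  obtain ⟨f₀, p₀, hf₀, hp₀⟩ := (exists_isSummand_skew S).choose_spec.exists_ne_zero
  constructor
  · intro h
    obtain ⟨f, -, hf, -⟩ := h.exists_ne_zero
    exact orbit_eq_of_hom hf hp₀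
  · intro h
    obtain ⟨f, hf⟩ := exists_hom_ne_zero_of_orbit_eq h.symm hf₀
    exact isSummand_of_ne_zero hf

theorem classCompatible_orbit : ClassCompatible (orbit A G) (skewOrbit (A := A) (G := G)) where
  eq_iff L S := by
    have : IsSemisimpleModule A S.module := isSemisimpleModule_of_isSimpleModule_skew (G := G)
    rw [isCompositionFactor_iff_isSummand, isSummand_skew_iff]
  eq_of_semilinear _ _ _ _ he := orbit_eq_of_semilinear he

theorem isSummand_resG_iff (L : Sim A) (S : Sim (SkewMonoidAlgebra A G)) :
    IsSummand A L.module (ResG A G S.module) ↔ orbit A G L = skewOrbit S := by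
  rw [← isSummand_skew_iff]
  let e := resEquiv A G S.module
  constructor
  · rintro ⟨i, p, h⟩
    exact ⟨e.symm.toLinearMap ∘ₗ i, p ∘ₗ e.toLinearMap, by
      ext; simpa using LinearMap.congr_fun h _⟩
  · rintro ⟨i, p, h⟩
    exact ⟨e.toLinearMap ∘ₗ i, p ∘ₗ e.symm.toLinearMap, by
      ext; simpa using LinearMap.congr_fun h _⟩

end Orbits

/-! ### The induced order on `Sim (A * G)`. -/

section Induced

variable {A : Type u} [Ring A] {G : Type v} [Group G] [MulSemiringAction G A]

/-- Members of the orbit of `L` are isomorphic to twists of `L`, and equivariance allows independent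
twists on the two sides. -/
theorem lt_of_orbit_eq {o : PartialOrder (Sim A)} (ho : IsEquivariant G o) {L L' K K' : Sim A}
    (h : orbit A G L = orbit A G K) (h' : orbit A G L' = orbit A G K') (hlt : o.lt L L') :
    o.lt K K' := by
  have key : ∀ {L K : Sim A}, orbit A G L = orbit A G K →
      ∃ g : G, IsSummand A K.module (Twist (A := A) g L.module) := by
    intro L K h
    obtain ⟨g, e, he⟩ := orbit_eq_iff.1 h
    let p : Twist (A := A) g L.module →ₗ[A] K.module :=
      { toFun := fun x => e x
        map_add' := fun x y => e.map_add x y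
        map_smul' := fun c x => by
          change e ((g⁻¹ • c) • (show L.module from x)) = _
          rw [he, smul_inv_smul]
          rfl }
    let e' : Twist (A := A) g L.module ≃ₗ[A] K.module := LinearEquiv.ofBijective p e.bijective
    exact ⟨g, e'.symm.toLinearMap, e'.toLinearMap, by
      ext; simp⟩
  obtain ⟨g, hg⟩ := key h
  obtain ⟨g', hg'⟩ := key h'
  exact (ho L L' g g').1 hlt K K' hg hg'

variable {k : Type w} [Field k] [Algebra k A] [FiniteDimensional k A] [Finite G]

theorem inducedOrder_lt_iff [PartialOrder (SimOrbit A G)] (o : PartialOrder (Sim A))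
    (ho : ∀ L L' : Sim A, o.lt L L' ↔ orbit A G L < orbit A G L')
    [IsArtinianRing A] (S S' : Sim (SkewMonoidAlgebra A G)) :
    (inducedOrder G k o).lt S S' ↔ skewOrbit S < skewOrbit S' := by
  change SemisimpleLT o (ResG A G S.module) (ResG A G S'.module) ↔ _
  simp only [SemisimpleLT, isSummand_resG_iff, ho]
  constructor
  · intro h
    exact h _ _ rfl rfl
  · intro h L L' hL hL'
    rwa [hL, hL']

end Induced

end QuasiHereditary

namespace QuasiHereditary
universe u v w

open SkewMonoidAlgebra

/-! ### Frobenius reciprocity for induced modules. -/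

section Frobenius

variable {A : Type u} [Ring A] {G : Type v} [Group G] [MulSemiringAction G A]
  {L : Type*} [AddCommGroup L] [Module A L] {N : Type*} [AddCommGroup N] [Module A N]
  [Module (SkewMonoidAlgebra A G) N] [IsScalarTower A (SkewMonoidAlgebra A G) N]

theorem Ind.induction {G : Type*} {L : Type*} [AddCommGroup L] {p : Ind G L → Prop} (y : Ind G L) (zero : p 0)
    (add : ∀ y z, p y → p z → p (y + z)) (single : ∀ (g : G) x, p (Ind.single g x)) : p y :=
  Finsupp.induction_linear (motive := p) y zero add single

/-- The homomorphism on the induced module given by a homomorphism over `A`. -/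
noncomputable def Ind.lift (f : L →ₗ[A] N) : Ind G L →ₗ[SkewMonoidAlgebra A G] N :=
  let F : Ind G L →+ N := Finsupp.liftAddHom fun g : G =>
    (DistribSMul.toAddMonoidHom N (SkewMonoidAlgebra.single g (1 : A) : SkewMonoidAlgebra A G)).comp f.toAddMonoidHom
  have hF : ∀ (g : G) x, F (Ind.single g x) = (SkewMonoidAlgebra.single g (1 : A) : SkewMonoidAlgebra A G) • f x :=
    fun g x => Finsupp.liftAddHom_apply_single _ g x
  { toFun := F
    map_add' := F.map_add
    map_smul' := fun c y => by
      induction y using Ind.induction with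
      | zero => simp
      | add y z hy hz => rw [smul_add, map_add, hy, hz, RingHom.id_apply, map_add, smul_add]
      | single g x =>
        induction c using SkewMonoidAlgebra.induction_on with
        | zero => simp
        | add p q hp hq => rw [add_smul, map_add, hp, hq, RingHom.id_apply, RingHom.id_apply,
            RingHom.id_apply, add_smul]
        | single h c =>
          rw [Ind.single_smul_single, hF, RingHom.id_apply, hF, map_smul, single_smul_smul,
            smul_inv_smul, single_eq h c, mul_smul, single_one_smul, single_smul_single_smul] }

theorem Ind.lift_single (f : L →ₗ[A] N) (g : G) (x : L) :
    Ind.lift f (Ind.single g x) = (SkewMonoidAlgebra.single g (1 : A) : SkewMonoidAlgebra A G) • f x :=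
  Finsupp.liftAddHom_apply_single _ g x

/-- Only the nonvanishing of the two sides of Frobenius reciprocity is needed: it detects summands
of semisimple modules. -/
theorem exists_ind_hom_ne_zero_iff : (∃ φ : Ind G L →ₗ[SkewMonoidAlgebra A G] N, φ ≠ 0) ↔
    ∃ f : L →ₗ[A] N, f ≠ 0 := by
  constructor
  · rintro ⟨φ, hφ⟩
    refine ⟨{ toFun := fun x => φ (Ind.single 1 x)
              map_add' := fun x y => by
                rw [← map_add]
                exact congrArg φ (Finsupp.single_add 1 x y)
              map_smul' := fun c x => by
                rw [RingHom.id_apply, ← single_one_smul (G := G) c (φ _), ← map_smul,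
                  Ind.single_smul_single]
                simp }, fun h0 => hφ (LinearMap.ext fun y => ?_)⟩
    induction y using Ind.induction with
    | zero => simp
    | add y z hy hz => rw [map_add, hy, hz, map_add]
    | single g x =>
      have h1 : φ (Ind.single 1 x) = 0 := LinearMap.congr_fun h0 x
      have h2 : Ind.single g x = (SkewMonoidAlgebra.single g (1 : A) : SkewMonoidAlgebra A G) • Ind.single 1 x := by
        rw [Ind.single_smul_single]
        simp
      rw [h2, map_smul, h1, smul_zero]
      rfl
  · rintro ⟨f, hf⟩
    refine ⟨Ind.lift f, fun h0 => hf (LinearMap.ext fun x => ?_)⟩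
    have h1 := LinearMap.congr_fun h0 (Ind.single 1 x)
    rw [Ind.lift_single, single_one_one_smul] at h1
    exact h1

end Frobenius

/-! ### The order on `Sim A` obtained from one on `Sim (A * G)`. -/

section Restricted

variable {A : Type u} [Ring A] {G : Type v} [Group G] [MulSemiringAction G A]
  {k : Type w} [Field k] [Algebra k A] [Finite G] [SMulCommClass G k A]

theorem isSummand_ind_iff [IsArtinianRing A] (hG : (Nat.card G : k) ≠ 0) (L : Sim A)
    (S : Sim (SkewMonoidAlgebra A G)) :
    IsSummand (SkewMonoidAlgebra A G) S.module (Ind G L.module) ↔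
      orbit A G L = skewOrbit S := by
  have : IsSemisimpleModule A (ResG A G (Ind G L.module)) := Ind.isSemisimple_res _
  have : IsSemisimpleModule (SkewMonoidAlgebra A G) (Ind G L.module) := isSemisimple_of_ResG hG _
  have : IsSemisimpleModule A S.module := isSemisimpleModule_of_isSimpleModule_skew (G := G)
  rw [← isSummand_skew_iff]
  constructor
  · intro h
    obtain ⟨-, p, -, hp⟩ := h.exists_ne_zero
    obtain ⟨f, hf⟩ := (exists_ind_hom_ne_zero_iff (A := A)).1 ⟨p, hp⟩
    exact isSummand_of_ne_zero hf
  · intro h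
    obtain ⟨f, -, hf, -⟩ := h.exists_ne_zero
    obtain ⟨p, hp⟩ := (exists_ind_hom_ne_zero_iff (G := G)).2 ⟨f, hf⟩
    exact isSummand_of_ne_zero' hp

theorem restrictedOrder_lt_iff [PartialOrder (SimOrbit A G)] [FiniteDimensional k A]
    [IsArtinianRing A] (hG : (Nat.card G : k) ≠ 0) (o : PartialOrder (Sim (SkewMonoidAlgebra A G)))
    (ho : ∀ S S' : Sim (SkewMonoidAlgebra A G), o.lt S S' ↔ skewOrbit S < skewOrbit S')
    (L L' : Sim A) :
    (restrictedOrder hG o).lt L L' ↔ orbit A G L < orbit A G L' := by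
  change SemisimpleLT o (Ind G L.module) (Ind G L'.module) ↔ _
  simp only [SemisimpleLT, isSummand_ind_iff hG, ho]
  constructor
  · intro h
    -- `h` quantifies over simple `A * G`-modules in the two orbits, so such modules must be
    -- exhibited.
    obtain ⟨S, hS⟩ := (classCompatible_orbit (G := G)).exists_class_eq k L
    obtain ⟨S', hS'⟩ := (classCompatible_orbit (G := G)).exists_class_eq k L'
    rw [hS, hS']
    exact h S S' hS hS'
  · intro h S S' hS hS'
    rwa [← hS, ← hS']

end Restricted

/-! ### Tensor products with the regular representation. -/

section Tensor

variable {A : Type u} [Ring A] {G : Type v} [Group G] [MulSemiringAction G A]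
  {k : Type w} [Field k] [Algebra k A] [SMulCommClass G k A]
  {V : Type*} [AddCommGroup V] [Module k V] (ρ : Representation k G V)
  {S : Type*} [AddCommGroup S] [Module k S] [Module A S] [Module (SkewMonoidAlgebra A G) S]
  [IsScalarTower k (SkewMonoidAlgebra A G) S] [IsScalarTower A (SkewMonoidAlgebra A G) S]

open TensorProduct

theorem TensorRep.induction {V : Type*} [AddCommGroup V] [Module k V] {ρ : Representation k G V}
    {S : Type*} [AddCommGroup S] [Module k S] {p : TensorRep ρ S → Prop} (t : TensorRep ρ S)
    (zero : p 0) (add : ∀ x y, p x → p y → p (x + y))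
    (tmul : ∀ s v, p (TensorRep.tmul ρ s v)) : p t :=
  TensorProduct.induction_on (motive := p) t zero tmul add

variable (A G S) in
/-- The map `s ↦ s ⊗ v`. -/
def TensorRep.mk (v : V) : S →ₗ[A] ResG A G (TensorRep ρ S) where
  toFun s := TensorRep.tmul ρ s v
  map_add' s t := TensorProduct.add_tmul s t v
  map_smul' c s := by
    have := TensorRep.single_smul_tmul (A := A) ρ 1 c s v
    rw [single_one_smul c s, map_one] at this
    exact this.symm

theorem TensorRep.isSemisimpleModule [Finite G] [IsSemisimpleModule A S]
    (hG : (Nat.card G : k) ≠ 0) :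
    IsSemisimpleModule (SkewMonoidAlgebra A G) (TensorRep ρ S) := by
  have : IsSemisimpleModule A (ResG A G (TensorRep ρ S)) := by
    refine isSemisimpleModule_of_isSemisimpleModule_submodule'
      (p := fun v : V => LinearMap.range (TensorRep.mk A G ρ S v))
      (fun v => IsSemisimpleModule.range _) ?_
    rw [eq_top_iff]
    rintro t -
    induction t using TensorRep.induction with
    | zero => exact Submodule.zero_mem _
    | tmul s v => exact Submodule.mem_iSup_of_mem v ⟨s, rfl⟩
    | add x y hx hy => exact Submodule.add_mem _ hx hy
  exact isSemisimple_of_ResG hG _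

/-- The regular representation, on functions on a set in bijection with `G`. -/
def regularRep (k : Type w) [Field k] {ι : Type*} (e : ι ≃ G) : Representation k G (ι → k) where
  toFun g :=
    { toFun := fun f i => f (e.symm (g⁻¹ * e i))
      map_add' := fun _ _ => rfl
      map_smul' := fun _ _ => rfl }
  map_one' := by
    ext
    simp
  map_mul' g h := by
    ext
    simp [mul_assoc]

variable {S' : Type*} [AddCommGroup S'] [Module k S'] [Module A S']
  [Module (SkewMonoidAlgebra A G) S'] [IsScalarTower k (SkewMonoidAlgebra A G) S']
  [IsScalarTower A (SkewMonoidAlgebra A G) S'] [IsScalarTower k A S] [IsScalarTower k A S']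

variable (G k) in
/-- The conjugate of an `A`-linear map by an element of the group. -/
noncomputable def conjHom (p : S →ₗ[A] S') (h : G) : S →ₗ[k] S' where
  toFun s := (single h (1 : A) : SkewMonoidAlgebra A G) •
    p ((single h⁻¹ (1 : A) : SkewMonoidAlgebra A G) • s)
  map_add' s t := by rw [smul_add, map_add, smul_add]
  map_smul' c s := by
    rw [smul_comm _ c s, LinearMap.map_smul_of_tower, smul_comm _ c, RingHom.id_apply]

theorem conjHom_single_smul (p : S →ₗ[A] S') (g h : G) (c : A) (s : S) :
    conjHom G k p (g * h) ((single g c : SkewMonoidAlgebra A G) • s) =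
      (single g c : SkewMonoidAlgebra A G) • conjHom G k p h s := by
  change (single (g * h) (1 : A) : SkewMonoidAlgebra A G) •
      p ((single (g * h)⁻¹ (1 : A) : SkewMonoidAlgebra A G) •
        (single g c : SkewMonoidAlgebra A G) • s) =
    (single g c : SkewMonoidAlgebra A G) • (single h (1 : A) : SkewMonoidAlgebra A G) •
      p ((single h⁻¹ (1 : A) : SkewMonoidAlgebra A G) • s)
  rw [single_eq g c, mul_smul, mul_smul, single_one_smul, single_one_smul, single_smul_smul,
    map_smul, single_smul_smul, smul_inv_smul, single_smul_single_smul, single_smul_single_smul,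
    mul_inv_rev, inv_mul_cancel_right]

/-- A homomorphism over `A` between modules over the skew group algebra extends to the tensor
product with the regular representation. -/
theorem exists_regularRep_hom [Finite G] {ι : Type*} (e : ι ≃ G) (p : S →ₗ[A] S') (hp : p ≠ 0) :
    ∃ q : TensorRep (regularRep k e) S →ₗ[SkewMonoidAlgebra A G] S', q ≠ 0 := by
  classical
  have := Fintype.ofFinite G
  -- The formula `s ⊗ f ↦ ∑ f(h) h p(h⁻¹ s)` is the isomorphism of `S ⊗ k^G` with `kG ⊗ S` followed
  -- by the map adjoint to `p`.
  let Q : S ⊗[k] (ι → k) →ₗ[k] S' := TensorProduct.lift <| LinearMap.mk₂ k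
    (fun s f => ∑ h : G, f (e.symm h) • conjHom G k p h s)
    (fun s t f => by simp only [map_add, smul_add, Finset.sum_add_distrib])
    (fun c s f => by simp only [map_smul, smul_comm _ c, Finset.smul_sum])
    (fun s f f' => by simp only [Pi.add_apply, add_smul, Finset.sum_add_distrib])
    (fun c s f => by simp only [Pi.smul_apply, smul_assoc, Finset.smul_sum])
  have hQ : ∀ s f, Q (s ⊗ₜ f) = ∑ h : G, f (e.symm h) • conjHom G k p h s := fun s f => rfl
  let F : TensorRep (regularRep k e) S →+ S' := Q.toAddMonoidHom
  have hF : ∀ s f, F (TensorRep.tmul _ s f) = ∑ h : G, f (e.symm h) • conjHom G k p h s :=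
    fun s f => rfl
  let q : TensorRep (regularRep k e) S →ₗ[SkewMonoidAlgebra A G] S' :=
    { toFun := F
      map_add' := F.map_add
      map_smul' := fun c t => by
        rw [RingHom.id_apply]
        induction t using TensorRep.induction with
        | zero => rw [smul_zero, map_zero, smul_zero]
        | add x y hx hy => rw [smul_add, map_add, hx, hy, map_add, smul_add]
        | tmul s f =>
          induction c using SkewMonoidAlgebra.induction_on with
          | zero => rw [zero_smul, map_zero, zero_smul]
          | add c d hc hd => rw [add_smul, map_add, hc, hd, add_smul]
          | single g c =>
            rw [TensorRep.single_smul_tmul, hF, hF, Finset.smul_sum]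
            refine (Fintype.sum_equiv (Equiv.mulLeft g) _ _ fun h => ?_).symm
            rw [Equiv.coe_mulLeft, smul_comm, conjHom_single_smul]
            simp [regularRep] }
  obtain ⟨s, hs⟩ : ∃ s, p s ≠ 0 := by
    by_contra! h
    exact hp (LinearMap.ext h)
  refine ⟨q, fun h0 => hs ?_⟩
  -- Evaluation at the delta function of the unit recovers `p s`.
  have h1 : Q (s ⊗ₜ Pi.single (e.symm 1) 1) = 0 := LinearMap.congr_fun h0 (TensorRep.tmul _ s _)
  rw [hQ, Finset.sum_eq_single 1] at h1
  · simpa [conjHom, single_one_one_smul] using h1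
  · intro h _ hh
    rw [Pi.single_eq_of_ne (by simpa using hh), zero_smul]
  · simp

end Tensor

end QuasiHereditary

namespace QuasiHereditary
universe u v w

open SkewMonoidAlgebra

/-! ### Stable orders depend only on orbits. -/

section Stable

variable {A : Type u} [Ring A] [IsArtinianRing A] {G : Type v} [Group G] [MulSemiringAction G A]
  {k : Type w} [Field k] [Algebra k A] [Finite G] [SMulCommClass G k A]

/-- `S` and `K` share a constituent `L` over `A`, and the nonzero composite `S → L → K` extends to
the tensor product. -/
theorem isSummand_tensorRep_regularRep (hG : (Nat.card G : k) ≠ 0) {ι : Type*} (e : ι ≃ G)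
    {S K : Sim (SkewMonoidAlgebra A G)} (h : skewOrbit S = skewOrbit K) :
    IsSummand (SkewMonoidAlgebra A G) K.module (TensorRep (regularRep k e) S.module) := by
  have : IsSemisimpleModule A S.module := isSemisimpleModule_of_isSimpleModule_skew (G := G)
  have := TensorRep.isSemisimpleModule (A := A) (regularRep k e) (S := S.module) hG
  obtain ⟨L, hL⟩ := exists_isSummand_skew S
  have hL' : IsSummand A L.module K.module := by
    rwa [isSummand_skew_iff, ← h, ← isSummand_skew_iff]
  obtain ⟨-, p, -, hp⟩ := hL.exists_ne_zero
  obtain ⟨f, -, hf, -⟩ := hL'.exists_ne_zero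
  obtain ⟨q, hq⟩ := exists_regularRep_hom (k := k) e (f ∘ₗ p) fun h0 => hf <|
    (LinearMap.cancel_right (LinearMap.surjective_of_ne_zero hp)).1
      (h0.trans (LinearMap.zero_comp p).symm)
  exact isSummand_of_ne_zero' hq

theorem lt_of_skewOrbit_eq (hG : (Nat.card G : k) ≠ 0)
    {o : PartialOrder (Sim (SkewMonoidAlgebra A G))} (ho : IsStable k o)
    {S S' K K' : Sim (SkewMonoidAlgebra A G)} (h : skewOrbit S = skewOrbit K)
    (h' : skewOrbit S' = skewOrbit K') (hlt : o.lt S S') : o.lt K K' := by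
  -- `IsStable` tests representations in the universe of `k`, so the regular representation is
  -- realised on functions on `Fin (Nat.card G)`.
  let e := (Finite.equivFin G).symm
  have : Nonempty (Fin (Nat.card G)) := ⟨e.symm 1⟩
  exact (ho S S' _ _ (regularRep k e) (regularRep k e)).1 hlt K K'
    (isSummand_tensorRep_regularRep hG e h) (isSummand_tensorRep_regularRep hG e h')

end Stable

end QuasiHereditary

theorem mainTheorem1 {k : Type*} [Field k] [IsAlgClosed k]
    {A : Type*} [Ring A] [Algebra k A] [FiniteDimensional k A]
    {G : Type*} [Group G] [Finite G] [MulSemiringAction G A] [SMulCommClass G k A]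
    (hG : (Nat.card G : k) ≠ 0) :
    (∀ o : PartialOrder (Sim A), IsEquivariant G o →
      (IsQuasiHereditary k o ↔ IsQuasiHereditary k (inducedOrder G k o)) ∧
      (IsStronglyQuasiHereditary k o ↔ IsStronglyQuasiHereditary k (inducedOrder G k o)) ∧
      (IsDirectedAlgebra k o ↔ IsDirectedAlgebra k (inducedOrder G k o))) ∧
    (∀ o : PartialOrder (Sim (SkewMonoidAlgebra A G)), IsStable k o →
      (IsQuasiHereditary k (restrictedOrder hG o) ↔ IsQuasiHereditary k o) ∧
      (IsStronglyQuasiHereditary k (restrictedOrder hG o) ↔ IsStronglyQuasiHereditary k o) ∧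
      (IsDirectedAlgebra k (restrictedOrder hG o) ↔ IsDirectedAlgebra k o)) := by
  have : IsArtinianRing A := IsArtinianRing.of_finite k A
  have : Finite (Sim A) := Sim.finite k
  have hc := classCompatible_orbit (A := A) (G := G)
  have : Finite (SimOrbit A G) := Quotient.finite _
  constructor
  · intro o ho
    -- The order on orbits from which the strict parts of `o` and of the induced order are pulled
    -- back.
    obtain ⟨_, ha⟩ := exists_partialOrder_lt_iff o (orbit A G) fun _ _ _ _ => lt_of_orbit_eq ho
    have hb := inducedOrder_lt_iff (k := k) o ha
    exact ⟨hc.isQuasiHereditary_iff hG o ha _ hb, hc.isStronglyQuasiHereditary_iff hG o ha _ hb,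
      hc.isDirectedAlgebra_iff hG o ha _ hb⟩
  · intro o ho
    obtain ⟨_, hb⟩ := exists_partialOrder_lt_iff o skewOrbit fun _ _ _ _ => lt_of_skewOrbit_eq hG ho
    have ha := restrictedOrder_lt_iff hG o hb
    exact ⟨hc.isQuasiHereditary_iff hG _ ha o hb, hc.isStronglyQuasiHereditary_iff hG _ ha o hb,
      hc.isDirectedAlgebra_iff hG _ ha o hb⟩
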